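/- Let $X_{n,b}$ be the smooth compact 3-manifold obtained from the connected sum $\#_n(S^1\times S^2)$ (which is $S^3$ for $n=0$) by removing $b\ge 0$ open 3-disks with disjoint closures, and write $X_m=X_{m,0}$. Fix an identification $\pi_1(X_m)\cong F_m$ with the free group of rank $m$. Let $\mathrm{Mod}(X_{n,b})$ be the group of orientation-preserving diffeomorphisms of $X_{n,b}$ fixing the boundary pointwise, modulo isotopies fixing the boundary pointwise, and let $\mathrm{Out}_{n,b}$ be the quotient of $\mathrm{Mod}(X_{n,b})$ by the (normal) subgroup generated by the sphere twists about smoothly embedded 2-spheres. For a partition $P$ of the set of boundary components of $X_{n,b}$, call two boundary components $P$-adjacent if they lie in a common member of $P$, and let $H_1^P(X_{n,b})$ be the subgroup of $H_1(X_{n,b},\partial X_{n,b};\mathbb Z)$ spanned by the classes of simple closed curves and of properly embedded arcs with endpoints in distinct $P$-adjacent boundary components. Let $IO_m$ be the kernel of the action of $\mathrm{Out}(F_m)$ on $H_1(F_m;\mathbb Z)=\mathbb Z^m$. Let $\iota: X_{n,b}\hookrightarrow X_m$ be a smooth embedding, and let $P=\{p_N\}$ be the induced partition of the boundary components of $X_{n,b}$,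 where $N$ runs over the connected components of $X_m\setminus \mathrm{int}(X_{n,b})$ and $p_N$ is the set of boundary components of $X_{n,b}$ shared with $N$. **Theorem (Restriction Theorem).** 1. There is a unique homomorphism $\iota_*:\mathrm{Out}_{n,b}\to \mathrm{Out}(F_m)$ that sends the class of a diffeomorphism $f$ to the outer automorphism of $\pi_1(X_m)\cong F_m$ induced by the homeomorphism of $X_m$ that extends $f$ by the identity. 2. The action of diffeomorphisms on $H_1(X_{n,b},\partial X_{n,b};\mathbb Z)$ induces a (unique, well-defined) action of $\mathrm{Out}_{n,b}$ on $H_1^P(X_{n,b})$. 3. Let $IO_{n,b}^P\subset \mathrm{Out}_{n,b}$ be the kernel of the action in 2. Then $$IO_{n,b}^P=\iota_*^{-1}(IO_m).$$ -/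

import Mathlib

open Set Function Topology Manifold
open scoped ContDiff

universe u v

/-! ## The 3-manifolds -/

/-- Euclidean 3-space. -/
abbrev E3 : Type := EuclideanSpace ℝ (Fin 3)

/-- The unit 2-sphere in Euclidean 3-space. -/
abbrev S2 : Type := Metric.sphere (0 : EuclideanSpace ℝ (Fin 3)) 1

/-- The unit 3-sphere in Euclidean 4-space. -/
abbrev S3 : Type := Metric.sphere (0 : EuclideanSpace ℝ (Fin 4)) 1

/-- `M` is a connected sum of the smooth 3-manifolds `A` and `B`: it is obtained from
`A \ {i 0}` and `B \ {j 0}` by identifying `i (t u)` with `j ((1 - t) u)` for `0 < t < 1` and unit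
vectors `u`, where `i` and `j` are smooth open embeddings of Euclidean space.
(No orientations are involved: the definition is only used with `B = S¹ × S²`, which
has an orientation-reversing diffeomorphism.) -/
def IsConnectedSum {EB HB : Type*} [NormedAddCommGroup EB] [NormedSpace ℝ EB]
    [TopologicalSpace HB] (IB : ModelWithCorners ℝ EB HB)
    (A : Type*) [TopologicalSpace A] [ChartedSpace E3 A]
    (B : Type*) [TopologicalSpace B] [ChartedSpace HB B]
    (M : Type*) [TopologicalSpace M] [ChartedSpace E3 M] : Prop :=
  ∃ (i : E3 → A) (j : E3 → B) (α : A → M) (β : B → M),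
    (IsLocalDiffeomorph (𝓡 3) (𝓡 3) ∞ i ∧ Injective i) ∧
    (IsLocalDiffeomorph (𝓡 3) IB ∞ j ∧ Injective j) ∧
    (IsLocalDiffeomorphOn (𝓡 3) (𝓡 3) ∞ α {i 0}ᶜ ∧ InjOn α {i 0}ᶜ) ∧
    (IsLocalDiffeomorphOn IB (𝓡 3) ∞ β {j 0}ᶜ ∧ InjOn β {j 0}ᶜ) ∧
    α '' {i 0}ᶜ ∪ β '' {j 0}ᶜ = univ ∧
    ∀ a ∈ ({i 0}ᶜ : Set A), ∀ b ∈ ({j 0}ᶜ : Set B),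
      (α a = β b ↔ ∃ (w : E3) (t : ℝ), ‖w‖ = 1 ∧ t ∈ Ioo (0 : ℝ) 1 ∧
        a = i (t • w) ∧ b = j ((1 - t) • w))

/-- `M` is (diffeomorphic to) the connected sum `#ₙ (S¹ × S²)` of `n` copies of `S¹ × S²`;
for `n = 0` this is the 3-sphere. -/
def IsSumS1S2 : ℕ → ∀ (M : Type u) [TopologicalSpace M] [ChartedSpace E3 M], Prop
  | 0, M, _, _ => Nonempty (M ≃ₘ^∞⟮𝓡 3, 𝓡 3⟯ S3)
  | n + 1, M, _, _ => ∃ (A : Type u) (_ : TopologicalSpace A) (_ : ChartedSpace E3 A)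
      (_ : IsManifold (𝓡 3) ∞ A), IsSumS1S2 n A ∧
        IsConnectedSum ((𝓡 1).prod (𝓡 2)) A (Circle × S2) M

/-- The smooth 3-manifold with boundary `X` is (diffeomorphic to) `X_{n,b}`, i.e. to
`#ₙ (S¹ × S²)` with `b` open 3-disks (with disjoint closures, bounded by smooth spheres) removed. -/
def IsXnb (n b : ℕ) (X : Type u) [TopologicalSpace X] [ChartedSpace (EuclideanHalfSpace 3) X] :
    Prop :=
  ∃ (M : Type u) (_ : TopologicalSpace M) (_ : ChartedSpace E3 M) (_ : IsManifold (𝓡 3) ∞ M)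
    (d : Fin b → E3 → M) (j : X → M),
    IsSumS1S2 n M ∧
    (∀ k, IsLocalDiffeomorph (𝓡 3) (𝓡 3) ∞ (d k) ∧ Injective (d k)) ∧
    Pairwise (fun k l => Disjoint (d k '' Metric.closedBall 0 1) (d l '' Metric.closedBall 0 1)) ∧
    IsSmoothEmbedding (𝓡∂ 3) (𝓡 3) ∞ j ∧
    range j = (⋃ k, d k '' Metric.ball 0 1)ᶜ

/-! ## Diffeomorphisms, mapping class group, sphere twists and `Out_{n,b}` -/

noncomputable section Diff

/-- Diffeomorphisms form a group under composition. -/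
instance Diffeomorph.instGroupSelf {E H : Type*} [NormedAddCommGroup E] [NormedSpace ℝ E]
    [TopologicalSpace H] {I : ModelWithCorners ℝ E H} {M : Type*} [TopologicalSpace M]
    [ChartedSpace H M] {k : ℕ∞ω} : Group (M ≃ₘ^k⟮I, I⟯ M) where
  mul f g := g.trans f
  one := Diffeomorph.refl I M k
  inv f := f.symm
  mul_assoc _ _ _ := Diffeomorph.ext fun _ => rfl
  one_mul _ := Diffeomorph.ext fun _ => rfl
  mul_one _ := Diffeomorph.ext fun _ => rfl
  inv_mul_cancel f := Diffeomorph.ext fun x => f.symm_apply_apply x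

variable (X : Type u) [TopologicalSpace X] [ChartedSpace (EuclideanHalfSpace 3) X]
  [IsManifold (𝓡∂ 3) ∞ X]

/-- An orientation of the 3-manifold `X`: an orientation of every tangent space, locally constant
in the standard local trivializations of the tangent bundle. -/
structure ManifoldOrientation where
  /-- the orientation of the tangent space at a point -/
  at' : ∀ x : X, Orientation ℝ (TangentSpace (𝓡∂ 3) x) (Fin 3)
  locallyConstant : ∀ x : X, ∀ᶠ y in 𝓝 x,
    ∀ hy : y ∈ (trivializationAt E3 (TangentSpace (𝓡∂ 3) (M := X)) x).baseSet,
      Orientation.map (Fin 3) ((trivializationAt E3 (TangentSpace (𝓡∂ 3) (M := X)) x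
        ).continuousLinearEquivAt ℝ y hy).toLinearEquiv (at' y) =
      Orientation.map (Fin 3) ((trivializationAt E3 (TangentSpace (𝓡∂ 3) (M := X)) x
        ).continuousLinearEquivAt ℝ x
          (FiberBundle.mem_baseSet_trivializationAt' x)).toLinearEquiv (at' x)

variable {X}

/-- The diffeomorphism `f` preserves the orientation `o`. -/
def PreservesOrientation (o : ManifoldOrientation X) (f : X ≃ₘ^∞⟮𝓡∂ 3, 𝓡∂ 3⟯ X) : Prop :=
  ∀ x, Orientation.map (Fin 3)
    (f.mfderivToContinuousLinearEquiv (by simp) x).toLinearEquiv (o.at' x) = o.at' (f x)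

theorem orientation_map_map {V₁ V₂ V₃ : Type*} [AddCommGroup V₁] [Module ℝ V₁] [AddCommGroup V₂]
    [Module ℝ V₂] [AddCommGroup V₃] [Module ℝ V₃] (e : V₁ ≃ₗ[ℝ] V₂) (e' : V₂ ≃ₗ[ℝ] V₃)
    (w : Orientation ℝ V₁ (Fin 3)) :
    Orientation.map (Fin 3) e' (Orientation.map (Fin 3) e w) =
      Orientation.map (Fin 3) (e.trans e') w := by
  induction w using Module.Ray.ind with
  | h v hv => simp only [Orientation.map_apply]; rfl

/-- The group `Diff⁺(X, ∂X)` of orientation-preserving diffeomorphisms of `X` that fix the boundary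
pointwise. -/
def DiffRel (o : ManifoldOrientation X) : Subgroup (X ≃ₘ^∞⟮𝓡∂ 3, 𝓡∂ 3⟯ X) where
  carrier := {f | PreservesOrientation o f ∧ ∀ x ∈ (𝓡∂ 3).boundary X, f x = x}
  mul_mem' := by
    rintro f g ⟨hf, hf'⟩ ⟨hg, hg'⟩
    refine ⟨fun x => ?_, fun x hx => ?_⟩
    · change _ = o.at' (f (g x))
      rw [← hf (g x), ← hg x, orientation_map_map]
      congr 2
      ext v
      have h := mfderiv_comp x ((f.contMDiff).mdifferentiable (by simp) (g x))
        ((g.contMDiff).mdifferentiable (by simp) x)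
      exact congrArg (fun L => L v) h
    · change f (g x) = x
      rw [hg' x hx, hf' x hx]
  one_mem' := by
    refine ⟨fun x => ?_, fun x _ => rfl⟩
    change _ = o.at' x
    conv_rhs => rw [← Equiv.refl_apply (o.at' x), ← Orientation.map_refl]
    congr 2
    ext v
    exact congrArg (fun L => L v) (mfderiv_id (I := 𝓡∂ 3) (x := x))
  inv_mem' := by
    rintro f ⟨hf, hf'⟩
    have hfix : ∀ x ∈ (𝓡∂ 3).boundary X, f⁻¹ x = x := fun x hx => by
      have : f.symm (f x) = x := f.symm_apply_apply x
      rwa [hf' x hx] at this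
    refine ⟨fun x => ?_, hfix⟩
    obtain ⟨y, rfl⟩ : ∃ y, f y = x := ⟨f.symm x, f.apply_symm_apply x⟩
    have h1 : f.symm (f y) = y := f.symm_apply_apply y
    have h2 : (o.at' (f.symm (f y)) : Orientation ℝ E3 (Fin 3)) = o.at' y :=
      congrArg (β := Orientation ℝ E3 (Fin 3)) (fun z => o.at' z) h1
    change _ = o.at' (f.symm (f y))
    refine Eq.trans ?_ h2.symm
    rw [← hf y]
    refine (orientation_map_map _ _ _).trans ?_
    conv_rhs => rw [← Equiv.refl_apply (o.at' y), ← Orientation.map_refl]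
    congr 2
    ext v
    have h := mfderiv_comp y ((f.symm.contMDiff).mdifferentiable (by simp) (f y))
        ((f.contMDiff).mdifferentiable (by simp) y)
    have h3 : (f.symm ∘ f : X → X) = id := funext f.symm_apply_apply
    have h4 : HEq (mfderiv (𝓡∂ 3) (𝓡∂ 3) (f.symm ∘ f : X → X) y)
        (mfderiv (𝓡∂ 3) (𝓡∂ 3) (id : X → X) y) := by rw [h3]
    have h5 := (eq_of_heq h4 : (mfderiv (𝓡∂ 3) (𝓡∂ 3) (f.symm ∘ f : X → X) y : E3 →L[ℝ] E3) =
        (mfderiv (𝓡∂ 3) (𝓡∂ 3) (id : X → X) y))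
    exact congrArg (fun L => L v) (h.symm.trans (h5.trans (mfderiv_id (I := 𝓡∂ 3) (x := y))))

/-- `f` is isotopic to the identity through (orientation-preserving) diffeomorphisms fixing the
boundary pointwise, by a smooth isotopy. -/
def IsotopicToId {o : ManifoldOrientation X} (f : DiffRel o) : Prop :=
  ∃ Φ : ℝ → DiffRel o,
    ContMDiff (𝓘(ℝ, ℝ).prod (𝓡∂ 3)) (𝓡∂ 3) ∞ (fun q : ℝ × X => (Φ q.1 : X → X) q.2) ∧
      Φ 0 = 1 ∧ Φ 1 = f

/-- The normal subgroup of diffeomorphisms isotopic to the identity. -/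
def isotopySubgroup (o : ManifoldOrientation X) : Subgroup (DiffRel o) where
  carrier := {f | IsotopicToId f}
  mul_mem' := by
    rintro f g ⟨Φ, hΦ, hΦ0, hΦ1⟩ ⟨Ψ, hΨ, hΨ0, hΨ1⟩
    refine ⟨fun t => Φ t * Ψ t, ?_, by simp [hΦ0, hΨ0], by simp [hΦ1, hΨ1]⟩
    exact hΦ.comp (contMDiff_fst.prodMk hΨ)
  one_mem' := ⟨fun _ => 1, contMDiff_snd, rfl, rfl⟩
  inv_mem' := by
    rintro f ⟨Φ, hΦ, hΦ0, hΦ1⟩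
    refine ⟨fun t => f⁻¹ * Φ (1 - t), ?_, by simp [hΦ1], by simp [hΦ0]⟩
    have h : ContMDiff 𝓘(ℝ, ℝ) 𝓘(ℝ, ℝ) ∞ (fun t : ℝ => 1 - t) :=
      (contDiff_const.sub contDiff_id).contMDiff
    exact (f⁻¹ : DiffRel o).1.contMDiff.comp
      (hΦ.comp ((h.comp contMDiff_fst).prodMk contMDiff_snd))

instance isotopySubgroup_normal (o : ManifoldOrientation X) : (isotopySubgroup o).Normal where
  conj_mem := by
    rintro f ⟨Φ, hΦ, hΦ0, hΦ1⟩ g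
    refine ⟨fun t => g * Φ t * g⁻¹, ?_, by simp [hΦ0], by simp [hΦ1]⟩
    exact g.1.contMDiff.comp
      (hΦ.comp (contMDiff_fst.prodMk ((g⁻¹ : DiffRel o).1.contMDiff.comp contMDiff_snd)))

/-- The mapping class group `Mod(X)`. -/
abbrev MappingClassGroup (o : ManifoldOrientation X) : Type u := DiffRel o ⧸ isotopySubgroup o

/-- Rotation of the 2-sphere by the angle `θ` about the third coordinate axis. -/
def rotS2 (θ : ℝ) (x : S2) : S2 :=
  ⟨!₂[Real.cos θ * x.1 0 - Real.sin θ * x.1 1, Real.sin θ * x.1 0 + Real.cos θ * x.1 1, x.1 2], by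
    have h := x.2
    simp only [mem_sphere_iff_norm, sub_zero, EuclideanSpace.norm_eq, Fin.sum_univ_three,
      Real.sqrt_eq_one, Real.norm_eq_abs, sq_abs] at h ⊢
    simp only [Matrix.cons_val_zero, Matrix.cons_val_one, Matrix.cons_val]
    linear_combination h + (x.1 0 ^ 2 + x.1 1 ^ 2) * Real.sin_sq_add_cos_sq θ⟩

/-- `f` is a sphere twist: there is a smoothly embedded sphere with an open tubular neighbourhood
`U : S² × ℝ ↪ X` such that `f` is the identity off the image of `U` and
`f (U (x, t)) = U (γ(t) x, t)`, where `γ(t)` is a smooth path of rotations that is trivial for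
`t ≤ 0`, performs one full revolution for `0 ≤ t ≤ 1`, and is trivial for `t ≥ 1`. -/
def IsSphereTwist {o : ManifoldOrientation X} (f : DiffRel o) : Prop :=
  ∃ U : S2 × ℝ → X,
    IsLocalDiffeomorph ((𝓡 2).prod 𝓘(ℝ, ℝ)) (𝓡∂ 3) ∞ U ∧ Injective U ∧
    (∀ x t, f.1 (U (x, t)) = U (rotS2 (2 * Real.pi * Real.smoothTransition t) x, t)) ∧
    ∀ y ∉ range U, f.1 y = y

/-- The subgroup of the mapping class group generated by sphere twists. -/
def sphereTwistSubgroup (o : ManifoldOrientation X) : Subgroup (MappingClassGroup o) :=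
  Subgroup.closure {q | ∃ f : DiffRel o, IsSphereTwist f ∧ q = QuotientGroup.mk f}

theorem IsSphereTwist.conj {o : ManifoldOrientation X} {f : DiffRel o} (hf : IsSphereTwist f)
    (g : DiffRel o) : IsSphereTwist (g * f * g⁻¹) := by
  obtain ⟨U, hU, hinj, hin, hout⟩ := hf
  have hg : ∀ y, (g⁻¹ : DiffRel o).1 (g.1 y) = y := fun y => g.1.symm_apply_apply y
  have hg' : ∀ y, g.1 ((g⁻¹ : DiffRel o).1 y) = y := fun y => g.1.apply_symm_apply y
  refine ⟨fun z => g.1 (U z), fun z => ?_, g.1.injective.comp hinj, fun x t => ?_, fun y hy => ?_⟩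
  · exact (hU z).comp _ _ (g.1.isLocalDiffeomorph (U z))
  · change g.1 (f.1 ((g⁻¹ : DiffRel o).1 (g.1 (U (x, t))))) = _
    rw [hg, hin]
  · change g.1 (f.1 ((g⁻¹ : DiffRel o).1 y)) = y
    rw [hout, hg']
    rintro ⟨z, hz⟩
    exact hy ⟨z, by simp only [hz, hg']⟩

instance sphereTwistSubgroup_normal (o : ManifoldOrientation X) :
    (sphereTwistSubgroup o).Normal := by
  rw [← Subgroup.normalizer_eq_top_iff, eq_top_iff]
  refine (Subgroup.le_normalizer_closure_iff).2 ?_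
  rintro q - _ ⟨f, hf, rfl⟩
  obtain ⟨g, rfl⟩ := QuotientGroup.mk_surjective q
  exact Subgroup.subset_closure ⟨g * f * g⁻¹, hf.conj g, rfl⟩

/-- The group `Out_{n,b}`: the mapping class group of `X = X_{n,b}` modulo sphere twists. -/
abbrev OutBdry (o : ManifoldOrientation X) : Type u := MappingClassGroup o ⧸ sphereTwistSubgroup o

/-- The class in `Out_{n,b}` of a diffeomorphism. -/
def outClass (o : ManifoldOrientation X) : DiffRel o →* OutBdry o :=
  (QuotientGroup.mk' (sphereTwistSubgroup o)).comp (QuotientGroup.mk' (isotopySubgroup o))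

end Diff

/-! ## Relative singular homology in degree one -/

noncomputable section Homology

variable {X : Type u} {Y : Type v} [TopologicalSpace X] [TopologicalSpace Y]

/-- Singular `k`-simplices of `X`. -/
abbrev SingSimplex (X : Type u) [TopologicalSpace X] (k : ℕ) : Type u :=
  C(stdSimplex ℝ (Fin (k + 1)), X)

/-- Singular `k`-chains of `X` with integer coefficients. -/
abbrev SingChain (X : Type u) [TopologicalSpace X] (k : ℕ) : Type u := SingSimplex X k →₀ ℤ

/-- The `i`-th face of a singular simplex. -/
def SingSimplex.face {k : ℕ} (σ : SingSimplex X (k + 1)) (i : Fin (k + 2)) : SingSimplex X k :=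
  σ.comp ⟨stdSimplex.map i.succAbove, stdSimplex.continuous_map _⟩

/-- The boundary map of the singular chain complex. -/
def singBoundary (X : Type u) [TopologicalSpace X] (k : ℕ) :
    SingChain X (k + 1) →ₗ[ℤ] SingChain X k :=
  Finsupp.linearCombination ℤ fun σ : SingSimplex X (k + 1) =>
    ∑ i : Fin (k + 2), Finsupp.single (σ.face i) ((-1 : ℤ) ^ (i : ℕ))

/-- The chains supported in the subspace `A`. -/
def singChainsIn (A : Set X) (k : ℕ) : Submodule ℤ (SingChain X k) :=
  Finsupp.supported ℤ ℤ {σ : SingSimplex X k | ∀ s, σ s ∈ A}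

/-- Relative singular 1-cycles of `(X, A)`. -/
def relCycles (A : Set X) : Submodule ℤ (SingChain X 1) :=
  (singChainsIn A 0).comap (singBoundary X 0)

/-- Relative singular 1-boundaries of `(X, A)`. -/
def relBoundaries (A : Set X) : Submodule ℤ (SingChain X 1) :=
  LinearMap.range (singBoundary X 1) ⊔ singChainsIn A 1

/-- The relative singular homology group `H₁(X, A; ℤ)`. -/
abbrev RelH1 (A : Set X) : Type u := relCycles A ⧸ (relBoundaries A).submoduleOf (relCycles A)

/-- The chain map induced by a continuous map. -/
def singChainMap (f : C(X, Y)) (k : ℕ) : SingChain X k →ₗ[ℤ] SingChain Y k :=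
  Finsupp.lmapDomain ℤ ℤ fun σ : SingSimplex X k => f.comp σ

theorem singChainMap_boundary (f : C(X, Y)) (k : ℕ) (c : SingChain X (k + 1)) :
    singBoundary Y k (singChainMap f (k + 1) c) = singChainMap f k (singBoundary X k c) := by
  induction c using Finsupp.induction_linear with
  | zero => simp
  | add a b ha hb => simp only [map_add, ha, hb]
  | single σ a =>
    have h1 : ∀ (j : ℕ) (τ : SingSimplex X j) (z : ℤ), singChainMap f j (Finsupp.single τ z) =
        Finsupp.single (f.comp τ) z := fun j τ z => Finsupp.mapDomain_single
    rw [h1, singBoundary, singBoundary, Finsupp.linearCombination_single,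
      Finsupp.linearCombination_single, map_smul, map_sum]
    simp only [h1]
    rfl

theorem singChainMap_mem {A : Set X} {B : Set Y} (f : C(X, Y)) (hf : MapsTo f A B) (k : ℕ)
    {c : SingChain X k} (hc : c ∈ singChainsIn A k) : singChainMap f k c ∈ singChainsIn B k := by
  have h := Finsupp.lmapDomain_supported (M := ℤ) ℤ
    (fun σ : SingSimplex X k => f.comp σ) {σ | ∀ s, σ s ∈ A}
  refine Finsupp.supported_mono ?_ (h.le (Submodule.mem_map_of_mem hc))
  rintro _ ⟨σ, hσ, rfl⟩ s
  exact hf (hσ s)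

/-- The map on relative cycles induced by a map of pairs. -/
def relCyclesMap {A : Set X} {B : Set Y} (f : C(X, Y)) (hf : MapsTo f A B) :
    relCycles A →ₗ[ℤ] relCycles B :=
  (singChainMap f 1).restrict fun c hc => by
    change singBoundary Y 0 (singChainMap f 1 c) ∈ singChainsIn B 0
    rw [singChainMap_boundary]
    exact singChainMap_mem f hf 0 hc

/-- The map `H₁(X, A) → H₁(Y, B)` induced by a map of pairs. -/
def RelH1.map {A : Set X} {B : Set Y} (f : C(X, Y)) (hf : MapsTo f A B) :
    RelH1 A →ₗ[ℤ] RelH1 B :=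
  Submodule.mapQ _ _ (relCyclesMap f hf) <| by
    rintro ⟨c, hc⟩ h
    change c ∈ relBoundaries A at h
    change singChainMap f 1 c ∈ relBoundaries B
    obtain ⟨_, ⟨a, rfl⟩, d, hd, rfl⟩ := Submodule.mem_sup.1 h
    rw [map_add, ← singChainMap_boundary]
    exact Submodule.add_mem_sup ⟨_, rfl⟩ (singChainMap_mem f hf 1 hd)

/-- A path, viewed as a singular 1-simplex. -/
def pathSimplex (h : C(unitInterval, X)) : SingSimplex X 1 :=
  h.comp ⟨fun s => stdSimplexHomeomorphUnitInterval s,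
    stdSimplexHomeomorphUnitInterval.continuous⟩

theorem pathSimplex_face_zero (h : C(unitInterval, X)) (s : stdSimplex ℝ (Fin 1)) :
    (pathSimplex h).face 0 s = h 1 := by
  have hs : s = stdSimplex.vertex 0 := Subsingleton.elim _ _
  subst hs
  change h (stdSimplexHomeomorphUnitInterval (stdSimplex.map _ _)) = h 1
  rw [stdSimplex.map_vertex]
  exact congrArg h stdSimplexHomeomorphUnitInterval_one

theorem pathSimplex_face_one (h : C(unitInterval, X)) (s : stdSimplex ℝ (Fin 1)) :
    (pathSimplex h).face 1 s = h 0 := by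
  have hs : s = stdSimplex.vertex 0 := Subsingleton.elim _ _
  subst hs
  change h (stdSimplexHomeomorphUnitInterval (stdSimplex.map _ _)) = h 0
  rw [stdSimplex.map_vertex]
  exact congrArg h stdSimplexHomeomorphUnitInterval_zero

theorem pathSimplex_mem_relCycles (A : Set X) (h : C(unitInterval, X))
    (hh : h 0 = h 1 ∨ (h 0 ∈ A ∧ h 1 ∈ A)) :
    Finsupp.single (pathSimplex h) (1 : ℤ) ∈ relCycles A := by
  change singBoundary X 0 _ ∈ singChainsIn A 0
  rw [singBoundary, Finsupp.linearCombination_single, one_smul, Fin.sum_univ_two]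
  rcases hh with hh | ⟨h0, h1⟩
  · have : (pathSimplex h).face 0 = (pathSimplex h).face 1 := by
      ext s
      rw [pathSimplex_face_zero, pathSimplex_face_one, hh]
    rw [this, ← Finsupp.single_add]
    simp
  · refine add_mem (Finsupp.single_mem_supported ℤ _ fun s => ?_)
      (Finsupp.single_mem_supported ℤ _ fun s => ?_)
    · rwa [pathSimplex_face_zero]
    · rwa [pathSimplex_face_one]

/-- The class in `H₁(X, A)` of a path that is closed or has both endpoints in `A`. -/
def pathClass (A : Set X) (h : C(unitInterval, X)) (hh : h 0 = h 1 ∨ (h 0 ∈ A ∧ h 1 ∈ A)) :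
    RelH1 A :=
  Submodule.Quotient.mk ⟨Finsupp.single (pathSimplex h) 1, pathSimplex_mem_relCycles A h hh⟩

end Homology

/-! ## Partitions of the boundary components and the Torelli group -/

noncomputable section Torelli

variable {X : Type u} [TopologicalSpace X] [ChartedSpace (EuclideanHalfSpace 3) X]

/-- The set of boundary components of `X`, i.e. of connected components of `∂X`. -/
def boundaryComponents (X : Type u) [TopologicalSpace X]
    [ChartedSpace (EuclideanHalfSpace 3) X] : Set (Set X) :=
  {C | ∃ x ∈ (𝓡∂ 3).boundary X, C = connectedComponentIn ((𝓡∂ 3).boundary X) x}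

/-- Two boundary components are `P`-adjacent if some member of `P` contains both of them. -/
def PAdjacent (P : Set (Set (Set X))) (C C' : Set X) : Prop :=
  ∃ p ∈ P, ({C, C'} : Set (Set X)) ⊆ p

/-- `h` is a simple closed curve. -/
def IsSimpleClosedCurve (h : C(unitInterval, X)) : Prop :=
  h 0 = h 1 ∧ InjOn h {t | t ≠ 1}

/-- `h` is a properly embedded arc in `X` with endpoints in distinct `P`-adjacent boundary
components. -/
def IsAdjacentArc (P : Set (Set (Set X))) (h : C(unitInterval, X)) : Prop :=
  Injective h ∧ (∀ t, h t ∈ (𝓡∂ 3).boundary X ↔ t = 0 ∨ t = 1) ∧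
    ∃ C ∈ boundaryComponents X, ∃ C' ∈ boundaryComponents X,
      C ≠ C' ∧ PAdjacent P C C' ∧ h 0 ∈ C ∧ h 1 ∈ C'

/-- The subgroup `H₁ᴾ(X)` of `H₁(X, ∂X)` spanned by the classes of simple closed curves and of
properly embedded arcs with endpoints in distinct `P`-adjacent boundary components. -/
def H1P (P : Set (Set (Set X))) : Submodule ℤ (RelH1 ((𝓡∂ 3).boundary X)) :=
  Submodule.span ℤ {c | ∃ (h : C(unitInterval, X))
    (hh : h 0 = h 1 ∨ (h 0 ∈ (𝓡∂ 3).boundary X ∧ h 1 ∈ (𝓡∂ 3).boundary X)),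
    (IsSimpleClosedCurve h ∨ IsAdjacentArc P h) ∧ c = pathClass _ h hh}

variable [IsManifold (𝓡∂ 3) ∞ X]

/-- The map on `H₁(X, ∂X)` induced by a diffeomorphism. -/
def diffH1 {o : ManifoldOrientation X} (f : DiffRel o) :
    RelH1 ((𝓡∂ 3).boundary X) →ₗ[ℤ] RelH1 ((𝓡∂ 3).boundary X) :=
  RelH1.map ⟨f.1, f.1.continuous⟩ fun x hx => by
    change f.1 x ∈ _
    rwa [f.2.2 x hx]

/-- `ρ` is the action of `Out_{n,b}` on `H₁ᴾ(X)` induced by the action of diffeomorphisms. -/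
def IsActionOnH1P {o : ManifoldOrientation X} (P : Set (Set (Set X)))
    (ρ : OutBdry o →* (H1P P ≃ₗ[ℤ] H1P P)) : Prop :=
  ∀ (f : DiffRel o) (c : H1P P), (ρ (outClass o f) c : RelH1 ((𝓡∂ 3).boundary X)) = diffH1 f c

end Torelli

/-! ## Outer automorphisms -/

section Outer

variable (G : Type u) [Group G]

instance innerAut_normal : (MulAut.conj : G →* MulAut G).range.Normal where
  conj_mem := by
    rintro _ ⟨g, rfl⟩ a
    exact ⟨a g, by ext x; simp⟩

/-- The outer automorphism group `Out(G)`. -/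
abbrev OutGroup : Type u := MulAut G ⧸ (MulAut.conj : G →* MulAut G).range

/-- The action of `Aut(G)` on the abelianization `H₁(G; ℤ)`. -/
def autAb : MulAut G →* MulAut (Abelianization G) where
  toFun a := a.abelianizationCongr
  map_one' := by
    ext x
    induction x using QuotientGroup.induction_on
    rfl
  map_mul' a a' := by
    ext x
    induction x using QuotientGroup.induction_on
    rfl

/-- The action of `Out(G)` on `H₁(G; ℤ)`. -/
def outAb : OutGroup G →* MulAut (Abelianization G) :=
  QuotientGroup.lift _ (autAb G) <| by
    rintro _ ⟨g, rfl⟩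
    ext x
    induction x using QuotientGroup.induction_on with
    | H y =>
      change Abelianization.of (g * y * g⁻¹) = Abelianization.of y
      simp

/-- The Torelli subgroup `IO_m` of `Out(F_m)`: the kernel of the action on `H₁(F_m; ℤ)`. -/
def IOut (m : ℕ) : Subgroup (OutGroup (FreeGroup (Fin m))) := (outAb (FreeGroup (Fin m))).ker

end Outer

/-! ## Embeddings into `X_m` -/

section Embedding

variable {X : Type u} [TopologicalSpace X] [ChartedSpace (EuclideanHalfSpace 3) X]
  {M : Type v} [TopologicalSpace M]

/-- For a subset `N` of `M`, the set of boundary components of `X` that are shared with `N` under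
the embedding `ι`. -/
def sharedComponents (ι : X → M) (N : Set M) : Set (Set X) :=
  {C | C ∈ boundaryComponents X ∧ ι '' C ⊆ N}

/-- The partition of the boundary components of `X` induced by an embedding `ι` of `X` in `M`:
its members are the sets of boundary components shared with `N`, for `N` a connected component of
the complement of the interior of `X`. -/
def inducedPartition (ι : X → M) : Set (Set (Set X)) :=
  {p | ∃ y ∈ (ι '' (𝓡∂ 3).interior X)ᶜ,
    p = sharedComponents ι (connectedComponentIn (ι '' (𝓡∂ 3).interior X)ᶜ y)}

variable [IsManifold (𝓡∂ 3) ∞ X]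

/-- The homeomorphism `F` of `M` is the extension by the identity of the diffeomorphism `f`. -/
def IsExtensionById {o : ManifoldOrientation X} (ι : X → M) (f : DiffRel o) (F : M ≃ₜ M) : Prop :=
  (∀ x, F (ι x) = ι (f.1 x)) ∧ ∀ y ∉ range ι, F y = y

/-- The outer automorphism `q` of `G ≅ π₁(M, p)` is induced by the homeomorphism `F` of `M`:
it is represented by `g ↦ δ · F(g) · δ⁻¹` for a path `δ` from `p` to `F p`. -/
def IsInducedOuter {G : Type*} [Group G] {p : M} (e : FundamentalGroup M p ≃* G) (F : M ≃ₜ M)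
    (q : OutGroup G) : Prop :=
  ∃ (δ : Path p (F p)) (a : MulAut G), q = QuotientGroup.mk a ∧
    ∀ g : FundamentalGroup M p, a (e g) =
      e ((FundamentalGroup.fundamentalGroupMulEquivOfPath δ).symm
        (FundamentalGroup.map (F : C(M, M)) p g))

/-- `φ` is the homomorphism `ι_* : Out_{n,b} → Out(F_m)` induced by the embedding `ι : X → M`: the
class of a diffeomorphism `f` is sent to the outer automorphism of `π₁(M, p) ≅ F_m` induced by the
extension of `f` by the identity. -/
def IsInducedMap {o : ManifoldOrientation X} {m : ℕ} (ι : X → M) {p : M}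
    (e : FundamentalGroup M p ≃* FreeGroup (Fin m))
    (φ : OutBdry o →* OutGroup (FreeGroup (Fin m))) : Prop :=
  ∀ f : DiffRel o, ∃ F : M ≃ₜ M, IsExtensionById ι f F ∧ IsInducedOuter e F (φ (outClass o f))

end Embedding

/-! Let Z be the complement in M of the interior of X, let f be a diffeomorphism of X fixing the
boundary B pointwise, and let F be its extension by the identity. Part 3 asks that f fix the
generators of H₁ᴾ(X) exactly when F acts trivially on H₁(M). Exact sequences are replaced by
duality. A `PathCocycle` is a homotopy-invariant additive function on paths, that is, a 1-cocycle on
the fundamental groupoid with values in an arbitrary abelian group. `chainCocycle` detects relative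
classes of paths in X and `exists_universal_pathCocycle` detects H₁(M), so both conditions become
identities between values of cocycles.

Suppose F is trivial on H₁(M) (`chainClass_comp_eq`). The cocycle of relative classes vanishes on B,
so it extends by zero over Z (`exists_extension`). A loop in X is a loop in M, and an arc between
adjacent boundary components closes up through Z, where F is the identity; the closing path
contributes equally before and after F. Hence f preserves the class.

Conversely (`cocycle_comp_eq`), let T be a cocycle on M. Loops in B are null-homotopic in X, so
after subtraction of a coboundary the restriction of T to X vanishes on B and depends only on
relative classes. Its change under f vanishes on simple closed curves, hence on all loops
(`loop_eq_zero_of_simple`), and so has a primitive w. The arcs show that w takes one value on all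
boundary points lying in the same component of Z; this is where P-adjacency enters. The resulting
primitive of T∘F − T on X therefore extends over Z, constant on each component, and T∘F agrees with
T on loops.

For parts 1 and 2, isotopies and sphere twists are `IsHomotopicallyTrivial`: on the fundamental
groupoid they are naturally isomorphic to the identity through paths that are constant on B. For a
twist this holds because its support lies in a tube S² × ℝ, which is simply connected. The property
passes to the extension by the identity and forces trivial actions on classes and on π₁ up to
conjugation.

The geometry enters through two lemmas: `IsSmoothEmbedding.isTameEmbedding` makes ι locally the
inclusion of a half-space, and `IsXnb.isTameDomain` shows that X is compact, Hausdorff and connected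
with null-homotopic boundary loops. -/

open scoped unitInterval

/-! ## Path induction and path cocycles -/

section Paths

variable {X Y : Type*} [TopologicalSpace X] [TopologicalSpace Y] {A : Type*} [AddCommGroup A]

/-- A property of paths that is invariant under homotopy and closed under concatenation holds for
a path as soon as it holds locally along it. -/
theorem ContinuousMap.path_induction {P : C(I, X) → Prop}
    (homotopic : ∀ {x y : X} (γ γ' : Path x y), γ.Homotopic γ' → P γ.1 → P γ'.1)
    (trans : ∀ {x y z : X} (γ : Path x y) (γ' : Path y z), P γ.1 → P γ'.1 → P (γ.trans γ').1)
    (h : C(I, X))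
    (loc : ∀ t, ∃ O ∈ 𝓝 (h t), ∀ h' : C(I, X), range h' ⊆ range h ∩ O → P h') : P h := by
  choose O hO hP using loc
  -- A Lebesgue number subdivision: each piece of `h` lies in one good neighbourhood, and the
  -- subdivision points equal 1 from index `n` on.
  obtain ⟨t, t0, tmono, ⟨n, tn⟩, ht⟩ := exists_monotone_Icc_subset_open_cover_unitInterval
    (c := fun s => h ⁻¹' interior (O s)) (fun s => isOpen_interior.preimage h.continuous)
    (fun s _ => mem_iUnion.2 ⟨s, mem_interior_iff_mem_nhds.2 (hO s)⟩)
  let γ : Path (h 0) (h 1) := ⟨h, rfl, rfl⟩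
  have key : ∀ k, P (γ.subpath (t 0) (t k)).1 := by
    intro k
    induction k with
    | zero =>
      refine hP (t 0) _ ?_
      rintro _ ⟨s, rfl⟩
      rw [Path.subpath_self]
      exact ⟨⟨t 0, rfl⟩, mem_of_mem_nhds (hO _)⟩
    | succ k ih =>
      refine homotopic _ _ ⟨Path.Homotopy.subpathTransSubpath γ (t 0) (t k) (t (k + 1))⟩
        (trans _ _ ih ?_)
      obtain ⟨i, hi⟩ := ht k
      refine hP i _ ?_
      have : range (γ.subpath (t k) (t (k + 1))).1 = h '' Icc (t k) (t (k + 1)) :=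
        γ.range_subpath_of_le _ _ (tmono k.le_succ)
      rw [this]
      rintro _ ⟨s, hs, rfl⟩
      exact ⟨⟨s, rfl⟩, interior_subset (hi hs)⟩
  have := key n
  rw [t0, tn n le_rfl, Path.subpath_zero_one] at this
  exact this

/-- A function on paths with values in an abelian group which is invariant under homotopy and
additive under concatenation. -/
structure PathCocycle (X : Type*) [TopologicalSpace X] (A : Type*) [AddCommGroup A] where
  /-- the value on a path -/
  toFun : C(I, X) → A
  map_homotopic' : ∀ {x y : X} (γ γ' : Path x y), γ.Homotopic γ' → toFun γ.1 = toFun γ'.1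
  map_trans' : ∀ {x y z : X} (γ : Path x y) (γ' : Path y z),
    toFun (γ.trans γ').1 = toFun γ.1 + toFun γ'.1

namespace PathCocycle

instance : CoeFun (PathCocycle X A) (fun _ => C(I, X) → A) := ⟨toFun⟩

variable (T : PathCocycle X A)

theorem map_homotopic {x y : X} {γ γ' : Path x y} (h : γ.Homotopic γ') : T γ.1 = T γ'.1 :=
  T.map_homotopic' γ γ' h

theorem map_trans {x y z : X} (γ : Path x y) (γ' : Path y z) :
    T (γ.trans γ').1 = T γ.1 + T γ'.1 := T.map_trans' γ γ'

theorem map_refl (x : X) : T (Path.refl x).1 = 0 := by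
  have := T.map_trans (Path.refl x) (Path.refl x)
  rw [Path.refl_trans_refl] at this
  simpa using this

theorem map_symm {x y : X} (γ : Path x y) : T γ.symm.1 = - T γ.1 := by
  have h1 := T.map_trans γ γ.symm
  have h2 := T.map_homotopic (γ := γ.trans γ.symm) (γ' := Path.refl x)
    ⟨(Path.Homotopy.reflTransSymm γ).symm⟩
  rw [h2, map_refl] at h1
  exact eq_neg_of_add_eq_zero_right h1.symm

theorem map_const (x : X) : T (ContinuousMap.const I x) = 0 := T.map_refl x

/-- The pullback of a path cocycle. -/
def comp (T : PathCocycle Y A) (f : C(X, Y)) : PathCocycle X A where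
  toFun h := T (f.comp h)
  map_homotopic' γ γ' h := T.map_homotopic (h.map f)
  map_trans' γ γ' := by
    have := T.map_trans (γ.map f.continuous) (γ'.map f.continuous)
    rw [← Path.map_trans] at this
    exact this

theorem comp_apply (T : PathCocycle Y A) (f : C(X, Y)) (h : C(I, X)) :
    T.comp f h = T (f.comp h) := rfl

/-- The path cocycle of the differences of the values of a function at the endpoints. -/
def coboundary (w : X → A) : PathCocycle X A where
  toFun h := w (h 1) - w (h 0)
  map_homotopic' γ γ' h := by
    change w (γ 1) - w (γ 0) = w (γ' 1) - w (γ' 0)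
    simp
  map_trans' γ γ' := by
    change w ((γ.trans γ') 1) - w ((γ.trans γ') 0) = w (γ 1) - w (γ 0) + (w (γ' 1) - w (γ' 0))
    simp

theorem coboundary_apply (w : X → A) (h : C(I, X)) : coboundary w h = w (h 1) - w (h 0) := rfl

/-- The difference of two path cocycles. -/
def sub (T T' : PathCocycle X A) : PathCocycle X A where
  toFun h := T h - T' h
  map_homotopic' γ γ' h := by rw [T.map_homotopic h, T'.map_homotopic h]
  map_trans' γ γ' := by rw [T.map_trans, T'.map_trans]; abel

theorem sub_apply (T T' : PathCocycle X A) (h : C(I, X)) : T.sub T' h = T h - T' h := rfl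

/-- A path cocycle that vanishes on the loops in `S` has a primitive on `S`. -/
theorem exists_primitive (S : Set X)
    (hS : ∀ h : C(I, X), range h ⊆ S → h 0 = h 1 → T h = 0) :
    ∃ w : X → A, ∀ h : C(I, X), range h ⊆ S → T h = w (h 1) - w (h 0) := by
  classical
  -- Points are related when joined inside `S`; equality is added so that points outside `S` are
  -- related to themselves. The primitive at `x` is the value of `T` on a path from the
  -- representative of its class, and the value 0 elsewhere plays no role.
  let r : Setoid X :=
    { r := fun x y => x = y ∨ JoinedIn S x y
      iseqv := by
        refine ⟨fun x => Or.inl rfl, ?_, ?_⟩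
        · rintro x y (h | h)
          · exact Or.inl h.symm
          · exact Or.inr h.symm
        · rintro x y z (rfl | h) (rfl | h')
          · exact Or.inl rfl
          · exact Or.inr h'
          · exact Or.inr h
          · exact Or.inr (h.trans h') }
  let rep : X → X := fun x => (Quotient.mk r x).out
  refine ⟨fun x => if hx : JoinedIn S (rep x) x then T hx.somePath.1 else 0, fun h hh => ?_⟩
  have hmem : ∀ t, h t ∈ S := fun t => hh ⟨t, rfl⟩
  let γ : Path (h 0) (h 1) := ⟨h, rfl, rfl⟩
  have h01 : JoinedIn S (h 0) (h 1) := ⟨γ, hmem⟩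
  have hrep : rep (h 0) = rep (h 1) :=
    congrArg Quotient.out (Quotient.sound (s := r) (Or.inr h01))
  have hj : ∀ x ∈ S, JoinedIn S (rep x) x := fun x hx => by
    rcases (Quotient.mk_out (s := r) x : rep x = x ∨ JoinedIn S (rep x) x) with h | h
    · have h' : rep x = x := h
      rw [h']
      exact JoinedIn.refl hx
    · exact h
  have j0 := hj _ (hmem 0)
  have j1 := hj _ (hmem 1)
  change T h = (if hx : _ then _ else _) - (if hx : _ then _ else _)
  rw [dif_pos j0, dif_pos j1]
  revert j1
  rw [← hrep]
  intro j1
  -- Both ends of `h` have the same representative, so the two chosen paths close `h` up to a loop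
  -- in `S`.
  have := hS (((j0.somePath.trans γ).trans j1.somePath.symm)).1 ?_ (by simp)
  · rw [map_trans, map_trans, map_symm] at this
    change T j0.somePath.1 + T h + _ = 0 at this
    rw [← sub_eq_zero, ← this]
    abel
  · change range ((j0.somePath.trans γ).trans j1.somePath.symm) ⊆ S
    rw [Path.trans_range, Path.trans_range, Path.symm_range]
    refine union_subset (union_subset ?_ hh) ?_
    · rintro _ ⟨t, rfl⟩
      exact j0.somePath_mem t
    · rintro _ ⟨t, rfl⟩
      exact j1.somePath_mem t

end PathCocycle

end Paths

/-! ## Convex patches -/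

section Patches

variable {X M : Type*} [TopologicalSpace X] [TopologicalSpace M]
  {E : Type*} [NormedAddCommGroup E] [NormedSpace ℝ E]

/-- A subset of `X` together with a homeomorphism onto a convex subset of `E`. -/
structure ConvexPatch (X : Type*) [TopologicalSpace X] (E : Type*) [NormedAddCommGroup E]
    [NormedSpace ℝ E] extends PartialEquiv X E where
  continuousOn_toFun : ContinuousOn toFun source
  continuousOn_invFun : ContinuousOn invFun target
  convex_target : Convex ℝ target

namespace ConvexPatch

variable (P : ConvexPatch X E)

theorem lineMap_mem {x y : X} (hx : x ∈ P.source) (hy : y ∈ P.source) {t : ℝ} (ht : t ∈ I) :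
    AffineMap.lineMap (P.toFun x) (P.toFun y) t ∈ P.target :=
  P.convex_target.lineMap_mem (P.map_source hx) (P.map_source hy) ht

/-- The path in a convex patch that corresponds to a straight line segment. -/
def segment {x y : X} (hx : x ∈ P.source) (hy : y ∈ P.source) : Path x y where
  toFun t := P.invFun (AffineMap.lineMap (P.toFun x) (P.toFun y) (t : ℝ))
  continuous_toFun := P.continuousOn_invFun.comp_continuous
    (AffineMap.lineMap_continuous.comp continuous_subtype_val)
    fun t => P.lineMap_mem hx hy t.2
  source' := by simpa using P.left_inv hx
  target' := by simpa using P.left_inv hy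

theorem segment_mem {x y : X} (hx : x ∈ P.source) (hy : y ∈ P.source) (t : I) :
    P.segment hx hy t ∈ P.source := P.map_target (P.lineMap_mem hx hy t.2)

theorem toFun_segment {x y : X} (hx : x ∈ P.source) (hy : y ∈ P.source) (t : I) :
    P.toFun (P.segment hx hy t) = AffineMap.lineMap (P.toFun x) (P.toFun y) (t : ℝ) :=
  P.right_inv (P.lineMap_mem hx hy t.2)

theorem range_segment_subset {x y : X} (hx : x ∈ P.source) (hy : y ∈ P.source) :
    range (P.segment hx hy) ⊆ P.source := by
  rintro _ ⟨t, rfl⟩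
  exact P.segment_mem hx hy t

theorem segment_injective {x y : X} (hx : x ∈ P.source) (hy : y ∈ P.source) (hxy : x ≠ y) :
    Injective (P.segment hx hy) := by
  intro s t hst
  have h := congrArg P.toFun hst
  rw [toFun_segment, toFun_segment] at h
  exact Subtype.ext (AffineMap.lineMap_injective ℝ
    (fun h' => hxy (P.injOn hx hy h')) h)

/-- Two paths in a convex patch with the same endpoints are homotopic. -/
theorem homotopic {x y : X} {γ γ' : Path x y} (hγ : range γ ⊆ P.source)
    (hγ' : range γ' ⊆ P.source) : γ.Homotopic γ' := by
  have hc : ∀ γ : Path x y, range γ ⊆ P.source → Continuous fun t => P.toFun (γ t) :=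
    fun γ h => P.continuousOn_toFun.comp_continuous γ.continuous fun t => h ⟨t, rfl⟩
  have h0 := hc γ hγ
  have h1 := hc γ' hγ'
  refine ⟨⟨⟨⟨fun q => P.invFun (AffineMap.lineMap (P.toFun (γ q.2)) (P.toFun (γ' q.2))
    (q.1 : ℝ)), ?_⟩, fun t => ?_, fun t => ?_⟩, ?_⟩⟩
  · refine P.continuousOn_invFun.comp_continuous ?_
      fun q => P.lineMap_mem (hγ ⟨_, rfl⟩) (hγ' ⟨_, rfl⟩) q.1.2
    simp only [AffineMap.lineMap_apply_module]
    exact ((continuous_const.sub (continuous_subtype_val.comp continuous_fst)).smul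
      (h0.comp continuous_snd)).add
      ((continuous_subtype_val.comp continuous_fst).smul (h1.comp continuous_snd))
  · simpa using P.left_inv (hγ ⟨t, rfl⟩)
  · simpa using P.left_inv (hγ' ⟨t, rfl⟩)
  · rintro s t (rfl | rfl)
    · simpa using P.left_inv (by simpa using hγ ⟨0, rfl⟩)
    · simpa using P.left_inv (by simpa using hγ ⟨1, rfl⟩)

theorem cocycle_loop_eq_zero {A : Type*} [AddCommGroup A] (T : PathCocycle X A) (h : C(I, X))
    (hh : range h ⊆ P.source) (h01 : h 0 = h 1) : T h = 0 := by
  let γ : Path (h 0) (h 0) := ⟨h, rfl, h01.symm⟩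
  rw [← T.map_refl (h 0)]
  refine T.map_homotopic (γ := γ) (P.homotopic hh ?_)
  rintro _ ⟨t, rfl⟩
  exact hh ⟨0, rfl⟩

/-- The restriction of a convex patch to the preimage of a convex set. -/
def restrict {C : Set E} (hC : Convex ℝ C) : ConvexPatch X E where
  toPartialEquiv := (P.toPartialEquiv.symm.restr C).symm
  continuousOn_toFun := P.continuousOn_toFun.mono inter_subset_left
  continuousOn_invFun := P.continuousOn_invFun.mono inter_subset_left
  convex_target := P.convex_target.inter hC

theorem restrict_source {C : Set E} (hC : Convex ℝ C) :
    (P.restrict hC).source = P.source ∩ P.toFun ⁻¹' C := rfl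

/-- The preimage of a convex patch under an embedding whose range corresponds to a convex set. -/
noncomputable def comap [Nonempty X] {f : X → M} (hf : IsEmbedding f) (P : ConvexPatch M E)
    {C : Set E} (hC : Convex ℝ C) (hfC : ∀ z ∈ P.source, z ∈ range f ↔ P.toFun z ∈ C) :
    ConvexPatch X E where
  toFun x := P.toFun (f x)
  invFun y := invFun f (P.invFun y)
  source := f ⁻¹' P.source
  target := P.target ∩ C
  map_source' x hx := ⟨P.map_source hx, (hfC _ hx).1 ⟨x, rfl⟩⟩
  map_target' y hy := by
    have h := P.map_target hy.1
    have h2 : P.invFun y ∈ range f := (hfC _ h).2 (by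
      rw [P.right_inv hy.1]; exact hy.2)
    change f (Function.invFun f (P.invFun y)) ∈ P.source
    rw [Function.invFun_eq h2]
    exact h
  left_inv' x hx := by
    rw [show P.invFun (P.toFun (f x)) = f x from P.left_inv hx]
    exact leftInverse_invFun hf.injective x
  right_inv' y hy := by
    have h2 : P.invFun y ∈ range f := (hfC _ (P.map_target hy.1)).2 (by
      rw [P.right_inv hy.1]; exact hy.2)
    change P.toFun (f (Function.invFun f (P.invFun y))) = _
    rw [Function.invFun_eq h2]
    exact P.right_inv hy.1
  continuousOn_toFun := P.continuousOn_toFun.comp hf.continuous.continuousOn fun x hx => hx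
  continuousOn_invFun := by
    rw [hf.continuousOn_iff]
    refine (P.continuousOn_invFun.mono inter_subset_left).congr fun y hy => ?_
    exact Function.invFun_eq ((hfC _ (P.map_target hy.1)).2 (by
      rw [P.right_inv hy.1]; exact hy.2))
  convex_target := P.convex_target.inter hC

end ConvexPatch

/-- Every point has arbitrarily small open neighbourhoods that are homeomorphic to a convex subset
of `E`. -/
def HasConvexPatches (X : Type*) [TopologicalSpace X] (E : Type*) [NormedAddCommGroup E]
    [NormedSpace ℝ E] : Prop :=
  ∀ x : X, ∀ O ∈ 𝓝 x, ∃ P : ConvexPatch X E, x ∈ P.source ∧ IsOpen P.source ∧ P.source ⊆ O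

/-- Closed patches make first and last times of a path in a patch exist. A closed ball in
coordinates need not be closed in `X`; regularity supplies a closed neighbourhood `V` inside the
patch, and a ball small enough to land in `V` works. -/
theorem HasConvexPatches.exists_closed [RegularSpace X] (hX : HasConvexPatches X E) (x : X)
    {O : Set X} (hO : O ∈ 𝓝 x) : ∃ P Q : ConvexPatch X E, x ∈ Q.source ∧ IsOpen Q.source ∧
      Q.source ⊆ P.source ∧ IsClosed P.source ∧ P.source ⊆ O := by
  obtain ⟨P, hx, hP, hPO⟩ := hX x O hO
  obtain ⟨V, hV, hVc, hVP⟩ := exists_mem_nhds_isClosed_subset (hP.mem_nhds hx)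
  have h1 : P.invFun ⁻¹' V ∈ 𝓝[P.target] (P.toFun x) := by
    refine P.continuousOn_invFun _ (P.map_source hx) ?_
    rwa [show P.invFun (P.toFun x) = x from P.left_inv hx]
  obtain ⟨r, hr, hrV⟩ := Metric.mem_nhdsWithin_iff.1 h1
  have hsub : P.source ∩ P.toFun ⁻¹' Metric.closedBall (P.toFun x) (r / 2) ⊆ V := by
    rintro z ⟨hz, hz'⟩
    have : P.toFun z ∈ P.invFun ⁻¹' V :=
      hrV ⟨Metric.closedBall_subset_ball (by linarith) hz', P.map_source hz⟩
    rwa [mem_preimage, show P.invFun (P.toFun z) = z from P.left_inv hz] at this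
  refine ⟨P.restrict (convex_closedBall (P.toFun x) (r / 2)),
    P.restrict (convex_ball (P.toFun x) (r / 2)), ?_, ?_, ?_, ?_, ?_⟩
  · exact ⟨hx, Metric.mem_ball_self (by linarith)⟩
  · exact P.continuousOn_toFun.isOpen_inter_preimage hP Metric.isOpen_ball
  · exact inter_subset_inter_right _ (preimage_mono Metric.ball_subset_closedBall)
  · have : P.source ∩ P.toFun ⁻¹' Metric.closedBall (P.toFun x) (r / 2) =
        V ∩ P.toFun ⁻¹' Metric.closedBall (P.toFun x) (r / 2) :=
      subset_antisymm (fun z hz => ⟨hsub hz, hz.2⟩) fun z hz => ⟨hVP hz.1, hz.2⟩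
    rw [ConvexPatch.restrict_source, this]
    exact (P.continuousOn_toFun.mono hVP).preimage_isClosed_of_isClosed hVc Metric.isClosed_closedBall
  · exact inter_subset_left.trans hPO

theorem HasConvexPatches.subtype (hX : HasConvexPatches X E) {W : Set X} (hW : IsOpen W) :
    HasConvexPatches W E := by
  intro x O hO
  obtain ⟨V, hV, hVO⟩ := mem_nhds_induced _ _ _ |>.1 (by simpa [instTopologicalSpaceSubtype] using hO)
  obtain ⟨P, hx, hP, hPV⟩ := hX x (V ∩ W) (Filter.inter_mem hV (hW.mem_nhds x.2))
  have : Nonempty W := ⟨x⟩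
  refine ⟨P.comap IsEmbedding.subtypeVal convex_univ (fun z hz => ?_), hx,
    hP.preimage continuous_subtype_val, fun z hz => hVO (hPV hz).1⟩
  simpa using (hPV hz).2

end Patches

/-! ## Gluing path cocycles -/

section Gluing

theorem unitInterval.eq_of_eventually_eq {A : Type*} {g : I → A} (hg : ∀ t, ∀ᶠ t' in 𝓝 t, g t' = g t) (t t' : I) :
    g t = g t' :=
  ((IsLocallyConstant.iff_eventually_eq g).2 hg).apply_eq_of_preconnectedSpace t t'

variable {M : Type*} [TopologicalSpace M] {A : Type*} [AddCommGroup A]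

/-- Functions on the members of an open cover whose differences are locally constant on the
overlaps. -/
structure LocalPrimitives (M : Type*) [TopologicalSpace M] (A : Type*) [AddCommGroup A] where
  /-- the open cover -/
  dom : M → Set M
  isOpen_dom : ∀ y, IsOpen (dom y)
  mem_dom : ∀ y, y ∈ dom y
  /-- the primitives -/
  val : M → M → A
  locallyConstant : ∀ y y', ∀ z ∈ dom y ∩ dom y', ∀ᶠ z' in 𝓝 z,
    val y z' - val y' z' = val y z - val y' z

namespace LocalPrimitives

variable (s : LocalPrimitives M A) [TopologicalSpace A] [DiscreteTopology A]

/-- The principal bundle with discrete structure group whose local sections are the local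
primitives. -/
def core : FiberBundleCore M M A where
  baseSet := s.dom
  isOpen_baseSet := s.isOpen_dom
  indexAt := id
  mem_baseSet_at := s.mem_dom
  coordChange i j x a := a + s.val i x - s.val j x
  coordChange_self i x hx a := by simp
  continuousOn_coordChange i j := by
    rintro ⟨z, a⟩ ⟨hz, -⟩
    refine ContinuousAt.continuousWithinAt ?_
    -- Differences of primitives are locally constant and `A` is discrete, so the coordinate change
    -- is locally constant.
    refine (continuousAt_const (y := a + s.val i z - s.val j z)).congr ?_
    have h1 : ∀ᶠ p : M × A in 𝓝 (z, a), p.2 = a := by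
      refine (continuous_snd.tendsto (z, a)).eventually (p := fun b => b = a) ?_
      simp [nhds_discrete]
    have h2 := (continuous_fst.tendsto (z, a)).eventually (s.locallyConstant i j z hz)
    filter_upwards [h1, h2] with p hp hp'
    rw [hp, add_sub_assoc, add_sub_assoc, hp']
  coordChange_comp i j k x hx a := by abel

/-- The projection of the associated covering space. -/
abbrev proj : s.core.TotalSpace → M := Bundle.TotalSpace.proj

theorem isCoveringMap : IsCoveringMap s.proj := FiberBundle.isCoveringMap (F := A)

/-- The coordinate on the covering space in which the local sections are the local primitives. -/
def coord (e : s.core.TotalSpace) : A := (show A from e.2) + s.val e.1 e.1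

/-- In the trivialization over `dom y` the fibre coordinate is `coord` minus `val y`. It is
continuous with values in a discrete space, hence locally constant along a lift. -/
theorem eventually_coord {h : C(I, M)} {Γ : I → s.core.TotalSpace} (hΓ : Continuous Γ)
    (hp : s.proj ∘ Γ = h) (t : I) (y : M) (hy : h t ∈ s.dom y) :
    ∀ᶠ t' in 𝓝 t, s.coord (Γ t') - s.val y (h t') = s.coord (Γ t) - s.val y (h t) := by
  have hp' : ∀ t, (Γ t).1 = h t := fun t => congrFun hp t
  have hloc : ∀ t', ((s.core.localTriv y) (Γ t')).2 = s.coord (Γ t') - s.val y (h t') := by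
    intro t'
    change (show A from (Γ t').2) + s.val (Γ t').1 (Γ t').1 - s.val y (Γ t').1 = _
    rw [← hp' t']
    rfl
  have hc : ContinuousAt (fun t' => ((s.core.localTriv y) (Γ t')).2) t := by
    refine continuous_snd.continuousAt.comp ?_
    refine ContinuousAt.comp ?_ hΓ.continuousAt
    refine (s.core.localTriv y).continuousOn.continuousAt ?_
    refine (s.core.localTriv y).open_source.mem_nhds ?_
    rw [FiberBundleCore.mem_localTriv_source, hp' t]
    exact hy
  have := hc.eventually_mem (by rw [mem_nhds_discrete]; exact mem_singleton _)
  filter_upwards [this] with t' ht'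
  rw [← hloc, ← hloc]
  exact ht'

/-- Two lifts of one path differ by a constant translation of the fibre, so the increment of `coord`
depends only on the path below. -/
theorem coord_sub_coord {h : C(I, M)} {Γ Γ' : I → s.core.TotalSpace} (hΓ : Continuous Γ)
    (hp : s.proj ∘ Γ = h) (hΓ' : Continuous Γ') (hp' : s.proj ∘ Γ' = h) :
    s.coord (Γ 1) - s.coord (Γ 0) = s.coord (Γ' 1) - s.coord (Γ' 0) := by
  have := unitInterval.eq_of_eventually_eq (g := fun t => s.coord (Γ t) - s.coord (Γ' t)) (fun t => by
    filter_upwards [s.eventually_coord hΓ hp t _ (s.mem_dom _),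
      s.eventually_coord hΓ' hp' t _ (s.mem_dom _)] with t' h1 h2
    have := congrArg₂ (· - ·) h1 h2
    simpa using this) 0 1
  have h2 : s.coord (Γ 0) - s.coord (Γ' 0) = s.coord (Γ 1) - s.coord (Γ' 1) := this
  rw [sub_eq_sub_iff_add_eq_add] at h2 ⊢
  rw [← h2, add_comm]

/-- The lift of a path to the covering space. -/
noncomputable def lift (h : C(I, M)) : C(I, s.core.TotalSpace) :=
  s.isCoveringMap.liftPath h ⟨h 0, (0 : A)⟩ rfl

theorem proj_lift (h : C(I, M)) : s.proj ∘ s.lift h = h := s.isCoveringMap.liftPath_lifts _ _ _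

/-- The path cocycle determined by local primitives. -/
noncomputable def toPathCocycle : PathCocycle M A where
  toFun h := s.coord (s.lift h 1) - s.coord (s.lift h 0)
  map_homotopic' {x y} γ γ' h := by
    have hx : ∀ γ : Path x y, γ.1 0 = x := fun γ => γ.source
    -- The increment may be computed on lifts with one common starting point, to which homotopy
    -- lifting applies.
    have key : ∀ γ : Path x y, s.coord (s.lift γ.1 1) - s.coord (s.lift γ.1 0) =
        s.coord (s.isCoveringMap.liftPath γ.1 ⟨x, (0 : A)⟩ (hx γ) 1) -
        s.coord ⟨x, (0 : A)⟩ := fun γ => by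
      have := s.coord_sub_coord (s.lift γ.1).continuous (s.proj_lift _)
        (s.isCoveringMap.liftPath γ.1 ⟨x, (0 : A)⟩ (hx γ)).continuous
        (s.isCoveringMap.liftPath_lifts _ _ _)
      rw [this, s.isCoveringMap.liftPath_zero]
    rw [key, key, s.isCoveringMap.liftPath_apply_one_eq_of_homotopicRel h]
  map_trans' {x y z} γ γ' := by
    have hpe : x = s.proj ⟨x, (0 : A)⟩ := rfl
    have key := s.isCoveringMap.liftPath_trans hpe γ γ'
    set Γ := s.isCoveringMap.liftPath γ.1 ⟨x, (0 : A)⟩ (γ.source.trans hpe) with hΓ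
    have hΓ1 : γ'.1 0 = s.proj (Γ 1) := by
      have : s.proj (Γ 1) = γ.1 1 := congrFun (s.isCoveringMap.liftPath_lifts _ _ _) 1
      rw [this]
      exact γ'.source.trans γ.target.symm
    set Γ' := s.isCoveringMap.liftPath γ'.1 (Γ 1) hΓ1 with hΓ'
    have h1 := s.coord_sub_coord (s.lift γ.1).continuous (s.proj_lift _) Γ.continuous
      (s.isCoveringMap.liftPath_lifts _ _ _)
    have h2 := s.coord_sub_coord (s.lift γ'.1).continuous (s.proj_lift _) Γ'.continuous
      (s.isCoveringMap.liftPath_lifts _ _ _)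
    have h3 := s.coord_sub_coord (s.lift (γ.trans γ').1).continuous (s.proj_lift _)
      (s.isCoveringMap.liftPath (γ.trans γ').1 ⟨x, (0 : A)⟩ (γ.trans γ').source).continuous
      (s.isCoveringMap.liftPath_lifts _ _ _)
    rw [h1, h2, h3]
    have h4 : Γ' 0 = Γ 1 := s.isCoveringMap.liftPath_zero _ _ _
    have h5 : s.isCoveringMap.liftPath (γ.trans γ').1 ⟨x, (0 : A)⟩ (γ.trans γ').source 1 = Γ' 1 :=
      (congrArg (fun f : C(I, s.core.TotalSpace) => f 1) key).trans (Path.target _)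
    have h6 : s.isCoveringMap.liftPath (γ.trans γ').1 ⟨x, (0 : A)⟩ (γ.trans γ').source 0 = Γ 0 :=
      (s.isCoveringMap.liftPath_zero _ _ _).trans (s.isCoveringMap.liftPath_zero _ _ _).symm
    rw [h4, h5, h6]
    abel

theorem toPathCocycle_apply (y : M) (h : C(I, M)) (hh : range h ⊆ s.dom y) :
    s.toPathCocycle h = s.val y (h 1) - s.val y (h 0) := by
  have := unitInterval.eq_of_eventually_eq (g := fun t => s.coord (s.lift h t) - s.val y (h t)) (fun t =>
    s.eventually_coord (s.lift h).continuous (s.proj_lift h) t y (hh ⟨t, rfl⟩)) 0 1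
  change s.coord (s.lift h 1) - s.coord (s.lift h 0) = _
  have h2 : s.coord (s.lift h 0) - s.val y (h 0) = s.coord (s.lift h 1) - s.val y (h 1) := this
  rw [sub_eq_sub_iff_add_eq_add] at h2 ⊢
  rw [← h2, add_comm]

end LocalPrimitives

/-- Local primitives are primitives of a path cocycle. -/
theorem LocalPrimitives.exists_pathCocycle (s : LocalPrimitives M A) :
    ∃ T : PathCocycle M A, ∀ (y : M) (h : C(I, M)), range h ⊆ s.dom y →
      T h = s.val y (h 1) - s.val y (h 0) := by
  let _ : TopologicalSpace A := ⊥
  have : DiscreteTopology A := ⟨rfl⟩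
  exact ⟨s.toPathCocycle, s.toPathCocycle_apply⟩

end Gluing

/-! ## Embedded arcs and simple closed curves -/

section Arcs

variable {X : Type*} [TopologicalSpace X] {E : Type*} [NormedAddCommGroup E] [NormedSpace ℝ E]

theorem Path.trans_injective {x y z : X} {α : Path x y} {β : Path y z} (hα : Injective α)
    (hβ : Injective β) (h : ∀ s t, α s = β t → t = 0) : Injective (α.trans β) := by
  have key : ∀ s t : I, (s : ℝ) ≤ 1 / 2 → ¬ (t : ℝ) ≤ 1 / 2 →
      (α.trans β) s ≠ (α.trans β) t := by
    intro s t hs ht hst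
    rw [Path.trans_apply, Path.trans_apply, dif_pos hs, dif_neg ht] at hst
    have := congrArg Subtype.val (h _ _ hst)
    simp only [Icc.coe_zero] at this
    linarith
  intro s t hst
  by_cases hs : (s : ℝ) ≤ 1 / 2 <;> by_cases ht : (t : ℝ) ≤ 1 / 2
  · rw [Path.trans_apply, Path.trans_apply, dif_pos hs, dif_pos ht] at hst
    have := congrArg Subtype.val (hα hst)
    exact Subtype.ext (by simpa using this)
  · exact absurd hst (key s t hs ht)
  · exact absurd hst.symm (key t s ht hs)
  · rw [Path.trans_apply, Path.trans_apply, dif_neg hs, dif_neg ht] at hst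
    have := congrArg Subtype.val (hβ hst)
    exact Subtype.ext (by simpa using this)

theorem Path.trans_injOn {x y : X} {α : Path x y} {β : Path y x} (hα : Injective α)
    (hβ : Injective β) (h : ∀ s t, α s = β t → t = 0 ∨ t = 1) :
    InjOn (α.trans β) {t | t ≠ 1} := by
  have key : ∀ s t : I, t ≠ 1 → (s : ℝ) ≤ 1 / 2 → ¬ (t : ℝ) ≤ 1 / 2 →
      (α.trans β) s ≠ (α.trans β) t := by
    intro s t ht1 hs ht hst
    rw [Path.trans_apply, Path.trans_apply, dif_pos hs, dif_neg ht] at hst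
    rcases h _ _ hst with h | h <;> have := congrArg Subtype.val h
    · simp only [Icc.coe_zero] at this
      linarith
    · simp only [Icc.coe_one] at this
      exact ht1 (Subtype.ext (by simp only [Icc.coe_one]; linarith))
  intro s hs1 t ht1 hst
  by_cases hs : (s : ℝ) ≤ 1 / 2 <;> by_cases ht : (t : ℝ) ≤ 1 / 2
  · rw [Path.trans_apply, Path.trans_apply, dif_pos hs, dif_pos ht] at hst
    have := congrArg Subtype.val (hα hst)
    exact Subtype.ext (by simpa using this)
  · exact absurd hst (key s t ht1 hs ht)
  · exact absurd hst.symm (key t s hs1 ht hs)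
  · rw [Path.trans_apply, Path.trans_apply, dif_neg hs, dif_neg ht] at hst
    have := congrArg Subtype.val (hβ hst)
    exact Subtype.ext (by simpa using this)

theorem Path.subpath_injective {x y : X} {γ : Path x y} (hγ : Injective γ) {t₀ t₁ : I}
    (h : t₀ ≠ t₁) : Injective (γ.subpath t₀ t₁) := by
  intro s t hst
  have h1 := congrArg Subtype.val (hγ hst)
  simp only [Icc.coe_convexComb] at h1
  have h2 : ((s : ℝ) - t) * ((t₁ : ℝ) - t₀) = 0 := by
    linear_combination h1
  rcases mul_eq_zero.1 h2 with h3 | h3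
  · exact Subtype.ext (by linarith)
  · exact absurd (Subtype.ext (by linarith)) h

/-- The set of points reached from `x` by injective paths is clopen. To pass from `z` to `w` inside
a small patch, cut the path to `z` when it first enters a larger closed patch and continue along a
straight segment, which meets the earlier piece only at the cut. If `x` itself lies in the closed
patch, a segment suffices. -/
theorem exists_injective_path [T2Space X] [RegularSpace X] [PreconnectedSpace X]
    (hX : HasConvexPatches X E) {x y : X} (hxy : x ≠ y) : ∃ γ : Path x y, Injective γ := by
  let S : Set X := {y | y = x ∨ ∃ γ : Path x y, Injective γ}
  have hS : ∀ y, ∃ N ∈ 𝓝 y, ∀ z ∈ N, z ∈ S → N ⊆ S := by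
    intro y
    obtain ⟨P, Q, hy, hQ, hQP, hP, -⟩ := hX.exists_closed y Filter.univ_mem
    refine ⟨Q.source, hQ.mem_nhds hy, fun z hz hzS w hw => ?_⟩
    by_cases hwx : w = x
    · exact Or.inl hwx
    refine Or.inr ?_
    by_cases hxP : x ∈ P.source
    · exact ⟨P.segment hxP (hQP hw), P.segment_injective _ _ (Ne.symm hwx)⟩
    obtain ⟨γ, hγ⟩ : ∃ γ : Path x z, Injective γ := by
      rcases hzS with rfl | h
      · exact absurd (hQP hz) hxP
      · exact h
    have hK : IsCompact (γ ⁻¹' P.source) := (hP.preimage γ.continuous).isCompact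
    obtain ⟨t₀, ht₀, hmin⟩ := hK.exists_isLeast ⟨1, by simpa using hQP hz⟩
    have h0 : (0 : I) ≠ t₀ := by
      rintro rfl
      exact hxP (by simpa using ht₀)
    have hα := Path.subpath_injective hγ h0
    -- The segment would be constant, hence not injective, in this case.
    by_cases hwt : γ t₀ = w
    · exact ⟨(γ.subpath 0 t₀).cast γ.source.symm hwt.symm, hα⟩
    refine ⟨((γ.subpath 0 t₀).trans (P.segment ht₀ (hQP hw))).cast γ.source.symm rfl, ?_⟩
    refine Path.trans_injective hα (P.segment_injective _ _ hwt) fun s t hst => ?_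
    have hmem : γ.subpath 0 t₀ s ∈ P.source := hst ▸ P.segment_mem ht₀ (hQP hw) t
    have hr : γ.subpath 0 t₀ s ∈ γ '' Icc 0 t₀ := by
      rw [← γ.range_subpath_of_le _ _ unitInterval.nonneg']
      exact ⟨s, rfl⟩
    obtain ⟨r, ⟨-, hr⟩, hrs⟩ := hr
    have : r = t₀ := le_antisymm hr (hmin (show γ r ∈ P.source from hrs ▸ hmem))
    refine P.segment_injective ht₀ (hQP hw) hwt ?_
    rw [← hst, ← hrs, this]
    simp
  have hclopen : IsClopen S := by
    constructor
    · rw [← isOpen_compl_iff, isOpen_iff_mem_nhds]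
      intro y hy
      obtain ⟨N, hN, h⟩ := hS y
      filter_upwards [hN] with z hz hzS
      exact hy (h z hz hzS (mem_of_mem_nhds hN))
    · rw [isOpen_iff_mem_nhds]
      intro y hy
      obtain ⟨N, hN, h⟩ := hS y
      exact Filter.mem_of_superset hN (h y (mem_of_mem_nhds hN) hy)
  have huniv : S = univ := hclopen.eq_univ ⟨x, Or.inl rfl⟩
  rcases (huniv.symm ▸ mem_univ y : y ∈ S) with h | h
  · exact absurd h.symm hxy
  · exact h

namespace PathCocycle

variable {A : Type*} [AddCommGroup A] (T : PathCocycle X A)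

/-- This is the gluing condition for primitives on `W` and on a patch, whose overlap may be
disconnected. If the difference of the primitives varied along an embedded path in `W`, then between
a last time with the old value and a first time with a new one the path would avoid the patch.
Closing that piece by a segment gives a simple closed curve on which `T` is the nonzero jump. -/
theorem primitive_sub_eq [T2Space X] [RegularSpace X] (hX : HasConvexPatches X E)
    (hT : ∀ h : C(I, X), h 0 = h 1 → InjOn h {t | t ≠ 1} → T h = 0) {W : Set X} (hW : IsOpen W)
    (hWc : IsPreconnected W) {w₁ w₂ : X → A}
    (hw₁ : ∀ h : C(I, X), range h ⊆ W → T h = w₁ (h 1) - w₁ (h 0)) {P : ConvexPatch X E}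
    (hP : IsClosed P.source) {O : Set X} (hO : IsOpen O) (hPO : P.source ⊆ O)
    (hw₂ : ∀ h : C(I, X), range h ⊆ O → T h = w₂ (h 1) - w₂ (h 0)) {z z' : X}
    (hz : z ∈ W ∩ P.source) (hz' : z' ∈ W ∩ P.source) : w₁ z - w₂ z = w₁ z' - w₂ z' := by
  by_contra hne
  have hzz' : z ≠ z' := by
    rintro rfl
    exact hne rfl
  obtain ⟨γ, hγ, hγW⟩ : ∃ γ : Path z z', Injective γ ∧ ∀ t, γ t ∈ W := by
    have : PreconnectedSpace W := Subtype.preconnectedSpace hWc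
    obtain ⟨γ, hγ⟩ := exists_injective_path (hX.subtype hW) (x := ⟨z, hz.1⟩) (y := ⟨z', hz'.1⟩)
      (by simpa using hzz')
    exact ⟨γ.map continuous_subtype_val, Subtype.val_injective.comp hγ, fun t => (γ t).2⟩
  set κ : I → A := fun t => w₁ (γ t) - w₂ (γ t) with hκ
  have hloc : ∀ t, γ t ∈ P.source → ∀ᶠ t' in 𝓝 t, κ t' = κ t := by
    intro t ht
    obtain ⟨ε, hε, hball⟩ := Metric.mem_nhds_iff.1
      ((hO.preimage γ.continuous).mem_nhds (hPO ht))
    filter_upwards [Metric.ball_mem_nhds t hε] with t' ht'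
    have hsub : range (γ.subpath t t').1 ⊆ O := by
      have : range (γ.subpath t t').1 = γ '' uIcc t t' := γ.range_subpath t t'
      rw [this]
      rintro _ ⟨s, hs, rfl⟩
      refine hball ?_
      have h1 : (s : ℝ) ∈ uIcc (t : ℝ) t' := by
        rcases le_total t t' with h | h
        · rw [uIcc_of_le h] at hs
          rw [uIcc_of_le (by exact_mod_cast h)]
          exact hs
        · rw [uIcc_of_ge h] at hs
          rw [uIcc_of_ge (by exact_mod_cast h)]
          exact hs
      have h2 := abs_sub_left_of_mem_uIcc h1
      rw [Metric.mem_ball, Subtype.dist_eq, Real.dist_eq] at ht' ⊢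
      linarith
    have hsub' : range (γ.subpath t t').1 ⊆ W := by
      rintro _ ⟨s, rfl⟩
      exact hγW _
    have e1 := hw₁ _ hsub'
    have e2 := hw₂ _ hsub
    have f0 : (γ.subpath t t').1 0 = γ t := (γ.subpath t t').source
    have f1 : (γ.subpath t t').1 1 = γ t' := (γ.subpath t t').target
    rw [f0, f1] at e1 e2
    have := e1.symm.trans e2
    simp only [hκ]
    rw [sub_eq_sub_iff_add_eq_add] at this ⊢
    rw [this, add_comm]
  have hKc : IsClosed {t | γ t ∈ P.source} := hP.preimage γ.continuous
  -- Local constancy of `κ` on the closed set of times spent in the patch makes its level sets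
  -- closed, so extremal times exist.
  have hclosed : ∀ p : A → Prop, IsClosed {t | γ t ∈ P.source ∧ p (κ t)} := by
    intro p
    refine isClosed_of_closure_subset fun t ht => ?_
    have h1 : γ t ∈ P.source := closure_minimal (fun s hs => hs.1) hKc ht
    obtain ⟨s, hs, hs'⟩ := mem_closure_iff_nhds.1 ht _ (hloc t h1)
    exact ⟨h1, hs ▸ hs'.2⟩
  -- The first time in the patch with a new value is `t₁`, and `s₀` is the last earlier time in the
  -- patch with the old value; strictly between them the path is outside the patch.
  obtain ⟨t₁, ⟨ht₁, hκ₁⟩, hmin⟩ := (hclosed (fun a => a ≠ κ 0)).isCompact.exists_isLeast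
    ⟨1, by simpa using hz'.2, by simpa [hκ] using Ne.symm hne⟩
  obtain ⟨s₀, ⟨⟨hs₀, hκ₀⟩, hst⟩, hmax⟩ := ((hclosed (fun a => a = κ 0)).inter
    (isClosed_Iic (a := t₁))).isCompact.exists_isGreatest ⟨0, ⟨by simpa using hz.2, rfl⟩, unitInterval.nonneg'⟩
  have hlt : s₀ ≠ t₁ := by
    rintro rfl
    exact hκ₁ hκ₀
  have hba : γ t₁ ≠ γ s₀ := fun h => hlt (hγ h).symm
  have hmid : ∀ r ∈ Icc s₀ t₁, γ r ∈ P.source → r = s₀ ∨ r = t₁ := by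
    rintro r ⟨hr0, hr1⟩ hr
    by_cases hκr : κ r = κ 0
    · exact Or.inl (le_antisymm (hmax ⟨⟨hr, hκr⟩, hr1⟩) hr0)
    · exact Or.inr (le_antisymm hr1 (hmin ⟨hr, hκr⟩))
  have hzero := hT ((γ.subpath s₀ t₁).trans (P.segment ht₁ hs₀)).1 (by
      change ((γ.subpath s₀ t₁).trans (P.segment ht₁ hs₀)) 0 =
        ((γ.subpath s₀ t₁).trans (P.segment ht₁ hs₀)) 1
      simp) <| by
    refine Path.trans_injOn (Path.subpath_injective hγ hlt) (P.segment_injective _ _ hba)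
      fun s t hs => ?_
    have hmem : γ.subpath s₀ t₁ s ∈ P.source := hs ▸ P.segment_mem ht₁ hs₀ t
    have hr : γ.subpath s₀ t₁ s ∈ γ '' Icc s₀ t₁ := by
      rw [← γ.range_subpath_of_le _ _ hst]
      exact ⟨s, rfl⟩
    obtain ⟨r, hr, hrs⟩ := hr
    rcases hmid r hr (hrs ▸ hmem) with rfl | rfl
    · refine Or.inr (P.segment_injective ht₁ hs₀ hba ?_)
      rw [← hs, ← hrs]
      simp
    · refine Or.inl (P.segment_injective ht₁ hs₀ hba ?_)
      rw [← hs, ← hrs]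
      simp
  rw [T.map_trans, hw₁ (γ.subpath s₀ t₁).1 (by rintro _ ⟨s, rfl⟩; exact hγW _),
    hw₂ (P.segment ht₁ hs₀).1 ((P.range_segment_subset _ _).trans hPO)] at hzero
  have f0 : (γ.subpath s₀ t₁).1 0 = γ s₀ := (γ.subpath s₀ t₁).source
  have f1 : (γ.subpath s₀ t₁).1 1 = γ t₁ := (γ.subpath s₀ t₁).target
  have g0 : (P.segment ht₁ hs₀).1 0 = γ t₁ := (P.segment ht₁ hs₀).source
  have g1 : (P.segment ht₁ hs₀).1 1 = γ s₀ := (P.segment ht₁ hs₀).target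
  rw [f0, f1, g0, g1] at hzero
  apply hκ₁
  rw [← hκ₀, ← sub_eq_zero, ← hzero]
  simp only [hκ]
  abel

/-- In a connected space with convex patches, a path cocycle which vanishes on simple closed
curves vanishes on all loops. -/
theorem loop_eq_zero_of_simple [T2Space X] [RegularSpace X] [PreconnectedSpace X]
    (hX : HasConvexPatches X E)
    (hT : ∀ h : C(I, X), h 0 = h 1 → InjOn h {t | t ≠ 1} → T h = 0) (h : C(I, X))
    (h01 : h 0 = h 1) : T h = 0 := by
  classical
  -- Zorn's lemma yields a maximal connected open set on whose loops `T` vanishes. By compactness a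
  -- loop in the union of a chain already lies in one member. The rest shows that a maximal set is
  -- closed.
  let F : Set (Set X) := {W | IsOpen W ∧ IsPreconnected W ∧
    ∀ h : C(I, X), range h ⊆ W → h 0 = h 1 → T h = 0}
  have hpre : ∀ P : ConvexPatch X E, IsPreconnected P.source := fun P => by
    rw [← P.symm_image_target_eq_source]
    exact P.convex_target.isPreconnected.image _ P.continuousOn_invFun
  obtain ⟨P₀, hP₀, hP₀o, -⟩ := hX (h 0) univ Filter.univ_mem
  obtain ⟨W, hW₀, hW⟩ := zorn_subset_nonempty F (fun c hcF hc hcne => by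
      refine ⟨⋃₀ c, ⟨isOpen_sUnion fun W hW => (hcF hW).1,
        IsPreconnected.sUnion_directed hc.directedOn fun W hW => (hcF hW).2.1,
        fun h hh h01 => ?_⟩, fun W hW => subset_sUnion_of_mem hW⟩
      have : Nonempty c := hcne.to_subtype
      rw [sUnion_eq_iUnion] at hh
      obtain ⟨W, hW⟩ := (isCompact_range h.continuous).elim_directed_cover
        (fun W : c => (W : Set X)) (fun W => (hcF W.2).1) hh
        (directedOn_iff_directed.1 hc.directedOn)
      exact (hcF W.2).2.2 h hW h01) P₀.source
    ⟨hP₀o, hpre P₀, fun h hh h01 => P₀.cocycle_loop_eq_zero T h hh h01⟩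
  obtain ⟨hWo, hWc, hWT⟩ := hW.prop
  have hWcl : IsClosed W := by
    refine isClosed_of_closure_subset fun y hy => ?_
    obtain ⟨P₁, Q₁, hy₁, hQ₁, hQP₁, -, -⟩ := hX.exists_closed y Filter.univ_mem
    -- Three nested patches around `y`: the open `Q₁` carries a primitive, the closed `P` feeds
    -- `primitive_sub_eq`, and the open `Q` is added to `W`.
    obtain ⟨P, Q, hyQ, hQ, hQP, hP, hPQ⟩ := hX.exists_closed y (hQ₁.mem_nhds hy₁)
    obtain ⟨w₁, hw₁⟩ := T.exists_primitive W hWT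
    obtain ⟨w₂, hw₂⟩ := T.exists_primitive Q₁.source
      fun h hh h01 => Q₁.cocycle_loop_eq_zero T h hh h01
    have hκ := fun {z z' : X} => T.primitive_sub_eq hX hT hWo hWc hw₁ hP hQ₁ hPQ hw₂
      (z := z) (z' := z')
    obtain ⟨z₀, hz₀Q, hz₀W⟩ := mem_closure_iff_nhds.1 hy _ (hQ.mem_nhds hyQ)
    have hmem : W ∪ Q.source ∈ F := by
      refine ⟨hWo.union hQ, hWc.union z₀ hz₀W hz₀Q (hpre Q), fun h hh h01 => ?_⟩
      -- The two primitives, matched at `z₀`, agree on the whole overlap by `hκ` and glue to a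
      -- primitive on the union.
      set w : X → A := fun z => if z ∈ W then w₁ z else w₂ z + (w₁ z₀ - w₂ z₀) with hw
      have hwW : ∀ z ∈ W, w z = w₁ z := fun z hz => if_pos hz
      have hwQ : ∀ z ∈ Q.source, w z = w₂ z + (w₁ z₀ - w₂ z₀) := fun z hz => by
        by_cases hzW : z ∈ W
        · rw [hwW z hzW, ← hκ ⟨hzW, hQP hz⟩ ⟨hz₀W, hQP hz₀Q⟩]
          abel
        · exact if_neg hzW
      have := ContinuousMap.path_induction (P := fun h => T.sub (coboundary w) h = 0)
        (fun γ γ' h h' => by rw [← map_homotopic _ h, h'])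
        (fun γ γ' h h' => by rw [map_trans, h, h', add_zero]) h (fun t => by
          rcases hh ⟨t, rfl⟩ with ht | ht
          · refine ⟨W, hWo.mem_nhds ht, fun h' hh' => ?_⟩
            have hh'' := fun t => (hh' ⟨t, rfl⟩).2
            rw [sub_apply, coboundary_apply, hw₁ h' fun z hz => (hh' hz).2,
              hwW _ (hh'' 0), hwW _ (hh'' 1), sub_self]
          · refine ⟨Q.source, hQ.mem_nhds ht, fun h' hh' => ?_⟩
            have hh'' := fun t => (hh' ⟨t, rfl⟩).2
            rw [sub_apply, coboundary_apply, hw₂ h' fun z hz => hPQ (hQP (hh' hz).2),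
              hwQ _ (hh'' 0), hwQ _ (hh'' 1)]
            abel)
      rwa [sub_apply, coboundary_apply, h01, sub_self, sub_zero] at this
    exact hW.le_of_ge hmem subset_union_left (Or.inr hyQ)
  have huniv : W = univ := IsClopen.eq_univ ⟨hWcl, hWo⟩ ⟨_, hW₀ hP₀⟩
  exact hWT h (huniv ▸ subset_univ _) h01

end PathCocycle

end Arcs

/-! ## Path cocycles and relative singular homology -/

section Singular

variable {X Y : Type*} [TopologicalSpace X] [TopologicalSpace Y] {A : Type*} [AddCommGroup A]

theorem PathCocycle.exists_primitive_of_simplyConnected [SimplyConnectedSpace X]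
    (T : PathCocycle X A) : ∃ w : X → A, ∀ h : C(I, X), T h = w (h 1) - w (h 0) := by
  obtain ⟨w, hw⟩ := T.exists_primitive univ fun h _ h01 => by
    let γ : Path (h 0) (h 0) := ⟨h, rfl, h01.symm⟩
    rw [← T.map_refl (h 0)]
    exact T.map_homotopic (γ := γ) (SimplyConnectedSpace.paths_homotopic _ _)
  exact ⟨w, fun h => hw h (subset_univ _)⟩

theorem stdSimplex_map_succAbove_apply {n : ℕ} (i : Fin (n + 2)) (s : stdSimplex ℝ (Fin (n + 1)))
    (j : Fin (n + 1)) : stdSimplex.map i.succAbove s (i.succAbove j) = s j := by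
  rw [stdSimplex.map_coe, FunOnFinite.linearMap_apply_apply]
  rw [Finset.sum_eq_single j] <;> simp

theorem stdSimplex_map_succAbove_self {n : ℕ} (i : Fin (n + 2)) (s : stdSimplex ℝ (Fin (n + 1))) :
    stdSimplex.map i.succAbove s i = 0 := by
  rw [stdSimplex.map_coe, FunOnFinite.linearMap_apply_apply]
  refine Finset.sum_eq_zero fun j hj => ?_
  simp at hj

/-- The class of a path in the singular 1-chains of `X` modulo boundaries and chains in `B`. -/
noncomputable def chainClass (B : Set X) (h : C(I, X)) : SingChain X 1 ⧸ relBoundaries B :=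
  Submodule.Quotient.mk (Finsupp.single (pathSimplex h) 1)

/-- The relation is read off the boundary of τ, where face 1 carries the opposite sign; homotopy
invariance and additivity come from suitable choices of τ. -/
theorem chainClass_triangle (B : Set X) (τ : SingSimplex X 2) {h₀ h₁ h₂ : C(I, X)}
    (e₀ : τ.face 0 = pathSimplex h₀) (e₁ : τ.face 1 = pathSimplex h₁)
    (e₂ : τ.face 2 = pathSimplex h₂) :
    chainClass B h₁ = chainClass B h₂ + chainClass B h₀ := by
  rw [chainClass, chainClass, chainClass, ← Submodule.Quotient.mk_add, Submodule.Quotient.eq]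
  refine Submodule.mem_sup_left ⟨Finsupp.single τ (-1), ?_⟩
  rw [singBoundary, Finsupp.linearCombination_single, Fin.sum_univ_three, e₀, e₁, e₂]
  simp
  abel

theorem chainClass_const (B : Set X) (x : X) : chainClass B (ContinuousMap.const I x) = 0 := by
  have := chainClass_triangle B (ContinuousMap.const _ x) (h₀ := ContinuousMap.const I x)
    (h₁ := ContinuousMap.const I x) (h₂ := ContinuousMap.const I x) rfl rfl rfl
  simpa using this

theorem chainClass_of_mem {B : Set X} {h : C(I, X)} (hh : range h ⊆ B) : chainClass B h = 0 := by
  rw [chainClass, Submodule.Quotient.mk_eq_zero]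
  exact Submodule.mem_sup_right (Finsupp.single_mem_supported ℤ _ fun s => hh ⟨_, rfl⟩)

/-! ### Explicit 2-simplices for homotopies and concatenations. -/

/-- The sum of the last two barycentric coordinates on the 2-simplex. -/
noncomputable def simplexSum : C(stdSimplex ℝ (Fin 3), I) where
  toFun x := ⟨x 1 + x 2, add_nonneg (stdSimplex.zero_le x 1) (stdSimplex.zero_le x 2), by
    have h := stdSimplex.sum_eq_one x
    rw [Fin.sum_univ_three] at h
    linarith [stdSimplex.zero_le x 0]⟩
  continuous_toFun := (((continuous_apply 1).comp continuous_subtype_val).add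
    ((continuous_apply 2).comp continuous_subtype_val)).subtype_mk _

/-- The last barycentric coordinate on the 2-simplex. -/
noncomputable def simplexLast : C(stdSimplex ℝ (Fin 3), I) where
  toFun x := ⟨x 2, stdSimplex.zero_le x 2, stdSimplex.le_one x 2⟩
  continuous_toFun := ((continuous_apply 2).comp continuous_subtype_val).subtype_mk _

/-- The mean of `simplexSum` and `simplexLast`. -/
noncomputable def simplexMean : C(stdSimplex ℝ (Fin 3), I) where
  toFun x := ⟨((simplexSum x : ℝ) + simplexLast x) / 2, by
    linarith [(simplexSum x).2.1, (simplexLast x).2.1], by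
    linarith [(simplexSum x).2.2, (simplexLast x).2.2]⟩
  continuous_toFun := (((continuous_subtype_val.comp simplexSum.continuous).add
    (continuous_subtype_val.comp simplexLast.continuous)).div_const 2).subtype_mk _

variable (s : stdSimplex ℝ (Fin 2))

/-- On faces 0, 1, 2 the pair (`simplexSum`, `simplexLast`) is (1, t), (t, t), (t, 0): it identifies
the 2-simplex with the half of the unit square on one side of the diagonal. -/
theorem simplexSum_face_zero : simplexSum (stdSimplex.map (Fin.succAbove (0 : Fin 3)) s) = 1 :=
  Subtype.ext <| (congrArg₂ (· + ·) (stdSimplex_map_succAbove_apply 0 s 0)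
    (stdSimplex_map_succAbove_apply 0 s 1)).trans (stdSimplex.add_eq_one s)

theorem simplexSum_face_one : simplexSum (stdSimplex.map (Fin.succAbove (1 : Fin 3)) s) =
    stdSimplexHomeomorphUnitInterval s :=
  Subtype.ext <| (congrArg₂ (· + ·) (stdSimplex_map_succAbove_self 1 s)
    (stdSimplex_map_succAbove_apply 1 s 1)).trans (zero_add _)

theorem simplexSum_face_two : simplexSum (stdSimplex.map (Fin.succAbove (2 : Fin 3)) s) =
    stdSimplexHomeomorphUnitInterval s :=
  Subtype.ext <| (congrArg₂ (· + ·) (stdSimplex_map_succAbove_apply 2 s 1)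
    (stdSimplex_map_succAbove_self 2 s)).trans (add_zero _)

theorem simplexLast_face_zero : simplexLast (stdSimplex.map (Fin.succAbove (0 : Fin 3)) s) =
    stdSimplexHomeomorphUnitInterval s :=
  Subtype.ext <| stdSimplex_map_succAbove_apply 0 s 1

theorem simplexLast_face_one : simplexLast (stdSimplex.map (Fin.succAbove (1 : Fin 3)) s) =
    stdSimplexHomeomorphUnitInterval s :=
  Subtype.ext <| stdSimplex_map_succAbove_apply 1 s 1

theorem simplexLast_face_two : simplexLast (stdSimplex.map (Fin.succAbove (2 : Fin 3)) s) = 0 :=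
  Subtype.ext <| stdSimplex_map_succAbove_self 2 s

/-- The square of the homotopy is cut along its diagonal `d` into two triangles. Two of its sides
are constant, so both paths have the class of `d`. -/
theorem chainClass_homotopic (B : Set X) {x y : X} {γ γ' : Path x y} (h : γ.Homotopic γ') :
    chainClass B γ.1 = chainClass B γ'.1 := by
  obtain ⟨H⟩ := h
  let d : C(I, X) := ⟨fun t => H (t, t), by fun_prop⟩
  have h1 := chainClass_triangle B (H.toContinuousMap.comp (simplexSum.prodMk simplexLast))
    (h₀ := γ'.1) (h₁ := d) (h₂ := ContinuousMap.const I x)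
    (ContinuousMap.ext fun s => by
      change H (simplexSum (stdSimplex.map (Fin.succAbove (0 : Fin 3)) s), simplexLast
        (stdSimplex.map (Fin.succAbove (0 : Fin 3)) s)) = γ' (stdSimplexHomeomorphUnitInterval s)
      rw [simplexSum_face_zero, simplexLast_face_zero]
      exact H.apply_one _)
    (ContinuousMap.ext fun s => by
      change H (simplexSum (stdSimplex.map (Fin.succAbove (1 : Fin 3)) s), simplexLast
        (stdSimplex.map (Fin.succAbove (1 : Fin 3)) s)) = H (_, _)
      rw [simplexSum_face_one, simplexLast_face_one]
      rfl)
    (ContinuousMap.ext fun s => by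
      change H (simplexSum (stdSimplex.map (Fin.succAbove (2 : Fin 3)) s), simplexLast
        (stdSimplex.map (Fin.succAbove (2 : Fin 3)) s)) = x
      rw [simplexSum_face_two, simplexLast_face_two]
      exact H.source _)
  have h2 := chainClass_triangle B (H.toContinuousMap.comp (simplexLast.prodMk simplexSum))
    (h₀ := ContinuousMap.const I y) (h₁ := d) (h₂ := γ.1)
    (ContinuousMap.ext fun s => by
      change H (simplexLast
        (stdSimplex.map (Fin.succAbove (0 : Fin 3)) s), simplexSum (stdSimplex.map (Fin.succAbove (0 : Fin 3)) s)) = y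
      rw [simplexSum_face_zero, simplexLast_face_zero]
      exact H.target _)
    (ContinuousMap.ext fun s => by
      change H (simplexLast
        (stdSimplex.map (Fin.succAbove (1 : Fin 3)) s), simplexSum (stdSimplex.map (Fin.succAbove (1 : Fin 3)) s)) = H (_, _)
      rw [simplexSum_face_one, simplexLast_face_one]
      rfl)
    (ContinuousMap.ext fun s => by
      change H (simplexLast
        (stdSimplex.map (Fin.succAbove (2 : Fin 3)) s), simplexSum (stdSimplex.map (Fin.succAbove (2 : Fin 3)) s)) = γ (stdSimplexHomeomorphUnitInterval s)
      rw [simplexSum_face_two, simplexLast_face_two]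
      exact H.apply_zero _)
  rw [chainClass_const, zero_add] at h1
  rw [chainClass_const, add_zero] at h2
  rw [← h1, h2]

/-- The filling 2-simplex is degenerate: `simplexMean` sends the vertices to 0, 1/2 and 1, so its
faces run through the second half, the whole and the first half of the concatenation. -/
theorem chainClass_trans (B : Set X) {x y z : X} (γ : Path x y) (γ' : Path y z) :
    chainClass B (γ.trans γ').1 = chainClass B γ.1 + chainClass B γ'.1 := by
  refine chainClass_triangle B ((γ.trans γ').1.comp simplexMean) (ContinuousMap.ext fun s => ?_)
    (ContinuousMap.ext fun s => ?_) (ContinuousMap.ext fun s => ?_)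
  · change (γ.trans γ') (simplexMean (stdSimplex.map (Fin.succAbove (0 : Fin 3)) s)) = γ' (stdSimplexHomeomorphUnitInterval s)
    have h : (simplexMean (stdSimplex.map (Fin.succAbove (0 : Fin 3)) s) : ℝ) =
        (1 + stdSimplexHomeomorphUnitInterval s) / 2 := by
      change (((simplexSum (stdSimplex.map (Fin.succAbove (0 : Fin 3)) s) : I) : ℝ) + (simplexLast (stdSimplex.map
        (Fin.succAbove (0 : Fin 3)) s) : I)) / 2 = _
      rw [simplexSum_face_zero, simplexLast_face_zero]
      rfl
    have hs := (stdSimplexHomeomorphUnitInterval s).2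
    rw [Path.trans_apply]
    split_ifs with h'
    -- At the midpoint `Path.trans_apply` uses the first path; the two halves agree there.
    · have h1 : stdSimplexHomeomorphUnitInterval s = 0 := by
        rw [h] at h'
        exact Subtype.ext (le_antisymm (by simp only [Icc.coe_zero]; linarith) hs.1)
      rw [h1, γ'.source]
      refine (congrArg γ (Subtype.ext ?_ : _ = (1 : I))).trans γ.target
      change 2 * (simplexMean (stdSimplex.map (Fin.succAbove (0 : Fin 3)) s) : ℝ) = 1
      rw [h, h1]
      norm_num
    · congr 1
      refine Subtype.ext ?_
      change 2 * (simplexMean (stdSimplex.map (Fin.succAbove (0 : Fin 3)) s) : ℝ) - 1 = _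
      rw [h]
      ring
  · change (γ.trans γ') (simplexMean (stdSimplex.map (Fin.succAbove (1 : Fin 3)) s)) = (γ.trans γ') (stdSimplexHomeomorphUnitInterval s)
    congr 1
    refine Subtype.ext ?_
    change (((simplexSum (stdSimplex.map (Fin.succAbove (1 : Fin 3)) s) : I) : ℝ) + (simplexLast (stdSimplex.map
        (Fin.succAbove (1 : Fin 3)) s) : I)) / 2 = _
    rw [simplexSum_face_one, simplexLast_face_one]
    ring
  · change (γ.trans γ') (simplexMean (stdSimplex.map (Fin.succAbove (2 : Fin 3)) s)) = γ (stdSimplexHomeomorphUnitInterval s)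
    have h : (simplexMean (stdSimplex.map (Fin.succAbove (2 : Fin 3)) s) : ℝ) =
        (stdSimplexHomeomorphUnitInterval s : ℝ) / 2 := by
      change (((simplexSum (stdSimplex.map (Fin.succAbove (2 : Fin 3)) s) : I) : ℝ) + (simplexLast (stdSimplex.map
        (Fin.succAbove (2 : Fin 3)) s) : I)) / 2 = _
      rw [simplexSum_face_two, simplexLast_face_two]
      simp
    have hs := (stdSimplexHomeomorphUnitInterval s).2
    rw [Path.trans_apply, dif_pos (by rw [h]; linarith [hs.2])]
    congr 1
    refine Subtype.ext ?_
    change 2 * (simplexMean (stdSimplex.map (Fin.succAbove (2 : Fin 3)) s) : ℝ) = _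
    rw [h]
    ring

/-- The path cocycle of the classes of paths in the 1-chains modulo boundaries and chains
in `B`. -/
noncomputable def chainCocycle (B : Set X) : PathCocycle X (SingChain X 1 ⧸ relBoundaries B) where
  toFun := chainClass B
  map_homotopic' _ _ h := chainClass_homotopic B h
  map_trans' := chainClass_trans B

/-- Relative homology sits inside the 1-chains modulo `relBoundaries B`, so classes may be compared
there, where every path has a class and not only relative cycles. -/
theorem pathClass_eq_iff {B : Set X} {h h' : C(I, X)} {hh : h 0 = h 1 ∨ (h 0 ∈ B ∧ h 1 ∈ B)}
    {hh' : h' 0 = h' 1 ∨ (h' 0 ∈ B ∧ h' 1 ∈ B)} :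
    pathClass B h hh = pathClass B h' hh' ↔ chainClass B h = chainClass B h' := by
  rw [pathClass, pathClass, chainClass, chainClass, Submodule.Quotient.eq, Submodule.Quotient.eq]
  rfl

theorem RelH1.map_pathClass {B : Set X} {B' : Set Y} (f : C(X, Y)) (hf : MapsTo f B B')
    (h : C(I, X)) (hh : h 0 = h 1 ∨ (h 0 ∈ B ∧ h 1 ∈ B)) :
    RelH1.map f hf (pathClass B h hh) = pathClass B' (f.comp h)
      (hh.imp (congrArg f) fun h => ⟨hf h.1, hf h.2⟩) := by
  refine congrArg Submodule.Quotient.mk (Subtype.ext ?_)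
  exact Finsupp.mapDomain_single

/-! ### Evaluation of path cocycles on singular chains. -/

/-- The path underlying a singular 1-simplex. -/
noncomputable def simplexPath (θ : SingSimplex X 1) : C(I, X) :=
  θ.comp ⟨stdSimplexHomeomorphUnitInterval.symm, stdSimplexHomeomorphUnitInterval.symm.continuous⟩

theorem simplexPath_pathSimplex (h : C(I, X)) : simplexPath (pathSimplex h) = h :=
  ContinuousMap.ext fun t => congrArg h (stdSimplexHomeomorphUnitInterval.apply_symm_apply t)

/-- The extension of a path cocycle to singular 1-chains. -/
noncomputable def PathCocycle.chainHom (T : PathCocycle X A) : SingChain X 1 →ₗ[ℤ] A :=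
  Finsupp.linearCombination ℤ fun θ => T (simplexPath θ)

theorem PathCocycle.chainHom_single (T : PathCocycle X A) (h : C(I, X)) :
    T.chainHom (Finsupp.single (pathSimplex h) 1) = T h := by
  rw [chainHom, Finsupp.linearCombination_single, one_smul, simplexPath_pathSimplex]

/-- Pulled back to the 2-simplex, which is simply connected, `T` has a primitive, and the
alternating sum of its differences at the vertices cancels. -/
theorem PathCocycle.chainHom_boundary (T : PathCocycle X A) (c : SingChain X 2) :
    T.chainHom (singBoundary X 1 c) = 0 := by
  induction c using Finsupp.induction_linear with
  | zero => simp
  | add a b ha hb => rw [map_add, map_add, ha, hb, add_zero]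
  | single τ a =>
    rw [singBoundary, Finsupp.linearCombination_single, map_smul, map_sum, Fin.sum_univ_three]
    have : SimplyConnectedSpace (stdSimplex ℝ (Fin 3)) := by
      have := (convex_stdSimplex ℝ (Fin 3)).contractibleSpace ⟨_, single_mem_stdSimplex ℝ 0⟩
      infer_instance
    obtain ⟨w, hw⟩ := (T.comp τ).exists_primitive_of_simplyConnected
    have key : ∀ (i : Fin 3) (z : ℤ), T.chainHom (Finsupp.single (τ.face i) z) =
        z • (w (stdSimplex.vertex (i.succAbove 1)) - w (stdSimplex.vertex (i.succAbove 0))) := by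
      intro i z
      rw [chainHom, Finsupp.linearCombination_single]
      have := hw (simplexPath (ContinuousMap.mk (stdSimplex.map i.succAbove)
        (stdSimplex.continuous_map _)))
      rw [comp_apply] at this
      refine congrArg (z • ·) (this.trans ?_)
      have h0 : stdSimplexHomeomorphUnitInterval.symm 0 = stdSimplex.vertex 0 := by
        rw [Homeomorph.symm_apply_eq]
        exact stdSimplexHomeomorphUnitInterval_zero.symm
      have h1 : stdSimplexHomeomorphUnitInterval.symm 1 = stdSimplex.vertex 1 := by
        rw [Homeomorph.symm_apply_eq]
        exact stdSimplexHomeomorphUnitInterval_one.symm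
      change w (stdSimplex.map i.succAbove (stdSimplexHomeomorphUnitInterval.symm 1)) -
        w (stdSimplex.map i.succAbove (stdSimplexHomeomorphUnitInterval.symm 0)) = _
      rw [h0, h1, stdSimplex.map_vertex, stdSimplex.map_vertex]
    rw [key, key, key]
    have e1 : (0 : Fin 3).succAbove 1 = 2 := rfl
    have e2 : (0 : Fin 3).succAbove 0 = 1 := rfl
    have e3 : (1 : Fin 3).succAbove 1 = 2 := rfl
    have e4 : (1 : Fin 3).succAbove 0 = 0 := rfl
    have e5 : (2 : Fin 3).succAbove 1 = 1 := rfl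
    have e6 : (2 : Fin 3).succAbove 0 = 0 := rfl
    rw [e1, e2, e3, e4, e5, e6]
    simp

/-- A path cocycle which vanishes on paths in `B` takes the same value on paths that represent the
same relative class. -/
theorem PathCocycle.eq_of_chainClass_eq (T : PathCocycle X A) {B : Set X}
    (hT : ∀ h : C(I, X), range h ⊆ B → T h = 0) {h h' : C(I, X)}
    (hh : chainClass B h = chainClass B h') : T h = T h' := by
  rw [chainClass, chainClass, Submodule.Quotient.eq] at hh
  have : relBoundaries B ≤ LinearMap.ker T.chainHom := by
    refine sup_le ?_ ?_
    · rintro _ ⟨c, rfl⟩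
      exact T.chainHom_boundary c
    · intro c hc
      rw [LinearMap.mem_ker, chainHom, Finsupp.linearCombination_apply]
      refine Finset.sum_eq_zero fun θ hθ => ?_
      have hθ' : ∀ s, θ s ∈ B := hc hθ
      change _ • T (simplexPath θ) = 0
      rw [hT _ (by rintro _ ⟨t, rfl⟩; exact hθ' _), smul_zero]
  have h0 := this hh
  rwa [LinearMap.mem_ker, map_sub, chainHom_single, chainHom_single, sub_eq_zero] at h0

end Singular

/-! ## Local form of codimension-zero embeddings -/

section Embeddings

variable {X M : Type*} [TopologicalSpace X] [TopologicalSpace M]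

/-- The convex patch given by a convex subset of the target of a chart. -/
def ConvexPatch.ofChart {E : Type*} [NormedAddCommGroup E] [NormedSpace ℝ E]
    (e : OpenPartialHomeomorph M E) {C : Set E} (hC : Convex ℝ C) (hCe : C ⊆ e.target) :
    ConvexPatch M E where
  toPartialEquiv := (e.toPartialEquiv.symm.restr C).symm
  continuousOn_toFun := e.continuousOn_toFun.mono inter_subset_left
  continuousOn_invFun := e.continuousOn_invFun.mono inter_subset_left
  convex_target := by
    change Convex ℝ (e.target ∩ C)
    rwa [inter_eq_right.2 hCe]

/-- A closed embedding whose range is locally a half-space, with boundary the image of `B`. -/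
structure IsTameEmbedding (ι : X → M) (B : Set X) : Prop where
  isClosedEmbedding : IsClosedEmbedding ι
  hasConvexPatches : HasConvexPatches M E3
  exists_patch : ∀ x, ∀ O ∈ 𝓝 (ι x), ∃ P : ConvexPatch M E3, ι x ∈ P.source ∧ IsOpen P.source ∧
    P.source ⊆ O ∧ P.target ∈ 𝓝 (P.toFun (ι x)) ∧
    (∀ z ∈ P.source, z ∈ range ι ↔ 0 ≤ P.toFun z 0) ∧
    ∀ x', ι x' ∈ P.source → (x' ∈ B ↔ P.toFun (ι x') 0 = 0)

theorem hasConvexPatches_of_chartedSpace [ChartedSpace E3 M] : HasConvexPatches M E3 := by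
  intro x O hO
  let e := (chartAt E3 x).restr (interior O)
  have hx : x ∈ e.source := by
    rw [OpenPartialHomeomorph.restr_source, interior_interior]
    exact ⟨mem_chart_source _ _, mem_interior_iff_mem_nhds.2 hO⟩
  obtain ⟨r, hr, hball⟩ := Metric.isOpen_iff.1 e.open_target (e x) (e.map_source hx)
  refine ⟨ConvexPatch.ofChart e (convex_ball (e x) r) hball, ⟨hx, Metric.mem_ball_self hr⟩,
    e.continuousOn.isOpen_inter_preimage e.open_source Metric.isOpen_ball, ?_⟩
  rintro z ⟨hz, -⟩
  have hz' : z ∈ ((chartAt E3 x).restr (interior O)).source := hz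
  rw [OpenPartialHomeomorph.restr_source, interior_interior] at hz'
  exact interior_subset hz'.2

variable [ChartedSpace (EuclideanHalfSpace 3) X] [ChartedSpace E3 M]

/-- A chart of the maximal atlas is a local diffeomorphism to the half-space, and local
diffeomorphisms preserve interior points. -/
theorem isInteriorPoint_iff_of_mem_maximalAtlas
    {φ : OpenPartialHomeomorph X (EuclideanHalfSpace 3)}
    (hφ : φ ∈ IsManifold.maximalAtlas (𝓡∂ 3) ∞ X) {x : X} (hx : x ∈ φ.source) :
    (𝓡∂ 3).IsInteriorPoint x ↔ 0 < (φ x).1 0 := by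
  let Φ : PartialDiffeomorph (𝓡∂ 3) (𝓡∂ 3) X (EuclideanHalfSpace 3) ∞ :=
    { toPartialEquiv := φ.toPartialEquiv
      open_source := φ.open_source
      open_target := φ.open_target
      contMDiffOn_toFun := contMDiffOn_of_mem_maximalAtlas hφ
      contMDiffOn_invFun := contMDiffOn_symm_of_mem_maximalAtlas hφ }
  have h : IsLocalDiffeomorphAt (𝓡∂ 3) (𝓡∂ 3) ∞ φ x := ⟨Φ, hx, fun _ _ => rfl⟩
  rw [h.isInteriorPoint_iff (by simp), ModelWithCorners.IsInteriorPoint,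
    interior_range_modelWithCornersEuclideanHalfSpace]
  simp [extChartAt, chartAt_self_eq]

theorem Manifold.IsImmersionAtOfComplement.codChart_apply_eq {F : Type*} [NormedAddCommGroup F]
    [NormedSpace ℝ F] {ι : X → M} {x : X}
    (hF : IsImmersionAtOfComplement F (𝓡∂ 3) (𝓡 3) ∞ ι x) {x' : X}
    (hx' : x' ∈ hF.domChart.source) :
    hF.codChart (ι x') = hF.equiv ((hF.domChart x').1, 0) := by
  have h : (hF.codChart.extend (𝓡 3)) (ι ((hF.domChart.extend (𝓡∂ 3)).symm
      (hF.domChart.extend (𝓡∂ 3) x'))) = hF.equiv (hF.domChart.extend (𝓡∂ 3) x', 0) :=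
    hF.writtenInCharts ((hF.domChart.extend (𝓡∂ 3)).map_source
      (by rwa [hF.domChart.extend_source]))
  rw [hF.domChart.extend_left_inv hx'] at h
  exact h

/-- In immersion charts ι is u ↦ (u, 0), and equality of dimensions kills the complement. Absorbing
the remaining linear isomorphism into the chart of `M` turns ι into the inclusion of the half-space.
-/
theorem IsSmoothEmbedding.isTameEmbedding [CompactSpace X] [T2Space M] {ι : X → M}
    (hι : IsSmoothEmbedding (𝓡∂ 3) (𝓡 3) ∞ ι) : IsTameEmbedding ι ((𝓡∂ 3).boundary X) where
  isClosedEmbedding := hι.isEmbedding.continuous.isClosedEmbedding hι.isEmbedding.injective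
  hasConvexPatches := hasConvexPatches_of_chartedSpace
  exists_patch x O hO := by
    have himm := hι.isImmersion.isImmersionAt x
    obtain ⟨F, _, _, hF⟩ := himm
    let equiv := hF.equiv
    -- The complement embeds in a 3-dimensional space and its dimension satisfies 3 + dim F = 3.
    have : Subsingleton F := by
      have : Module.Finite ℝ F := Module.Finite.of_injective
        (equiv.toLinearEquiv.toLinearMap.comp (LinearMap.inr ℝ E3 F))
        (equiv.injective.comp LinearMap.inr_injective)
      have h := equiv.toLinearEquiv.finrank_eq
      rw [Module.finrank_prod] at h
      exact (Module.finrank_zero_iff (R := ℝ)).1 (by omega)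
    have : Unique F := uniqueOfSubsingleton 0
    let L : E3 ≃L[ℝ] E3 := (ContinuousLinearEquiv.prodUnique ℝ E3 F).symm.trans equiv
    set φ := hF.domChart with hφ
    set ψ := hF.codChart with hψ
    have hw : ∀ x' ∈ φ.source, ψ (ι x') = L (φ x').1 := by
      intro x' hx'
      refine (hF.codChart_apply_eq hx').trans ?_
      change equiv ((φ x').1, 0) = equiv ((φ x').1, default)
      rw [Subsingleton.elim (0 : F) default]
    -- Since ι is an embedding, inside `V` the range of ι consists only of points coming from the
    -- domain chart.
    obtain ⟨V, hV, hVφ⟩ := hι.isEmbedding.isOpen_iff.1 φ.open_source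
    let e := (ψ.restr (V ∩ interior O)).transHomeomorph L.symm.toHomeomorph
    have hVO : interior (V ∩ interior O) = V ∩ interior O :=
      (hV.inter isOpen_interior).interior_eq
    have hes : e.source = ψ.source ∩ (V ∩ interior O) := by
      change (ψ.restr (V ∩ interior O)).source = _
      rw [OpenPartialHomeomorph.restr_source, hVO]
    have he : ∀ z, e z = L.symm (ψ z) := fun z => rfl
    have heι : ∀ x', ι x' ∈ e.source → x' ∈ φ.source ∧ e (ι x') = (φ x').1 := by
      intro x' hx'
      have h1 : x' ∈ φ.source := by
        rw [← hVφ]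
        exact (hes ▸ hx').2.1
      exact ⟨h1, by rw [he, hw x' h1, L.symm_apply_apply]⟩
    have hx : ι x ∈ e.source := by
      rw [hes]
      refine ⟨hF.mem_codChart_source, ?_, mem_interior_iff_mem_nhds.2 hO⟩
      change x ∈ ι ⁻¹' V
      rw [hVφ]
      exact hF.mem_domChart_source
    have hex := (heι x hx).2
    -- The target of `φ` is the trace on the half-space of an open set `U`; in `U` every point with
    -- nonnegative first coordinate is a value of the chart of `X`.
    obtain ⟨U, hU, hUφ⟩ := (IsInducing.subtypeVal.isOpen_iff).1 φ.open_target
    have hxU : e (ι x) ∈ U := by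
      rw [hex]
      have h := φ.map_source (heι x hx).1
      rw [← hUφ] at h
      exact h
    obtain ⟨r, hr, hball⟩ := Metric.isOpen_iff.1 (e.open_target.inter hU) (e (ι x))
      ⟨e.map_source hx, hxU⟩
    refine ⟨ConvexPatch.ofChart e (convex_ball (e (ι x)) r) (hball.trans inter_subset_left),
      ⟨hx, Metric.mem_ball_self hr⟩,
      e.continuousOn.isOpen_inter_preimage e.open_source Metric.isOpen_ball, ?_, ?_, ?_, ?_⟩
    · rintro z ⟨hz, -⟩
      exact interior_subset (hes.subset hz).2.2
    · exact Filter.inter_mem (e.open_target.mem_nhds (e.map_source hx)) (Metric.ball_mem_nhds _ hr)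
    · rintro z ⟨hz, hzb⟩
      change z ∈ range ι ↔ 0 ≤ e z 0
      constructor
      · rintro ⟨x', rfl⟩
        rw [(heι x' hz).2]
        exact (φ x').2
      · intro h0
        let y : EuclideanHalfSpace 3 := ⟨e z, h0⟩
        have hy : y ∈ φ.target := by
          rw [← hUφ]
          exact (hball hzb).2
        have hy' := φ.map_target hy
        refine ⟨φ.symm y, ψ.injOn (hF.source_subset_preimage_source hy') (hes.subset hz).1 ?_⟩
        rw [hw _ hy', φ.right_inv hy]
        change L (e z) = _
        rw [he, L.apply_symm_apply]
    · rintro x' ⟨hz, -⟩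
      change _ ↔ e (ι x') 0 = 0
      obtain ⟨h1, h2⟩ := heι x' hz
      rw [h2, ← (𝓡∂ 3).compl_interior, mem_compl_iff]
      change ¬ (𝓡∂ 3).IsInteriorPoint x' ↔ _
      rw [isInteriorPoint_iff_of_mem_maximalAtlas hF.domChart_mem_maximalAtlas h1, not_lt]
      exact ⟨fun h => le_antisymm h (φ x').2, fun h => h.le⟩

end Embeddings

/-! ## Tame embeddings -/

theorem convex_coord {s : Set ℝ} (hs : Convex ℝ s) : Convex ℝ {y : E3 | y 0 ∈ s} :=
  hs.linear_preimage (EuclideanSpace.proj (𝕜 := ℝ) (0 : Fin 3)).toLinearMap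

/-- Points of a preconnected subset of a locally path connected set `Z` are joined in `Z`. -/
theorem IsPreconnected.joinedIn_of_locally {X : Type*} [TopologicalSpace X] {S Z : Set X}
    (hS : IsPreconnected S) (hSZ : S ⊆ Z)
    (hZ : ∀ z ∈ Z, ∃ N ∈ 𝓝 z, ∀ w ∈ N ∩ Z, JoinedIn Z z w) {x y : X} (hx : x ∈ S) (hy : y ∈ S) :
    JoinedIn Z x y := by
  refine hS.induction₂ (fun x y => JoinedIn Z x y) (fun z hz => ?_)
    (fun x y z _ _ _ h h' => h.trans h') (fun x y _ _ h => h.symm) hx hy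
  obtain ⟨N, hN, h⟩ := hZ z (hSZ hz)
  filter_upwards [mem_nhdsWithin_of_mem_nhds hN, self_mem_nhdsWithin] with w hw hw'
  exact h w ⟨hw, hSZ hw'⟩

namespace IsTameEmbedding

variable {X M : Type*} [TopologicalSpace X] [TopologicalSpace M] {ι : X → M} {B : Set X}
  (h : IsTameEmbedding ι B)

include h

theorem continuous : Continuous ι := h.isClosedEmbedding.continuous

theorem injective : Injective ι := h.isClosedEmbedding.injective

theorem exists_lift (γ : C(I, M)) (hγ : range γ ⊆ range ι) :
    ∃ a : C(I, X), ContinuousMap.comp ⟨ι, h.continuous⟩ a = γ := by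
  let e := h.isClosedEmbedding.isEmbedding.toHomeomorph
  refine ⟨⟨fun t => e.symm ⟨γ t, hγ ⟨t, rfl⟩⟩,
    e.symm.continuous.comp (γ.continuous.subtype_mk _)⟩, ContinuousMap.ext fun t => ?_⟩
  exact congrArg Subtype.val (e.apply_symm_apply ⟨γ t, hγ ⟨t, rfl⟩⟩)

/-- At an interior point the first coordinate of a patch is positive, and the nearby points with
positive coordinate are again images of interior points. -/
theorem isOpen_image_compl : IsOpen (ι '' Bᶜ) := by
  rw [isOpen_iff_mem_nhds]
  rintro _ ⟨x, hx, rfl⟩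
  obtain ⟨P, hxP, hP, -, -, hr, hb⟩ := h.exists_patch x univ Filter.univ_mem
  have h0 : 0 < P.toFun (ι x) 0 :=
    lt_of_le_of_ne ((hr _ hxP).1 ⟨x, rfl⟩) fun h => hx ((hb x hxP).2 h.symm)
  have : P.source ∩ P.toFun ⁻¹' {y : E3 | 0 < y 0} ∈ 𝓝 (ι x) :=
    (P.continuousOn_toFun.isOpen_inter_preimage hP
      (isOpen_lt continuous_const (EuclideanSpace.proj (𝕜 := ℝ) (0 : Fin 3)).continuous)).mem_nhds
      ⟨hxP, h0⟩
  filter_upwards [this] with z hz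
  obtain ⟨x', rfl⟩ := (hr z hz.1).2 (le_of_lt hz.2)
  exact ⟨x', fun hx' => hz.2.ne' ((hb x' hz.1).1 hx'), rfl⟩

theorem isClosed_domain : IsClosed B := by
  have := h.isOpen_image_compl.preimage h.continuous
  rw [preimage_image_eq _ h.injective] at this
  exact isOpen_compl_iff.1 this

omit h in
theorem exists_coord {U : Set E3} {y : E3} (hU : U ∈ 𝓝 y) :
    ∃ ε > 0, ∃ y₁ ∈ U, ∃ y₂ ∈ U, y₁ 0 = y 0 + ε ∧ y₂ 0 = y 0 - ε := by
  have hc : ∀ c : ℝ, Filter.Tendsto (fun ε : ℝ => y + (c * ε) • EuclideanSpace.single (0 : Fin 3) (1 : ℝ))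
      (𝓝[>] 0) (𝓝 y) := fun c => by
    refine tendsto_nhdsWithin_of_tendsto_nhds ?_
    have : Continuous fun ε : ℝ => y + (c * ε) • EuclideanSpace.single (0 : Fin 3) (1 : ℝ) := by
      fun_prop
    simpa using this.tendsto 0
  obtain ⟨ε, ⟨h1, h2⟩, hε⟩ := (((hc 1).eventually hU).and ((hc (-1)).eventually hU)).and
    self_mem_nhdsWithin |>.exists
  exact ⟨ε, hε, _, h1, _, h2, by simp, by simp [sub_eq_add_neg]⟩

theorem exists_notMem_range {x : X} (hx : x ∈ B) {O : Set M} (hO : O ∈ 𝓝 (ι x)) :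
    ∃ z ∈ O, z ∉ range ι := by
  obtain ⟨P, hxP, hP, hPO, hT, hr, hb⟩ := h.exists_patch x O hO
  obtain ⟨ε, hε, -, -, y, hy, -, hy0⟩ := exists_coord hT
  refine ⟨P.invFun y, hPO (P.map_target hy), fun hz => ?_⟩
  have := (hr _ (P.map_target hy)).1 hz
  rw [P.right_inv hy, hy0, (hb x hxP).1 hx] at this
  linarith

theorem exists_notMem {x : X} {O : Set X} (hO : O ∈ 𝓝 x) : ∃ x' ∈ O, x' ∉ B := by
  by_cases hx : x ∈ B
  swap
  · exact ⟨x, mem_of_mem_nhds hO, hx⟩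
  rw [h.isClosedEmbedding.isInducing.nhds_eq_comap] at hO
  obtain ⟨O', hO', hOO⟩ := hO
  obtain ⟨P, hxP, hP, hPO, hT, hr, hb⟩ := h.exists_patch x O' hO'
  obtain ⟨ε, hε, y, hy, -, -, hy0, -⟩ := exists_coord hT
  have h0 : y 0 = ε := by rw [hy0, (hb x hxP).1 hx, zero_add]
  obtain ⟨x', hx'⟩ := (hr _ (P.map_target hy)).2 (by rw [P.right_inv hy, h0]; exact hε.le)
  have hs : ι x' ∈ P.source := hx' ▸ P.map_target hy
  refine ⟨x', hOO (hPO hs), fun hB => ?_⟩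
  have := (hb x' hs).1 hB
  rw [hx', P.right_inv hy, h0] at this
  exact hε.ne' this

theorem mem_interior_range_iff {x : X} : ι x ∈ interior (range ι) ↔ x ∉ B := by
  constructor
  · intro hx hB
    obtain ⟨z, hz, hz'⟩ := h.exists_notMem_range hB (isOpen_interior.mem_nhds hx)
    exact hz' (interior_subset hz)
  · intro hx
    exact interior_maximal (image_subset_range _ _) h.isOpen_image_compl ⟨x, hx, rfl⟩

omit h [TopologicalSpace X] in
theorem patch_mem_compl_iff {P : ConvexPatch M E3}
    (hr : ∀ z ∈ P.source, z ∈ range ι ↔ 0 ≤ P.toFun z 0)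
    (hb : ∀ x', ι x' ∈ P.source → (x' ∈ B ↔ P.toFun (ι x') 0 = 0)) {z : M} (hz : z ∈ P.source) :
    z ∈ (ι '' Bᶜ)ᶜ ↔ P.toFun z 0 ≤ 0 := by
  constructor
  · intro hzZ
    by_contra! h0
    obtain ⟨x', rfl⟩ := (hr z hz).2 h0.le
    exact hzZ ⟨x', fun hB => h0.ne' ((hb x' hz).1 hB), rfl⟩
  · rintro h0 ⟨x', hx', rfl⟩
    exact hx' ((hb x' hz).2 (le_antisymm h0 ((hr _ hz).1 ⟨x', rfl⟩)))

/-- A property of paths in `M` that is invariant under homotopy and under concatenation holds for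
all paths if it holds for the paths in `X` and for the paths in the complement of its interior. -/
theorem path_induction {Q : C(I, M) → Prop}
    (homotopic : ∀ {x y : M} (γ γ' : Path x y), γ.Homotopic γ' → Q γ.1 → Q γ'.1)
    (trans : ∀ {x y z : M} (γ : Path x y) (γ' : Path y z), Q γ.1 → Q γ'.1 → Q (γ.trans γ').1)
    (hX : ∀ a : C(I, X), Q (ContinuousMap.comp ⟨ι, h.continuous⟩ a))
    (hZ : ∀ γ : C(I, M), range γ ⊆ (ι '' Bᶜ)ᶜ → Q γ) (γ : C(I, M)) : Q γ := by
  refine ContinuousMap.path_induction homotopic trans γ fun t => ?_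
  by_cases ht : γ t ∈ range ι
  swap
  · refine ⟨(range ι)ᶜ, h.isClosedEmbedding.isClosed_range.isOpen_compl.mem_nhds ht, fun γ' hγ' =>
      hZ γ' fun z hz hz' => (hγ' hz).2 (image_subset_range _ _ hz')⟩
  obtain ⟨x, hx⟩ := ht
  obtain ⟨P, hxP, hP, -, -, hr, hb⟩ := h.exists_patch x univ Filter.univ_mem
  refine ⟨P.source, hx ▸ hP.mem_nhds hxP, fun γ' hγ' => ?_⟩
  have hs : ∀ t, γ' t ∈ P.source := fun t => (hγ' ⟨t, rfl⟩).2
  -- A path in the convex patch may be replaced by straight segments. Segments on one side of the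
  -- hyperplane are covered by `hX` or `hZ`; if the ends lie on opposite sides, one breaks the
  -- segment at a point of the hyperplane found by the intermediate value theorem.
  have hpos : ∀ {u v : M} (hu : u ∈ P.source) (hv : v ∈ P.source), 0 ≤ P.toFun u 0 →
      0 ≤ P.toFun v 0 → Q (P.segment hu hv).1 := by
    intro u v hu hv hu0 hv0
    have hsub : range (P.segment hu hv) ⊆ range ι := by
      rintro _ ⟨t, rfl⟩
      refine (hr _ (P.segment_mem hu hv t)).2 ?_
      rw [P.toFun_segment]
      exact (convex_coord (convex_Ici 0)).lineMap_mem hu0 hv0 t.2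
    obtain ⟨a, ha⟩ := h.exists_lift (P.segment hu hv).1 hsub
    exact ha ▸ hX a
  have hneg : ∀ {u v : M} (hu : u ∈ P.source) (hv : v ∈ P.source), P.toFun u 0 ≤ 0 →
      P.toFun v 0 ≤ 0 → Q (P.segment hu hv).1 := by
    intro u v hu hv hu0 hv0
    refine hZ _ ?_
    rintro _ ⟨t, rfl⟩
    refine (patch_mem_compl_iff hr hb (P.segment_mem hu hv t)).2 ?_
    rw [P.toFun_segment]
    exact (convex_coord (convex_Iic 0)).lineMap_mem hu0 hv0 t.2
  let β : Path (γ' 0) (γ' 1) := ⟨γ', rfl, rfl⟩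
  have hβ : range β ⊆ P.source := by rintro _ ⟨t, rfl⟩; exact hs t
  have hmix : ∀ {w : M} (hw : w ∈ P.source), Q (P.segment (hs 0) hw).1 →
      Q (P.segment hw (hs 1)).1 → Q γ' := fun {w} hw h1 h2 => by
    refine homotopic _ β (P.homotopic ?_ hβ) (trans _ _ h1 h2)
    rw [Path.trans_range]
    exact union_subset (P.range_segment_subset _ _) (P.range_segment_subset _ _)
  have hmid : (P.toFun (γ' 0) 0 ≤ 0 ∧ 0 ≤ P.toFun (γ' 1) 0) ∨
      (0 ≤ P.toFun (γ' 0) 0 ∧ P.toFun (γ' 1) 0 ≤ 0) → ∃ w ∈ P.source, P.toFun w 0 = 0 := by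
    intro hm
    have hc : Continuous fun t => P.toFun (γ' t) 0 :=
      (EuclideanSpace.proj (𝕜 := ℝ) (0 : Fin 3)).continuous.comp
        (P.continuousOn_toFun.comp_continuous γ'.continuous hs)
    have : (0 : ℝ) ∈ range fun t => P.toFun (γ' t) 0 := by
      rcases hm with hm | hm
      · exact mem_range_of_exists_le_of_exists_ge hc ⟨_, hm.1⟩ ⟨_, hm.2⟩
      · exact mem_range_of_exists_le_of_exists_ge hc ⟨_, hm.2⟩ ⟨_, hm.1⟩
    obtain ⟨t, ht⟩ := this
    exact ⟨γ' t, hs t, ht⟩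
  rcases le_total 0 (P.toFun (γ' 0) 0) with h0 | h0 <;>
    rcases le_total 0 (P.toFun (γ' 1) 0) with h1 | h1
  · exact hmix (hs 1) (hpos _ _ h0 h1) (hpos _ _ h1 h1)
  · obtain ⟨w, hw, hw0⟩ := hmid (Or.inr ⟨h0, h1⟩)
    exact hmix hw (hpos _ _ h0 hw0.ge) (hneg _ _ hw0.le h1)
  · obtain ⟨w, hw, hw0⟩ := hmid (Or.inl ⟨h0, h1⟩)
    exact hmix hw (hneg _ _ h0 hw0.le) (hpos _ _ hw0.ge h1)
  · exact hmix (hs 1) (hneg _ _ h0 h1) (hneg _ _ h1 h1)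

/-! ### Patches of `X` and path connectedness of its interior, boundary and complement. -/

/-- Patches of `X`. -/
theorem exists_patch_domain (x : X) {O : Set X} (hO : O ∈ 𝓝 x) : ∃ P : ConvexPatch X E3,
    x ∈ P.source ∧ IsOpen P.source ∧ P.source ⊆ O ∧
      ∀ x' ∈ P.source, 0 ≤ P.toFun x' 0 ∧ (x' ∈ B ↔ P.toFun x' 0 = 0) := by
  rw [h.isClosedEmbedding.isInducing.nhds_eq_comap] at hO
  obtain ⟨O', hO', hOO⟩ := hO
  obtain ⟨P, hxP, hP, hPO, hT, hr, hb⟩ := h.exists_patch x O' hO'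
  have : Nonempty X := ⟨x⟩
  exact ⟨P.comap h.isClosedEmbedding.isEmbedding (convex_coord (convex_Ici 0)) hr, hxP,
    hP.preimage h.continuous, fun z hz => hOO (hPO hz),
    fun x' hx' => ⟨(hr _ hx').1 ⟨x', rfl⟩, hb x' hx'⟩⟩

theorem hasConvexPatches_domain : HasConvexPatches X E3 := fun x _ hO =>
  let ⟨P, h1, h2, h3, _⟩ := h.exists_patch_domain x hO
  ⟨P, h1, h2, h3⟩

omit h in
theorem _root_.ConvexPatch.joinedIn {X : Type*} [TopologicalSpace X] (P : ConvexPatch X E3)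
    {C : Set E3} (hC : Convex ℝ C)
    {Z : Set X} (hZ : ∀ z ∈ P.source, P.toFun z ∈ C → z ∈ Z) {x y : X} (hx : x ∈ P.source)
    (hy : y ∈ P.source) (hxC : P.toFun x ∈ C) (hyC : P.toFun y ∈ C) : JoinedIn Z x y :=
  ⟨P.segment hx hy, fun t => hZ _ (P.segment_mem hx hy t) (by
    rw [P.toFun_segment]; exact hC.lineMap_mem hxC hyC t.2)⟩

/-- Preconnected subsets of the complement of the interior of `X` lie in a single path
component. -/
theorem joinedIn_compl {S : Set M} (hS : IsPreconnected S) (hSZ : S ⊆ (ι '' Bᶜ)ᶜ) {y y' : M}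
    (hy : y ∈ S) (hy' : y' ∈ S) : JoinedIn (ι '' Bᶜ)ᶜ y y' := by
  refine hS.joinedIn_of_locally hSZ (fun z hz => ?_) hy hy'
  by_cases hzr : z ∈ range ι
  · obtain ⟨x, rfl⟩ := hzr
    obtain ⟨P, hxP, hP, -, -, hr, hb⟩ := h.exists_patch x univ Filter.univ_mem
    have hiff := fun {z} => patch_mem_compl_iff (z := z) hr hb
    exact ⟨P.source, hP.mem_nhds hxP, fun w hw => P.joinedIn (convex_coord (convex_Iic 0))
      (fun z hz => (hiff hz).2) hxP hw.1 ((hiff hxP).1 hz) ((hiff hw.1).1 hw.2)⟩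
  · obtain ⟨P, hzP, hP, hPO⟩ := h.hasConvexPatches z _
      (h.isClosedEmbedding.isClosed_range.isOpen_compl.mem_nhds hzr)
    exact ⟨P.source, hP.mem_nhds hzP, fun w hw => P.joinedIn convex_univ
      (fun z hz _ hz' => hPO hz (image_subset_range _ _ hz')) hzP hw.1 trivial trivial⟩

theorem joinedIn_boundary {S : Set X} (hS : IsPreconnected S) (hSB : S ⊆ B) {y y' : X}
    (hy : y ∈ S) (hy' : y' ∈ S) : JoinedIn B y y' := by
  refine hS.joinedIn_of_locally hSB (fun x hx => ?_) hy hy'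
  obtain ⟨P, hxP, hP, -, hb⟩ := h.exists_patch_domain x Filter.univ_mem
  exact ⟨P.source, hP.mem_nhds hxP, fun w hw => P.joinedIn (convex_coord (convex_singleton 0))
    (fun z hz => (hb z hz).2.2) hxP hw.1 ((hb x hxP).2.1 hx) ((hb w hw.1).2.1 hw.2)⟩

/-- The interior of a connected manifold is path connected. -/
theorem joinedIn_interior [PreconnectedSpace X] {u v : X} (hu : u ∉ B) (hv : v ∉ B) :
    JoinedIn Bᶜ u v := by
  -- `S` is defined also at boundary points, so that connectedness of all of `X` applies. It is
  -- closed because interior points are dense and an open half of a patch is convex.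
  let S : Set X := {x | ∃ N ∈ 𝓝 x, ∀ w ∈ N, w ∉ B → JoinedIn Bᶜ u w}
  have hN : ∀ x, ∃ N, IsOpen N ∧ x ∈ N ∧ ∀ w ∈ N, ∀ w' ∈ N, w ∉ B → w' ∉ B → JoinedIn Bᶜ w w' := by
    intro x
    obtain ⟨P, hxP, hP, -, hb⟩ := h.exists_patch_domain x Filter.univ_mem
    have hiff : ∀ w ∈ P.source, w ∉ B ↔ 0 < P.toFun w 0 := fun w hw => by
      rw [(hb w hw).2, ← Ne, ne_comm]
      exact ((hb w hw).1.lt_iff_ne).symm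
    exact ⟨P.source, hP, hxP, fun w hw w' hw' hwB hwB' =>
      P.joinedIn (convex_coord (convex_Ioi 0)) (fun z hz => (hiff z hz).2) hw hw'
      ((hiff w hw).1 hwB) ((hiff w' hw').1 hwB')⟩
  have hopen : IsOpen S := by
    rw [isOpen_iff_mem_nhds]
    rintro x ⟨N, hN, hw⟩
    filter_upwards [eventually_mem_nhds_iff.2 hN] with x' hx' using ⟨N, hx', hw⟩
  have hclosed : IsClosed S := by
    rw [← isOpen_compl_iff, isOpen_iff_mem_nhds]
    intro x hx
    obtain ⟨N, hNo, hxN, hN⟩ := hN x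
    refine Filter.mem_of_superset (hNo.mem_nhds hxN) ?_
    rintro x' hx' ⟨N', hN', hw'⟩
    obtain ⟨w, ⟨hwN, hwN'⟩, hwB⟩ := h.exists_notMem (Filter.inter_mem (hNo.mem_nhds hx') hN')
    exact hx ⟨N, hNo.mem_nhds hxN, fun w'' hw'' hB =>
      (hw' w hwN' hwB).trans (hN w hwN w'' hw'' hwB hB)⟩
  have huS : u ∈ S := by
    obtain ⟨N, hNo, hxN, hN⟩ := hN u
    exact ⟨N, hNo.mem_nhds hxN, fun w hw hB => hN u hxN w hw hu hB⟩
  have hS : S = univ := IsClopen.eq_univ ⟨hclosed, hopen⟩ ⟨u, huS⟩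
  obtain ⟨N, hN, hw⟩ : v ∈ S := hS ▸ mem_univ v
  exact hw v (mem_of_mem_nhds hN) hv

omit h in
theorem _root_.convex_halfspace_union_singleton {p : E3} (hp : p 0 = 0) :
    Convex ℝ ({y : E3 | 0 < y 0} ∪ {p}) := by
  rintro x (hx | rfl) y (hy | rfl) a b ha hb hab
  · exact Or.inl (convex_coord (convex_Ioi 0) hx hy ha hb hab)
  · rcases ha.eq_or_lt with rfl | ha
    · right
      obtain rfl : b = 1 := by linarith
      simp
    · left
      change 0 < a * x 0 + b * y 0
      rw [hp, mul_zero, add_zero]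
      exact mul_pos ha hx
  · rcases hb.eq_or_lt with rfl | hb
    · right
      obtain rfl : a = 1 := by linarith
      simp
    · left
      change 0 < a * x 0 + b * y 0
      rw [hp, mul_zero, zero_add]
      exact mul_pos hb hy
  · right
    rw [← add_smul, hab, one_smul]
    rfl

/-- Distinct boundary points are the endpoints of a properly embedded arc. -/
theorem exists_arc [T2Space X] [RegularSpace X] [PreconnectedSpace X] {c c' : X} (hc : c ∈ B)
    (hc' : c' ∈ B) (hcc : c ≠ c') :
    ∃ γ : Path c c', Injective γ ∧ ∀ t, γ t ∈ B ↔ t = 0 ∨ t = 1 := by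
  -- An injective path between `c` and `c'` in the interior with only these two points added is
  -- automatically properly embedded. At the endpoints, patches of `Y` are modelled on an open
  -- half-space together with one boundary point, which is still convex.
  let Y : Set X := Bᶜ ∪ {c, c'}
  have hY : IsPreconnected Y := by
    have hB : IsPreconnected Bᶜ := isPreconnected_of_forall_pair fun x hx y hy => by
      obtain ⟨γ, hγ⟩ := h.joinedIn_interior hx hy
      exact ⟨range γ, by rintro _ ⟨t, rfl⟩; exact hγ t, ⟨0, γ.source⟩, ⟨1, γ.target⟩,
        isPreconnected_range γ.continuous⟩
    refine hB.subset_closure subset_union_left fun x _ => ?_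
    rw [mem_closure_iff_nhds]
    intro O hO
    exact h.exists_notMem hO
  have : PreconnectedSpace Y := Subtype.preconnectedSpace hY
  have hpatch : HasConvexPatches Y E3 := by
    rintro ⟨x, hx⟩ O hO
    obtain ⟨O', hO', hOO⟩ := (mem_nhds_subtype _ _ _).1 hO
    have : Nonempty Y := ⟨⟨x, hx⟩⟩
    -- The patch must avoid the other endpoint, so that at most one boundary point of `Y` lies in
    -- it.
    have hfin : (({c, c'} : Set X) \ {x})ᶜ ∈ 𝓝 x :=
      (((Set.toFinite {c, c'}).subset sdiff_subset).isClosed.isOpen_compl).mem_nhds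
        fun h => h.2 rfl
    obtain ⟨P, hxP, hP, hPO, hb⟩ := h.exists_patch_domain x (Filter.inter_mem hO' hfin)
    have hiff : ∀ w ∈ P.source, w ∉ B ↔ 0 < P.toFun w 0 := fun w hw => by
      rw [(hb w hw).2, ← Ne, ne_comm]
      exact ((hb w hw).1.lt_iff_ne).symm
    by_cases hxB : x ∈ B
    · have hx0 := (hb x hxP).2.1 hxB
      have hx' : x ∈ ({c, c'} : Set X) := hx.resolve_left fun h => h hxB
      refine ⟨P.comap IsEmbedding.subtypeVal (convex_halfspace_union_singleton hx0)
        fun z hz => ?_, hxP, hP.preimage continuous_subtype_val, fun z hz => hOO (hPO hz).1⟩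
      rw [Subtype.range_coe]
      constructor
      · rintro (hzB | hz')
        · exact Or.inl ((hiff z hz).1 hzB)
        · right
          have : z = x := by
            by_contra hzx
            exact (hPO hz).2 ⟨hz', hzx⟩
          rw [this]
          rfl
      · rintro (hz0 | hz0)
        · exact Or.inl ((hiff z hz).2 hz0)
        · right
          rwa [P.injOn hz hxP hz0]
    · have hsub : P.source ∩ Bᶜ ⊆ Y := fun z hz => Or.inl hz.2
      obtain ⟨P, hxP, hP, hPO, -⟩ := h.exists_patch_domain x
        (Filter.inter_mem hO' (h.isClosed_domain.isOpen_compl.mem_nhds hxB))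
      refine ⟨P.comap IsEmbedding.subtypeVal convex_univ fun z hz => ?_, hxP,
        hP.preimage continuous_subtype_val, fun z hz => hOO (hPO hz).1⟩
      rw [Subtype.range_coe]
      exact iff_of_true (Or.inl (hPO hz).2) trivial
  obtain ⟨γ, hγ⟩ := exists_injective_path hpatch (x := (⟨c, Or.inr (Or.inl rfl)⟩ : Y))
    (y := ⟨c', Or.inr (Or.inr rfl)⟩) fun h => hcc (congrArg Subtype.val h)
  refine ⟨γ.map continuous_subtype_val, Subtype.val_injective.comp hγ, fun t => ⟨fun ht => ?_, ?_⟩⟩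
  · have h0 : (γ t : X) ∈ B := ht
    rcases (γ t).2 with h1 | h1 | h1
    · exact absurd h0 h1
    · exact Or.inl (hγ ((Subtype.ext h1).trans γ.source.symm))
    · exact Or.inr (hγ ((Subtype.ext (mem_singleton_iff.1 h1)).trans γ.target.symm))
  · rintro (rfl | rfl)
    · rwa [Path.source]
    · rwa [Path.target]

/-! ### Extension of cocycles from `X` to `M` by zero. -/

variable {A : Type*} [AddCommGroup A]

/-- A primitive of τ on a patch is constant on the boundary part, since segments there lie in `B`.
Subtracting this constant allows extension by zero to the other side. -/
theorem exists_local_primitive (τ : PathCocycle X A) (hτ : ∀ a : C(I, X), range a ⊆ B → τ a = 0)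
    (z : M) : ∃ (D : Set M) (v : M → A), IsOpen D ∧ z ∈ D ∧
      (∀ a : C(I, X), (∀ t, ι (a t) ∈ D) → τ a = v (ι (a 1)) - v (ι (a 0))) ∧
      ∀ y ∈ (ι '' Bᶜ)ᶜ, v y = 0 := by
  classical
  by_cases hz : z ∈ range ι
  swap
  · refine ⟨(range ι)ᶜ, 0, h.isClosedEmbedding.isClosed_range.isOpen_compl, hz,
      fun a ha => absurd ⟨_, rfl⟩ (ha 0), fun y _ => rfl⟩
  obtain ⟨x, rfl⟩ := hz
  obtain ⟨P, hxP, hP, -, -, hr, hb⟩ := h.exists_patch x univ Filter.univ_mem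
  have : Nonempty X := ⟨x⟩
  let Q : ConvexPatch X E3 :=
    P.comap h.isClosedEmbedding.isEmbedding (convex_coord (convex_Ici 0)) hr
  obtain ⟨w, hw⟩ := τ.exists_primitive Q.source fun a ha h01 => Q.cocycle_loop_eq_zero τ a ha h01
  have hB : ∀ x₁ ∈ Q.source, ∀ x₂ ∈ Q.source, x₁ ∈ B → x₂ ∈ B → w x₁ = w x₂ := by
    intro x₁ h₁ x₂ h₂ hB₁ hB₂
    have h1 := hw (Q.segment h₁ h₂).1 (Q.range_segment_subset h₁ h₂)
    rw [hτ] at h1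
    · have h2 : w (Q.segment h₁ h₂ 1) - w (Q.segment h₁ h₂ 0) = 0 := h1.symm
      rw [Path.source, Path.target] at h2
      exact (sub_eq_zero.1 h2).symm
    · rintro _ ⟨t, rfl⟩
      refine (hb _ (Q.segment_mem h₁ h₂ t)).2 ?_
      change Q.toFun (Q.segment h₁ h₂ t) 0 = 0
      rw [Q.toFun_segment]
      exact (convex_coord (convex_singleton 0)).lineMap_mem ((hb _ h₁).1 hB₁) ((hb _ h₂).1 hB₂) t.2
  obtain ⟨c, hc⟩ : ∃ c : A, ∀ x' ∈ Q.source, x' ∈ B → w x' = c := by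
    by_cases hne : ∃ x' ∈ Q.source, x' ∈ B
    · obtain ⟨x', hx', hxB⟩ := hne
      exact ⟨w x', fun y hy hyB => hB _ hy _ hx' hyB hxB⟩
    · push Not at hne
      exact ⟨0, fun y hy hyB => absurd hyB (hne y hy)⟩
  let v : M → A := fun y => if y ∈ ι '' Bᶜ then w (invFun ι y) - c else 0
  have hv : ∀ x' ∈ Q.source, v (ι x') = w x' - c := by
    intro x' hx'
    by_cases hxB : x' ∈ B
    · rw [hc x' hx' hxB, sub_self]
      refine if_neg ?_
      rintro ⟨x'', h1, h2⟩
      exact h1 (h.injective h2 ▸ hxB)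
    · refine (if_pos (mem_image_of_mem _ hxB)).trans ?_
      rw [leftInverse_invFun h.injective]
  refine ⟨P.source, v, hP, hxP, fun a ha => ?_, fun y hy => if_neg hy⟩
  rw [hv _ (ha 1), hv _ (ha 0), sub_sub_sub_cancel_right]
  exact hw a (by rintro _ ⟨t, rfl⟩; exact ha t)

/-- A path cocycle on `X` that vanishes on the boundary extends by zero. -/
theorem exists_extension (τ : PathCocycle X A) (hτ : ∀ a : C(I, X), range a ⊆ B → τ a = 0) :
    ∃ T : PathCocycle M A, (∀ a : C(I, X), T (ContinuousMap.comp ⟨ι, h.continuous⟩ a) = τ a) ∧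
      ∀ γ : C(I, M), range γ ⊆ (ι '' Bᶜ)ᶜ → T γ = 0 := by
  choose D v hD hz hv hv0 using h.exists_local_primitive τ hτ
  let s : LocalPrimitives M A :=
    { dom := D
      isOpen_dom := hD
      mem_dom := hz
      val := v
      locallyConstant := by
        rintro y y' z ⟨hzy, hzy'⟩
        have hDD : D y ∩ D y' ∈ 𝓝 z := ((hD y).inter (hD y')).mem_nhds ⟨hzy, hzy'⟩
        by_cases hzr : z ∈ range ι
        swap
        · filter_upwards [h.isClosedEmbedding.isClosed_range.isOpen_compl.mem_nhds hzr] with z' hz'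
          have hout : ∀ z ∉ range ι, z ∈ (ι '' Bᶜ)ᶜ := fun z hz hz' => hz (image_subset_range _ _ hz')
          rw [hv0 _ _ (hout _ hz'), hv0 _ _ (hout _ hz'), hv0 _ _ (hout _ hzr),
            hv0 _ _ (hout _ hzr)]
        obtain ⟨x, rfl⟩ := hzr
        -- Near an interior point the patch is kept inside the interior of `X`. Hence a point of the
        -- patch outside the range occurs only for `x ∈ B`, and then all primitives vanish at both
        -- points.
        have hO : ∃ O ∈ 𝓝 (ι x), O ⊆ D y ∩ D y' ∧ (x ∉ B → O ⊆ ι '' Bᶜ) := by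
          by_cases hxB : x ∈ B
          · exact ⟨_, hDD, Subset.rfl, fun h => absurd hxB h⟩
          · exact ⟨_, Filter.inter_mem hDD (h.isOpen_image_compl.mem_nhds ⟨x, hxB, rfl⟩),
              inter_subset_left, fun _ => inter_subset_right⟩
        obtain ⟨O, hO, hOD, hOB⟩ := hO
        obtain ⟨P, hxP, hP, hPO, -, hr, hb⟩ := h.exists_patch x O hO
        filter_upwards [hP.mem_nhds hxP] with z' hz'
        by_cases hzr' : z' ∈ range ι
        · obtain ⟨x', rfl⟩ := hzr'
          have : Nonempty X := ⟨x⟩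
          let Q : ConvexPatch X E3 :=
            P.comap h.isClosedEmbedding.isEmbedding (convex_coord (convex_Ici 0)) hr
          -- Both local primitives compute τ along this segment, so their difference has equal
          -- values at its ends.
          let γ := Q.segment (x := x) (y := x') hxP hz'
          have hγ : ∀ t, ι (γ t) ∈ D y ∩ D y' := fun t => hOD (hPO (Q.segment_mem _ _ t))
          have h1 := hv y γ.1 fun t => (hγ t).1
          have h2 := hv y' γ.1 fun t => (hγ t).2
          have h3 : v y (ι (γ 1)) - v y (ι (γ 0)) = v y' (ι (γ 1)) - v y' (ι (γ 0)) :=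
            h1.symm.trans h2
          rw [Path.source, Path.target] at h3
          rw [sub_eq_sub_iff_add_eq_add] at h3 ⊢
          rw [h3, add_comm]
        · have hzZ : z' ∈ (ι '' Bᶜ)ᶜ := fun hz => hzr' (image_subset_range _ _ hz)
          have hxB : x ∈ B := by
            by_contra hxB
            exact hzZ (hOB hxB (hPO hz'))
          have hxZ : ι x ∈ (ι '' Bᶜ)ᶜ := fun ⟨x', h1, h2⟩ => h1 (h.injective h2 ▸ hxB)
          rw [hv0 _ _ hzZ, hv0 _ _ hzZ, hv0 _ _ hxZ, hv0 _ _ hxZ] }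
  obtain ⟨T, hT⟩ := s.exists_pathCocycle
  refine ⟨T, fun a => ?_, fun γ hγ => ?_⟩
  · refine ContinuousMap.path_induction
      (P := fun a => T (ContinuousMap.comp ⟨ι, h.continuous⟩ a) = τ a)
      (fun {x y} γ γ' hγ hh => ?_) (fun {x y z} γ γ' h1 h2 => ?_) a fun t => ?_
    · rw [← τ.map_homotopic hγ, ← hh]
      exact ((T.comp ⟨ι, h.continuous⟩).map_homotopic hγ).symm
    · rw [τ.map_trans, ← h1, ← h2]
      exact (T.comp ⟨ι, h.continuous⟩).map_trans γ γ'
    · refine ⟨ι ⁻¹' D (ι (a t)), ((hD _).preimage h.continuous).mem_nhds (hz _), fun a' ha' => ?_⟩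
      have hin : ∀ t', ι (a' t') ∈ D (ι (a t)) := fun t' => (ha' ⟨t', rfl⟩).2
      rw [hv _ a' hin]
      exact hT (ι (a t)) _ (by rintro _ ⟨t', rfl⟩; exact hin t')
  -- The induction takes place in the subspace, so all pieces of the path stay where the local
  -- primitives vanish.
  · let Z := {z // z ∈ (ι '' Bᶜ)ᶜ}
    let T' : PathCocycle Z A := T.comp ⟨Subtype.val, continuous_subtype_val⟩
    let γ' : C(I, Z) := ⟨fun t => ⟨γ t, hγ ⟨t, rfl⟩⟩, γ.continuous.subtype_mk _⟩
    change T' γ' = 0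
    refine ContinuousMap.path_induction (P := fun a => T' a = 0) (fun {x y} γ γ' hγ hh => ?_)
      (fun {x y z} γ γ' h1 h2 => ?_) γ' fun t => ?_
    · rw [← T'.map_homotopic hγ, hh]
    · rw [T'.map_trans, h1, h2, add_zero]
    · refine ⟨Subtype.val ⁻¹' D (γ' t), ((hD _).preimage continuous_subtype_val).mem_nhds (hz _),
        fun a ha => ?_⟩
      refine (hT (γ' t) _ ?_).trans ?_
      · rintro _ ⟨t', rfl⟩
        exact (ha ⟨t', rfl⟩).2
      · exact (congrArg₂ (· - ·) (hv0 _ _ (a 1).2) (hv0 _ _ (a 0).2)).trans (sub_zero 0)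

end IsTameEmbedding

/-! ## Topology of connected sums -/

section ConnectedSum

theorem Topology.IsEmbedding.exists_lift {X Y : Type*} [TopologicalSpace X] [TopologicalSpace Y]
    {s : Y → X} (hs : IsEmbedding s) (h : C(I, X)) (hh : range h ⊆ range s) :
    ∃ g : C(I, Y), ∀ t, s (g t) = h t := by
  let e := hs.toHomeomorph
  exact ⟨⟨fun t => e.symm ⟨h t, hh ⟨t, rfl⟩⟩,
    e.symm.continuous.comp (h.continuous.subtype_mk _)⟩,
    fun t => congrArg Subtype.val (e.apply_symm_apply ⟨h t, hh ⟨t, rfl⟩⟩)⟩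

theorem one_lt_rank_euclideanSpace (n : ℕ) : 1 < Module.rank ℝ (EuclideanSpace ℝ (Fin (n + 2))) := by
  rw [rank_eq_card_basis (EuclideanSpace.basisFun (Fin (n + 2)) ℝ).toBasis, Fintype.card_fin]
  exact_mod_cast (by omega : 1 < n + 2)

/-- In a separation of the punctured space, the punctured Euclidean neighbourhood is connected and
lies on one side; filling in the point on that side would separate `A`. -/
theorem isPreconnected_compl_singleton_of_isOpenEmbedding {A : Type*} [TopologicalSpace A]
    [T1Space A] [PreconnectedSpace A] {i : E3 → A} (hi : IsOpenEmbedding i) :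
    IsPreconnected ({i 0}ᶜ : Set A) := by
  have hN : IsPreconnected (i '' {0}ᶜ) :=
    ((isConnected_compl_singleton_of_one_lt_rank (one_lt_rank_euclideanSpace 1) 0).isPreconnected
      ).image _ hi.continuous.continuousOn
  have hsub : i '' {0}ᶜ ⊆ {i 0}ᶜ := by
    rintro _ ⟨w, hw, rfl⟩ h
    exact hw (hi.injective h)
  rw [isPreconnected_iff_subset_of_disjoint]
  have key : ∀ u v : Set A, IsOpen u → IsOpen v → {i 0}ᶜ ⊆ u ∪ v → {i 0}ᶜ ∩ (u ∩ v) = ∅ →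
      i '' {0}ᶜ ⊆ u → {i 0}ᶜ ⊆ u := by
    intro u v hu hv huv hd hNu
    have hcov : (univ : Set A) ⊆ ((u ∩ {i 0}ᶜ) ∪ range i) ∪ (v ∩ {i 0}ᶜ) := by
      intro a _
      by_cases ha : a = i 0
      · exact Or.inl (Or.inr ⟨0, ha.symm⟩)
      · rcases huv ha with h | h
        · exact Or.inl (Or.inl ⟨h, ha⟩)
        · exact Or.inr ⟨h, ha⟩
    have hrange : ∀ a ∈ range i, a ≠ i 0 → a ∈ u := by
      rintro _ ⟨w, rfl⟩ ha
      exact hNu ⟨w, fun h => ha (congrArg i h), rfl⟩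
    have h := isPreconnected_univ.subset_or_subset
      ((hu.inter isOpen_compl_singleton).union hi.isOpen_range) (hv.inter isOpen_compl_singleton)
      (by
        rw [Set.disjoint_left]
        rintro a (ha | ha) ⟨hav, ha0⟩
        · exact notMem_empty a (hd ▸ ⟨ha0, ha.1, hav⟩)
        · exact notMem_empty a (hd ▸ ⟨ha0, hrange a ha ha0, hav⟩)) hcov
    rcases h with h | h
    · intro a ha
      rcases h (mem_univ a) with h | h
      · exact h.1
      · exact hrange a h ha
    · exact absurd rfl (h (mem_univ (i 0))).2
  intro u v hu hv huv hd
  rcases (isPreconnected_iff_subset_of_disjoint.1 hN) u v hu hv (hsub.trans huv)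
    (subset_empty_iff.1 ((inter_subset_inter_left _ hsub).trans hd.subset)) with h | h
  · exact Or.inl (key u v hu hv huv hd h)
  · exact Or.inr (key v u hv hu (by rwa [union_comm]) (by rwa [inter_comm v]) h)

theorem IsLocalHomeomorphOn.isOpen_image {A M : Type*} [TopologicalSpace A] [TopologicalSpace M]
    {α : A → M} {s u : Set A} (hα : IsLocalHomeomorphOn α s) (hu : IsOpen u) (hus : u ⊆ s) :
    IsOpen (α '' u) := by
  rw [isOpen_iff_mem_nhds]
  rintro _ ⟨a, ha, rfl⟩
  rw [← hα.map_nhds_eq (hus ha)]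
  exact Filter.image_mem_map (hu.mem_nhds ha)

theorem smul_notMem_image_closedBall {A : Type*} {i : E3 → A} (hi : Injective i) {w : E3}
    (hw : ‖w‖ = 1) {t r : ℝ} (ht0 : 0 ≤ t) (ht : r < t) : i (t • w) ∉ i '' Metric.closedBall 0 r := by
  rintro ⟨w', hw', h⟩
  obtain rfl := hi h
  rw [mem_closedBall_zero_iff, norm_smul, hw, mul_one, Real.norm_of_nonneg ht0] at hw'
  linarith

theorem exists_unit_smul_eq {w : E3} (hw0 : w ≠ 0) :
    ∃ w' : E3, ‖w'‖ = 1 ∧ 0 < ‖w‖ ∧ w = ‖w‖ • w' := by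
  have hn : 0 < ‖w‖ := norm_pos_iff.2 hw0
  exact ⟨‖w‖⁻¹ • w, by rw [norm_smul, norm_inv, norm_norm, inv_mul_cancel₀ hn.ne'],
    hn, by rw [smul_smul, mul_inv_cancel₀ hn.ne', one_smul]⟩

theorem smul_mem_compl_singleton {A : Type*} {i : E3 → A} (hi : Injective i) {w : E3}
    (hw : ‖w‖ = 1) {t : ℝ} (ht : 0 < t) : i (t • w) ∈ ({i 0}ᶜ : Set A) := fun h =>
  smul_notMem_image_closedBall hi hw ht.le ht ⟨0, by simp, Eq.symm h⟩

theorem IsLocalHomeomorphOn.separated {A M : Type*} [TopologicalSpace A] [TopologicalSpace M]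
    [T2Space A] {s : Set A} {α : A → M} (hα : IsLocalHomeomorphOn α s) (hs : IsOpen s)
    (hα' : InjOn α s) {a a' : A} (ha : a ∈ s) (ha' : a' ∈ s) (hne : α a ≠ α a') :
    ∃ u v : Set M, IsOpen u ∧ IsOpen v ∧ α a ∈ u ∧ α a' ∈ v ∧ Disjoint u v := by
  obtain ⟨u, v, hu, hv, hau, hav, hd⟩ := t2_separation fun h : a = a' => hne (congrArg α h)
  refine ⟨α '' (u ∩ s), α '' (v ∩ s), hα.isOpen_image (hu.inter hs) inter_subset_right,
    hα.isOpen_image (hv.inter hs) inter_subset_right, ⟨a, ⟨hau, ha⟩, rfl⟩, ⟨a', ⟨hav, ha'⟩, rfl⟩, ?_⟩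
  rw [Set.disjoint_left]
  rintro _ ⟨z, hz, rfl⟩ ⟨z', hz', h⟩
  exact Set.disjoint_left.1 hd hz.1 (hα' hz'.2 hz.2 h ▸ hz'.1)

theorem compl_image_subset_compl_singleton {A : Type*} {i : E3 → A} {s : Set E3}
    (hs : (0 : E3) ∈ s) : (i '' s)ᶜ ⊆ {i 0}ᶜ := by
  rw [compl_subset_compl, singleton_subset_iff]
  exact ⟨0, hs, rfl⟩

theorem isCompact_image_compl_ball {A M : Type*} [TopologicalSpace A] [TopologicalSpace M]
    [CompactSpace A] {i : E3 → A} {α : A → M} (hi : IsOpenEmbedding i)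
    (hα : IsLocalHomeomorphOn α {i 0}ᶜ) : IsCompact (α '' (i '' Metric.ball 0 (1 / 2))ᶜ) :=
  (hi.isOpenMap _ Metric.isOpen_ball).isClosed_compl.isCompact.image_of_continuousOn
    (hα.continuousOn.mono (compl_image_subset_compl_singleton (by simp)))

theorem isOpen_compl_image_closedBall {A : Type*} [TopologicalSpace A] [T2Space A] {i : E3 → A}
    (hi : Continuous i) : IsOpen (i '' Metric.closedBall 0 (1 / 2))ᶜ :=
  ((isCompact_closedBall _ _).image hi).isClosed.isOpen_compl

theorem smul_mem_compl_image_ball {A : Type*} {i : E3 → A} (hi : Injective i) {w : E3} {t : ℝ}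
    (hw : ‖w‖ = 1) (ht : t < 1 / 2) : i ((1 - t) • w) ∈ (i '' Metric.ball 0 (1 / 2))ᶜ := fun h =>
  smul_notMem_image_closedBall hi hw (by linarith : 0 ≤ 1 - t) (by linarith : 1 / 2 < 1 - t)
    (image_mono Metric.ball_subset_closedBall h)

variable {A B M : Type*} [TopologicalSpace A] [TopologicalSpace B] [TopologicalSpace M]
  {i : E3 → A} {j : E3 → B} {α : A → M} {β : B → M}

/-- Points in the image of one common piece are separated there. Otherwise one point comes only from
`A` and the other only from `B`. Then both avoid the closed balls of radius 1/2, and the complements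
of these balls have disjoint images because radius t is glued to radius 1 − t. -/
theorem t2Space_of_connectedSum [T2Space A] [T2Space B] (hi : IsOpenEmbedding i)
    (hj : IsOpenEmbedding j) (hα : IsLocalHomeomorphOn α {i 0}ᶜ) (hα' : InjOn α {i 0}ᶜ)
    (hβ : IsLocalHomeomorphOn β {j 0}ᶜ) (hβ' : InjOn β {j 0}ᶜ)
    (hu : α '' {i 0}ᶜ ∪ β '' {j 0}ᶜ = univ)
    (hαβ : ∀ a ∈ ({i 0}ᶜ : Set A), ∀ b ∈ ({j 0}ᶜ : Set B),
      (α a = β b ↔ ∃ (w : E3) (t : ℝ), ‖w‖ = 1 ∧ t ∈ Ioo (0 : ℝ) 1 ∧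
        a = i (t • w) ∧ b = j ((1 - t) • w))) : T2Space M := by
  have mixed : ∀ a ∈ ({i 0}ᶜ : Set A), ∀ b ∈ ({j 0}ᶜ : Set B), α a ≠ β b → 
      ∃ u v : Set M, IsOpen u ∧ IsOpen v ∧ α a ∈ u ∧ β b ∈ v ∧ Disjoint u v := by
    intro a ha b hb hne
    by_cases haβ : α a ∈ β '' {j 0}ᶜ
    · obtain ⟨b', hb', h⟩ := haβ
      rw [← h] at hne ⊢
      exact hβ.separated isOpen_compl_singleton hβ' hb' hb hne
    by_cases hbα : β b ∈ α '' {i 0}ᶜ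
    · obtain ⟨a', ha', h⟩ := hbα
      rw [← h] at hne ⊢
      exact hα.separated isOpen_compl_singleton hα' ha ha' hne
    refine ⟨α '' (i '' Metric.closedBall 0 (1 / 2))ᶜ, β '' (j '' Metric.closedBall 0 (1 / 2))ᶜ,
      hα.isOpen_image (isOpen_compl_image_closedBall hi.continuous)
        (compl_image_subset_compl_singleton (by simp)),
      hβ.isOpen_image (isOpen_compl_image_closedBall hj.continuous)
        (compl_image_subset_compl_singleton (by simp)), ⟨a, ?_, rfl⟩, ⟨b, ?_, rfl⟩, ?_⟩
    · rintro ⟨w, hw, rfl⟩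
      obtain ⟨w', hw', hn, hww⟩ := exists_unit_smul_eq fun h : w = 0 => ha (congrArg i h)
      rw [mem_closedBall_zero_iff] at hw
      have hj0 := smul_mem_compl_singleton hj.injective hw' (by linarith : 0 < 1 - ‖w‖)
      exact haβ ⟨_, hj0, ((hαβ _ ha _ hj0).2 ⟨w', ‖w‖, hw', ⟨hn, by linarith⟩, congrArg i hww,
        rfl⟩).symm⟩
    · rintro ⟨w, hw, rfl⟩
      obtain ⟨w', hw', hn, hww⟩ := exists_unit_smul_eq fun h : w = 0 => hb (congrArg j h)
      rw [mem_closedBall_zero_iff] at hw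
      have hi0 := smul_mem_compl_singleton hi.injective hw' (by linarith : 0 < 1 - ‖w‖)
      exact hbα ⟨_, hi0, (hαβ _ hi0 _ hb).2 ⟨w', 1 - ‖w‖, hw', ⟨by linarith, by linarith⟩,
        rfl, by rw [sub_sub_cancel, ← hww]⟩⟩
    · rw [Set.disjoint_left]
      rintro _ ⟨z, hz, rfl⟩ ⟨z', hz', h⟩
      obtain ⟨w, t, hw, ht, rfl, rfl⟩ := (hαβ z
        (compl_image_subset_compl_singleton (by simp) hz) z'
        (compl_image_subset_compl_singleton (by simp) hz')).1 h.symm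
      rcases le_total t (1 / 2) with h' | h'
      · refine hz ⟨_, ?_, rfl⟩
        rwa [mem_closedBall_zero_iff, norm_smul, hw, mul_one, Real.norm_of_nonneg ht.1.le]
      · refine hz' ⟨_, ?_, rfl⟩
        rw [mem_closedBall_zero_iff, norm_smul, hw, mul_one, Real.norm_of_nonneg (by linarith [ht.2])]
        linarith
  refine ⟨fun x y hxy => ?_⟩
  rcases hu.symm.subset (mem_univ x) with ⟨a, ha, rfl⟩ | ⟨b, hb, rfl⟩ <;>
    rcases hu.symm.subset (mem_univ y) with ⟨a', ha', rfl⟩ | ⟨b', hb', rfl⟩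
  · exact hα.separated isOpen_compl_singleton hα' ha ha' hxy
  · exact mixed a ha b' hb' hxy
  · obtain ⟨u, v, hu, hv, h1, h2, hd⟩ := mixed a' ha' b hb hxy.symm
    exact ⟨v, u, hv, hu, h2, h1, hd.symm⟩
  · exact hβ.separated isOpen_compl_singleton hβ' hb hb' hxy

/-- The complements of the open balls of radius 1/2 are compact and cover: a point at radius t < 1/2
on one side reappears at radius 1 − t > 1/2 on the other. -/
theorem compactSpace_of_connectedSum [CompactSpace A] [CompactSpace B] (hi : IsOpenEmbedding i)
    (hj : IsOpenEmbedding j) (hα : IsLocalHomeomorphOn α {i 0}ᶜ)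
    (hβ : IsLocalHomeomorphOn β {j 0}ᶜ) (hu : α '' {i 0}ᶜ ∪ β '' {j 0}ᶜ = univ)
    (hαβ : ∀ a ∈ ({i 0}ᶜ : Set A), ∀ b ∈ ({j 0}ᶜ : Set B),
      (α a = β b ↔ ∃ (w : E3) (t : ℝ), ‖w‖ = 1 ∧ t ∈ Ioo (0 : ℝ) 1 ∧
        a = i (t • w) ∧ b = j ((1 - t) • w))) : CompactSpace M := by
  refine ⟨((isCompact_image_compl_ball hi hα).union (isCompact_image_compl_ball hj hβ)
    ).of_isClosed_subset isClosed_univ ?_⟩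
  intro x _
  rcases hu.symm.subset (mem_univ x) with ⟨a, ha, rfl⟩ | ⟨b, hb, rfl⟩
  · by_cases h : a ∈ i '' Metric.ball 0 (1 / 2)
    · obtain ⟨w, hw, rfl⟩ := h
      obtain ⟨w', hw', hn, hww⟩ := exists_unit_smul_eq fun h : w = 0 => ha (congrArg i h)
      rw [mem_ball_zero_iff] at hw
      have hj0 := smul_mem_compl_singleton hj.injective hw' (by linarith : 0 < 1 - ‖w‖)
      exact Or.inr ⟨_, smul_mem_compl_image_ball hj.injective hw' hw, ((hαβ _ ha _ hj0).2
        ⟨w', ‖w‖, hw', ⟨hn, by linarith⟩, congrArg i hww, rfl⟩).symm⟩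
    · exact Or.inl ⟨a, h, rfl⟩
  · by_cases h : b ∈ j '' Metric.ball 0 (1 / 2)
    · obtain ⟨w, hw, rfl⟩ := h
      obtain ⟨w', hw', hn, hww⟩ := exists_unit_smul_eq fun h : w = 0 => hb (congrArg j h)
      rw [mem_ball_zero_iff] at hw
      have hi0 := smul_mem_compl_singleton hi.injective hw' (by linarith : 0 < 1 - ‖w‖)
      exact Or.inl ⟨_, smul_mem_compl_image_ball hi.injective hw' hw, (hαβ _ hi0 _ hb).2
        ⟨w', 1 - ‖w‖, hw', ⟨by linarith, by linarith⟩, rfl, by rw [sub_sub_cancel, ← hww]⟩⟩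
    · exact Or.inr ⟨b, h, rfl⟩

theorem connectedSpace_of_connectedSum [T1Space A] [T1Space B] [PreconnectedSpace A]
    [PreconnectedSpace B] (hi : IsOpenEmbedding i)
    (hj : IsOpenEmbedding j) (hα : IsLocalHomeomorphOn α {i 0}ᶜ)
    (hβ : IsLocalHomeomorphOn β {j 0}ᶜ) (hu : α '' {i 0}ᶜ ∪ β '' {j 0}ᶜ = univ)
    (hαβ : ∀ a ∈ ({i 0}ᶜ : Set A), ∀ b ∈ ({j 0}ᶜ : Set B),
      (α a = β b ↔ ∃ (w : E3) (t : ℝ), ‖w‖ = 1 ∧ t ∈ Ioo (0 : ℝ) 1 ∧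
        a = i (t • w) ∧ b = j ((1 - t) • w))) : ConnectedSpace M := by
  obtain ⟨w, hw⟩ : ∃ w : E3, ‖w‖ = 1 := exists_norm_eq _ zero_le_one
  have h := (hαβ _ (smul_mem_compl_singleton hi.injective hw one_half_pos) _ (smul_mem_compl_singleton hj.injective hw one_half_pos)).2
    ⟨w, 1 / 2, hw, by norm_num, rfl, by norm_num⟩
  have := IsPreconnected.union' (s := α '' {i 0}ᶜ) (t := β '' {j 0}ᶜ)
    ⟨_, ⟨_, smul_mem_compl_singleton hi.injective hw one_half_pos, rfl⟩, ⟨_, smul_mem_compl_singleton hj.injective hw one_half_pos, h.symm⟩⟩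
    ((isPreconnected_compl_singleton_of_isOpenEmbedding hi).image _ hα.continuousOn)
    ((isPreconnected_compl_singleton_of_isOpenEmbedding hj).image _ hβ.continuousOn)
  rw [hu] at this
  exact { isPreconnected_univ := this, toNonempty := ⟨α (i ((1 / 2 : ℝ) • w))⟩ }

end ConnectedSum

theorem IsLocalDiffeomorph.isOpenEmbedding {E F H H' : Type*} [NormedAddCommGroup E]
    [NormedSpace ℝ E] [NormedAddCommGroup F] [NormedSpace ℝ F] [TopologicalSpace H]
    [TopologicalSpace H'] {J : ModelWithCorners ℝ E H} {J' : ModelWithCorners ℝ F H'}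
    {N : Type*} [TopologicalSpace N] [ChartedSpace H N] {N' : Type*} [TopologicalSpace N']
    [ChartedSpace H' N'] {n : ℕ∞ω} {f : N → N'} (hf : IsLocalDiffeomorph J J' n f)
    (hf' : Injective f) : IsOpenEmbedding f :=
  .of_continuous_injective_isOpenMap hf.isLocalHomeomorph.continuous hf' hf.isOpenMap

instance : ConnectedSpace S2 := isConnected_iff_connectedSpace.1
  (isConnected_sphere (one_lt_rank_euclideanSpace 1) 0 zero_le_one)

/-- The connected sum of copies of `S¹ × S²` is a compact connected Hausdorff space. -/
theorem IsSumS1S2.topology {n : ℕ} : ∀ {M : Type u} [TopologicalSpace M] [ChartedSpace E3 M],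
    IsSumS1S2 n M → T2Space M ∧ CompactSpace M ∧ ConnectedSpace M := by
  induction n with
  | zero =>
    rintro M _ _ ⟨Φ⟩
    have : ConnectedSpace S3 := isConnected_iff_connectedSpace.1
      (isConnected_sphere (one_lt_rank_euclideanSpace 2) 0 zero_le_one)
    exact ⟨Φ.toHomeomorph.symm.t2Space, Φ.toHomeomorph.symm.compactSpace,
      Φ.toHomeomorph.symm.surjective.connectedSpace Φ.toHomeomorph.symm.continuous⟩
  | succ n ih =>
    rintro M _ _ ⟨A, _, _, _, hA, i, j, α, β, ⟨hi, hi'⟩, ⟨hj, hj'⟩, ⟨hα, hα'⟩, ⟨hβ, hβ'⟩, hu, hαβ⟩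
    obtain ⟨_, _, _⟩ := ih hA
    have hi := hi.isOpenEmbedding hi'
    have hj := hj.isOpenEmbedding hj'
    exact ⟨t2Space_of_connectedSum hi hj hα.isLocalHomeomorphOn hα' hβ.isLocalHomeomorphOn hβ' hu hαβ,
      compactSpace_of_connectedSum hi hj hα.isLocalHomeomorphOn hβ.isLocalHomeomorphOn hu hαβ,
      connectedSpace_of_connectedSum hi hj hα.isLocalHomeomorphOn hβ.isLocalHomeomorphOn hu hαβ⟩

/-! ## Simple connectedness of the 2-sphere -/

section Sphere

/-- A space covered by two simply connected open sets with path connected intersection is simply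
connected. -/
theorem Path.homotopic_of_union {X : Type*} [TopologicalSpace X] {U V : Set X} (hU : IsOpen U)
    (hV : IsOpen V) (hUV : U ∪ V = univ) (hc : IsPathConnected (U ∩ V))
    (hUc : ∀ x ∈ U, ∀ y ∈ U, JoinedIn U x y) (hVc : ∀ x ∈ V, ∀ y ∈ V, JoinedIn V x y)
    (hUs : ∀ {x y : X} (γ γ' : Path x y), range γ ⊆ U → range γ' ⊆ U → γ.Homotopic γ')
    (hVs : ∀ {x y : X} (γ γ' : Path x y), range γ ⊆ V → range γ' ⊆ V → γ.Homotopic γ')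
    {x y : X} (γ γ' : Path x y) : γ.Homotopic γ' := by
  obtain ⟨o, ho, hoc⟩ := hc
  -- The connecting path to a point of the overlap must stay in the overlap, which uses its path
  -- connectedness.
  have hex : ∀ x, ∃ p : Path o x, (x ∈ U → range p ⊆ U) ∧ (x ∈ V → range p ⊆ V) := by
    intro x
    have hr : ∀ {S : Set X} {p : Path o x}, (∀ t, p t ∈ S) → range p ⊆ S :=
      fun h => by rintro _ ⟨t, rfl⟩; exact h t
    by_cases hxU : x ∈ U
    · by_cases hxV : x ∈ V
      · obtain ⟨p, hp⟩ := hoc ⟨hxU, hxV⟩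
        exact ⟨p, fun _ => hr fun t => (hp t).1, fun _ => hr fun t => (hp t).2⟩
      · obtain ⟨p, hp⟩ := hUc o ho.1 x hxU
        exact ⟨p, fun _ => hr hp, fun h => absurd h hxV⟩
    · have hxV := (hUV.symm.subset (mem_univ x)).resolve_left hxU
      obtain ⟨p, hp⟩ := hVc o ho.2 x hxV
      exact ⟨p, fun h => absurd h hxU, fun _ => hr hp⟩
  choose p hpU hpV using hex
  -- Locally both sides lie in `U` or both in `V`. The conclusion determines every path from `x` to
  -- `y` up to homotopy in terms of `p x` and `p y`.
  have key : ∀ h : C(I, X), ((p (h 0)).trans ⟨h, rfl, rfl⟩).Homotopic (p (h 1)) := by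
    intro h
    refine ContinuousMap.path_induction
      (P := fun h => ((p (h 0)).trans ⟨h, rfl, rfl⟩).Homotopic (p (h 1)))
      (fun {x y} γ γ' hγ hh => ?_) (fun {x y z} γ γ' h1 h2 => ?_) h fun t => ?_
    · have cast : ∀ γ : Path x y, ((p (γ 0)).trans (⟨γ.1, rfl, rfl⟩ : Path (γ 0) (γ 1))).Homotopic
          (p (γ 1)) ↔ ((p x).trans γ).Homotopic (p y) := by
        rintro ⟨f, rfl, rfl⟩
        rfl
      refine (cast γ').2 (Path.Homotopic.trans ?_ ((cast γ).1 hh))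
      exact (Path.Homotopic.refl _).hcomp hγ.symm
    · have cast : ∀ {x y : X} (γ : Path x y),
          ((p (γ 0)).trans (⟨γ.1, rfl, rfl⟩ : Path (γ 0) (γ 1))).Homotopic
          (p (γ 1)) ↔ ((p x).trans γ).Homotopic (p y) := by
        rintro _ _ ⟨f, rfl, rfl⟩
        rfl
      refine (cast _).2 ?_
      have h1 := (cast _).1 h1
      have h2 := (cast _).1 h2
      exact (Path.Homotopic.trans_assoc _ _ _).symm.trans
        ((h1.hcomp (Path.Homotopic.refl _)).trans h2)
    · have hmem : ∀ {S : Set X} (h' : C(I, X)), range h' ⊆ S →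
          range (p (h' 0)) ⊆ S → range ((p (h' 0)).trans ⟨h', rfl, rfl⟩) ⊆ S := by
        intro S h' hh hp
        rw [Path.trans_range]
        exact union_subset hp hh
      rcases hUV.symm.subset (mem_univ (h t)) with ht | ht
      · refine ⟨U, hU.mem_nhds ht, fun h' hh => ?_⟩
        have hh' : ∀ t, h' t ∈ U := fun t => (hh ⟨t, rfl⟩).2
        exact hUs _ _ (hmem h' (hh.trans inter_subset_right) (hpU _ (hh' 0))) (hpU _ (hh' 1))
      · refine ⟨V, hV.mem_nhds ht, fun h' hh => ?_⟩
        have hh' : ∀ t, h' t ∈ V := fun t => (hh ⟨t, rfl⟩).2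
        exact hVs _ _ (hmem h' (hh.trans inter_subset_right) (hpV _ (hh' 0))) (hpV _ (hh' 1))
  have key' : ∀ {x y : X} (γ : Path x y), ((p x).trans γ).Homotopic (p y) := by
    rintro _ _ ⟨f, rfl, rfl⟩
    exact key f
  have h := (key' γ).trans (key' γ').symm
  have h2 := (Path.Homotopic.refl (p x).symm).hcomp h
  have h3 : ∀ γ : Path x y, ((p x).symm.trans ((p x).trans γ)).Homotopic γ := fun γ =>
    (Path.Homotopic.trans_assoc _ _ _).symm.trans
      (((Path.Homotopic.symm_trans (p x)).hcomp (Path.Homotopic.refl γ)).trans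
        (Path.Homotopic.refl_trans γ))
  exact (h3 γ).symm.trans (h2.trans (h3 γ'))

theorem ConvexPatch.joinedIn_source {X E : Type*} [TopologicalSpace X] [NormedAddCommGroup E]
    [NormedSpace ℝ E] (P : ConvexPatch X E) {x y : X} (hx : x ∈ P.source) (hy : y ∈ P.source) :
    JoinedIn P.source x y :=
  ⟨P.segment hx hy, P.segment_mem hx hy⟩

/-- The complements of two antipodal points are planes under stereographic projection, and their
intersection is a punctured plane. -/
instance : SimplyConnectedSpace S2 := by
  have : Fact (Module.finrank ℝ E3 = 2 + 1) := ⟨by simp⟩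
  rw [simply_connected_iff_paths_homotopic']
  refine ⟨isPathConnected_iff_pathConnectedSpace.1
    (isPathConnected_sphere (one_lt_rank_euclideanSpace 1) 0 zero_le_one), fun {x y} γ γ' => ?_⟩
  obtain ⟨o⟩ : Nonempty S2 := inferInstance
  have hne : -o ≠ o := fun h => by
    have h1 : -o.1 = o.1 := congrArg Subtype.val h
    have h2 : o.1 = 0 := by
      have h3 : (2 : ℝ) • o.1 = 0 := by rw [two_smul, ← sub_neg_eq_add, h1, sub_self]
      exact (smul_eq_zero.1 h3).resolve_left two_ne_zero
    exact ne_zero_of_mem_unit_sphere o h2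
  let P : S2 → ConvexPatch S2 (EuclideanSpace ℝ (Fin 2)) := fun v =>
    .ofChart (stereographic' 2 v) convex_univ (stereographic'_target v).symm.subset
  have hP : ∀ v, (P v).source = {v}ᶜ := fun v => by
    change (stereographic' 2 v).source ∩ _ ⁻¹' univ = _
    rw [stereographic'_source, preimage_univ, inter_univ]
  refine Path.homotopic_of_union (U := (P o).source) (V := (P (-o)).source) ?_ ?_ ?_ ?_
    (fun x hx y hy => (P o).joinedIn_source hx hy) (fun x hx y hy => (P (-o)).joinedIn_source hx hy)
    (fun γ γ' hγ hγ' => (P o).homotopic hγ hγ') (fun γ γ' hγ hγ' => (P (-o)).homotopic hγ hγ') γ γ'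
  · rw [hP]; exact isOpen_compl_singleton
  · rw [hP]; exact isOpen_compl_singleton
  · rw [hP, hP, eq_univ_iff_forall]
    intro z
    by_cases hz : z = o
    · right
      rw [hz]
      exact hne.symm
    · exact Or.inl hz
  · have h := (isPathConnected_compl_singleton_of_one_lt_rank (one_lt_rank_euclideanSpace 0)
      (stereographic' 2 o (-o))).image' (f := (stereographic' 2 o).symm)
      ((stereographic' 2 o).continuousOn_symm.mono (by rw [stereographic'_target]; exact subset_univ _))
    convert h using 1
    have hs : -o ∈ (stereographic' 2 o).source := by rw [stereographic'_source]; exact hne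
    ext z
    rw [hP, hP]
    constructor
    · rintro ⟨hz1, hz2⟩
      have hs' : z ∈ (stereographic' 2 o).source := by rw [stereographic'_source]; exact hz1
      exact ⟨stereographic' 2 o z, fun h => hz2 ((stereographic' 2 o).injOn hs' hs h),
        (stereographic' 2 o).left_inv hs'⟩
    · rintro ⟨w, hw, rfl⟩
      have ht : w ∈ (stereographic' 2 o).target := by rw [stereographic'_target]; trivial
      refine ⟨?_, fun h => hw ?_⟩
      · rw [← stereographic'_source (n := 2)]
        exact (stereographic' 2 o).map_target ht
      · rw [mem_singleton_iff, ← mem_singleton_iff.1 h, (stereographic' 2 o).right_inv ht]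

instance {X Y : Type*} [TopologicalSpace X] [TopologicalSpace Y] [SimplyConnectedSpace X]
    [SimplyConnectedSpace Y] : SimplyConnectedSpace (X × Y) := by
  rw [simply_connected_iff_paths_homotopic']
  refine ⟨inferInstance, fun {x y} γ γ' => ?_⟩
  obtain ⟨H⟩ : (γ.map continuous_fst).Homotopic (γ'.map continuous_fst) :=
    SimplyConnectedSpace.paths_homotopic _ _
  obtain ⟨K⟩ : (γ.map continuous_snd).Homotopic (γ'.map continuous_snd) :=
    SimplyConnectedSpace.paths_homotopic _ _
  exact ⟨Path.Homotopic.prodHomotopy H K⟩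

end Sphere

/-! ## Topology of `X_{n,b}` -/

section Xnb

variable {ι M : Type*} [TopologicalSpace M]

/-- The complement of open balls with disjoint closures in a connected space is connected. -/
theorem isPreconnected_compl_iUnion_ball [Finite ι] [T2Space M] [PreconnectedSpace M]
    {d : ι → E3 → M} (hd : ∀ k, IsOpenEmbedding (d k))
    (hdisj : Pairwise fun k l => Disjoint (d k '' Metric.closedBall 0 1) (d l '' Metric.closedBall 0 1)) :
    IsPreconnected (⋃ k, d k '' Metric.ball 0 1)ᶜ := by
  set K := (⋃ k, d k '' Metric.ball 0 1)ᶜ with hK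
  have hS : ∀ k, d k '' Metric.sphere 0 1 ⊆ K := by
    rintro k _ ⟨w, hw, rfl⟩ h
    obtain ⟨l, w', hw', h⟩ := mem_iUnion.1 h
    by_cases hkl : l = k
    · subst hkl
      obtain rfl := (hd l).injective h
      rw [mem_sphere_iff_norm, sub_zero] at hw
      rw [mem_ball_zero_iff, hw] at hw'
      exact hw'.false
    · exact Set.disjoint_left.1 (hdisj hkl) ⟨w', Metric.ball_subset_closedBall hw', rfl⟩
        ⟨w, Metric.sphere_subset_closedBall hw, h.symm⟩
  have hSc : ∀ k, IsConnected (d k '' Metric.sphere 0 1) := fun k =>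
    (isConnected_sphere (one_lt_rank_euclideanSpace 1) 0 zero_le_one).image _
      (hd k).continuous.continuousOn
  have hcb : ∀ k, d k '' Metric.closedBall 0 1 ∩ K ⊆ d k '' Metric.sphere 0 1 := by
    rintro k _ ⟨⟨w, hw, rfl⟩, h⟩
    refine ⟨w, ?_, rfl⟩
    by_contra hw'
    refine h (mem_iUnion.2 ⟨k, w, ?_, rfl⟩)
    rw [← Metric.closedBall_sdiff_sphere]
    exact ⟨hw, hw'⟩
  rw [isPreconnected_closed_iff]
  intro u v hu hv huv hKu hKv
  by_contra hne
  rw [not_nonempty_iff_eq_empty] at hne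
  have hd' : ∀ z ∈ K, z ∈ u → z ∈ v → False := fun z h1 h2 h3 => notMem_empty z (hne ▸ ⟨h1, h2, h3⟩)
  have hKc : IsClosed K :=
    (isOpen_iUnion fun k => (hd k).isOpenMap _ Metric.isOpen_ball).isClosed_compl
  -- Each boundary sphere is connected and so lies on one side of a separation of `K`. Adding every
  -- closed ball to the side of its sphere would produce a separation of `M`.
  have hfill : ∀ u : Set M, IsClosed u →
      IsClosed ((u ∩ K) ∪ ⋃ k ∈ {k | (d k '' Metric.sphere 0 1 ∩ u).Nonempty},
        d k '' Metric.closedBall 0 1) := fun u hu =>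
    (hu.inter hKc).union ((Set.toFinite _).isClosed_biUnion fun k _ =>
      ((isCompact_closedBall _ _).image (hd k).continuous).isClosed)
  have hsep : ∀ k, (d k '' Metric.sphere 0 1 ∩ u).Nonempty →
      (d k '' Metric.sphere 0 1 ∩ v).Nonempty → False := by
    intro k h1 h2
    obtain ⟨z, hz, hz1, hz2⟩ := isPreconnected_closed_iff.1 (hSc k).isPreconnected u v hu hv
      ((hS k).trans huv) h1 h2
    exact hd' z (hS k hz) hz1 hz2
  have hin : ∀ u v : Set M, IsClosed u → IsClosed v → K ⊆ u ∪ v →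
      (∀ k, (d k '' Metric.sphere 0 1 ∩ u).Nonempty →
      (d k '' Metric.sphere 0 1 ∩ v).Nonempty → False) →
      ∀ z ∈ K, (z ∈ (u ∩ K) ∪ ⋃ k ∈ {k | (d k '' Metric.sphere 0 1 ∩ u).Nonempty},
        d k '' Metric.closedBall 0 1) → z ∈ u := by
    rintro u v hu hv huv hsep z hz (h | h)
    · exact h.1
    · obtain ⟨k, hk, hzk⟩ := mem_iUnion₂.1 h
      have hzS := hcb k ⟨hzk, hz⟩
      exact (huv hz).resolve_right fun hzv => hsep k hk ⟨z, hzS, hzv⟩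
  obtain ⟨z, -, hz, hz'⟩ := isPreconnected_closed_iff.1 (isPreconnected_univ (α := M)) _ _
    (hfill u hu) (hfill v hv) (fun z _ => by
      by_cases hz : z ∈ K
      · exact (huv hz).imp (fun h => Or.inl ⟨h, hz⟩) fun h => Or.inl ⟨h, hz⟩
      · rw [hK, mem_compl_iff, not_not] at hz
        obtain ⟨k, w, hw, rfl⟩ := mem_iUnion.1 hz
        have hmem : d k w ∈ d k '' Metric.closedBall 0 1 := ⟨w, Metric.ball_subset_closedBall hw, rfl⟩
        obtain ⟨s, hs⟩ := (hSc k).nonempty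
        exact (huv (hS k hs)).imp (fun h => Or.inr (mem_iUnion₂.2 ⟨k, ⟨s, hs, h⟩, hmem⟩))
          fun h => Or.inr (mem_iUnion₂.2 ⟨k, ⟨s, hs, h⟩, hmem⟩))
    (by obtain ⟨z, h1, h2⟩ := hKu; exact ⟨z, trivial, Or.inl ⟨h2, h1⟩⟩)
    (by obtain ⟨z, h1, h2⟩ := hKv; exact ⟨z, trivial, Or.inl ⟨h2, h1⟩⟩)
  by_cases hzK : z ∈ K
  · exact hd' z hzK (hin u v hu hv huv hsep z hzK hz)
      (hin v u hv hu (by rwa [union_comm]) (fun k h1 h2 => hsep k h2 h1) z hzK hz')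
  · obtain ⟨k, hk, hzk⟩ := mem_iUnion₂.1 (hz.resolve_left fun h => hzK h.2)
    obtain ⟨l, hl, hzl⟩ := mem_iUnion₂.1 (hz'.resolve_left fun h => hzK h.2)
    obtain rfl : k = l := by
      by_contra hkl
      exact Set.disjoint_left.1 (hdisj hkl) hzk hzl
    exact hsep k hk hl

/-- The topological properties of `X_{n,b}`. -/
structure IsTameDomain (X : Type*) [TopologicalSpace X] (B : Set X) : Prop where
  compactSpace : CompactSpace X
  t2Space : T2Space X
  preconnectedSpace : PreconnectedSpace X
  homotopic_refl : ∀ {x : X} (γ : Path x x), range γ ⊆ B → γ.Homotopic (Path.refl x)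

/-- The boundary of `X` maps into the union of the spheres bounding the removed balls, since off the
closed balls the range contains a neighbourhood. A loop in the boundary stays in one of these
disjoint spheres, which lies in the range and is simply connected. -/
theorem IsXnb.isTameDomain {n b : ℕ} {X : Type u} [TopologicalSpace X]
    [ChartedSpace (EuclideanHalfSpace 3) X] (hX : IsXnb n b X) :
    IsTameDomain X ((𝓡∂ 3).boundary X) := by
  obtain ⟨M, _, _, _, d, j, hM, hd, hdisj, hj, hr⟩ := hX
  obtain ⟨_, _, _⟩ := hM.topology
  have hd : ∀ k, IsOpenEmbedding (d k) := fun k => (hd k).1.isOpenEmbedding (hd k).2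
  have hcl : IsClosedEmbedding j := ⟨hj.isEmbedding, by
    rw [hr]
    exact (isOpen_iUnion fun k => (hd k).isOpenMap _ Metric.isOpen_ball).isClosed_compl⟩
  have hXc : CompactSpace X := hcl.compactSpace
  have hX2 : T2Space X := hcl.isEmbedding.t2Space
  have ht := IsSmoothEmbedding.isTameEmbedding hj
  have hbdry : (𝓡∂ 3).boundary X ⊆ ⋃ k, j ⁻¹' (d k '' Metric.sphere 0 1) := by
    intro x hx
    by_contra hne
    refine ht.mem_interior_range_iff.1 ?_ hx
    refine mem_interior.2 ⟨(⋃ k, d k '' Metric.closedBall 0 1)ᶜ, ?_, ?_, ?_⟩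
    · rw [hr]
      exact compl_subset_compl.2 (iUnion_mono fun k => image_mono Metric.ball_subset_closedBall)
    · exact (isClosed_iUnion_of_finite fun k =>
        ((isCompact_closedBall _ _).image (hd k).continuous).isClosed).isOpen_compl
    · intro h
      obtain ⟨k, w, hw, hwx⟩ := mem_iUnion.1 h
      rw [← Metric.ball_union_sphere] at hw
      rcases hw with hw | hw
      · exact (hr.subset ⟨x, rfl⟩ : j x ∈ _) (mem_iUnion.2 ⟨k, w, hw, hwx⟩)
      · exact hne (mem_iUnion.2 ⟨k, w, hw, hwx⟩)
  refine ⟨hXc, hX2, ?_, fun {x} γ hγ => ?_⟩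
  · have h := isPreconnected_compl_iUnion_ball hd hdisj
    rw [← hr, ← image_univ, hcl.isInducing.isPreconnected_image] at h
    exact ⟨h⟩
  · have hpre : ∀ k, IsClosed (j ⁻¹' (d k '' Metric.sphere 0 1)) := fun k =>
      (((isCompact_sphere _ _).image (hd k).continuous).isClosed).preimage hcl.continuous
    obtain ⟨k, hk⟩ := mem_iUnion.1 (hbdry (hγ ⟨0, rfl⟩))
    have hS : range γ ⊆ j ⁻¹' (d k '' Metric.sphere 0 1) := by
      have hclopen : IsClopen (γ ⁻¹' (j ⁻¹' (d k '' Metric.sphere 0 1))) := by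
        refine ⟨(hpre k).preimage γ.continuous, ?_⟩
        have : γ ⁻¹' (j ⁻¹' (d k '' Metric.sphere 0 1)) =
            (⋃ l ∈ {l | l ≠ k}, γ ⁻¹' (j ⁻¹' (d l '' Metric.sphere 0 1)))ᶜ := by
          ext t
          constructor
          · rintro h1 h2
            obtain ⟨l, hl, h2⟩ := mem_iUnion₂.1 h2
            exact Set.disjoint_left.1 (hdisj hl) (image_mono Metric.sphere_subset_closedBall h2)
              (image_mono Metric.sphere_subset_closedBall h1)
          · intro h
            obtain ⟨l, hl⟩ := mem_iUnion.1 (hbdry (hγ ⟨t, rfl⟩))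
            by_cases hlk : l = k
            · exact hlk ▸ hl
            · exact absurd (mem_iUnion₂.2 ⟨l, hlk, hl⟩) h
        rw [this]
        exact ((Set.toFinite _).isClosed_biUnion fun l _ =>
          (hpre l).preimage γ.continuous).isOpen_compl
      rintro _ ⟨t, rfl⟩
      exact (hclopen.eq_univ ⟨0, hk⟩).symm.subset (mem_univ t)
    have hmem : ∀ w : S2, d k w.1 ∈ range j := by
      intro w
      rw [hr]
      rintro h
      obtain ⟨l, w', hw', h⟩ := mem_iUnion.1 h
      have hw := w.2
      by_cases hkl : l = k
      · subst hkl
        rw [(hd l).injective h, mem_ball_zero_iff, norm_eq_of_mem_sphere] at hw'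
        exact hw'.false
      · exact Set.disjoint_left.1 (hdisj hkl) ⟨w', Metric.ball_subset_closedBall hw', rfl⟩
          ⟨w.1, Metric.sphere_subset_closedBall hw, h.symm⟩
    choose s hs using hmem
    have hsc : Continuous s := hcl.isInducing.continuous_iff.2 <| by
      have : j ∘ s = fun w => d k w.1 := funext hs
      rw [this]
      exact (hd k).continuous.comp continuous_subtype_val
    have hse : IsEmbedding s := (hsc.isClosedEmbedding fun w w' h => by
      have := congrArg j h
      rw [hs, hs] at this
      exact Subtype.ext ((hd k).injective this)).isEmbedding
    obtain ⟨g, hg⟩ := hse.exists_lift γ.1 (by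
      rintro _ ⟨t, rfl⟩
      obtain ⟨w, hw, h⟩ := hS ⟨t, rfl⟩
      exact ⟨⟨w, hw⟩, hcl.injective ((hs _).trans h)⟩)
    have hg01 : g 1 = g 0 := hse.injective (by
      rw [hg, hg]
      exact γ.target.trans γ.source.symm)
    let δ : Path (g 0) (g 0) := ⟨g, rfl, hg01⟩
    have hx : x = s (g 0) := (γ.source.symm.trans (hg 0).symm)
    subst hx
    have h1 : γ = δ.map hsc := Path.ext (funext fun t => (hg t).symm)
    rw [h1]
    exact Path.Homotopic.map (SimplyConnectedSpace.paths_homotopic δ (Path.refl _)) ⟨s, hsc⟩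

end Xnb

/-! ## Induced outer automorphisms -/

section Induced

/-- Endpoints such as f x and x often agree only propositionally; homotopies are then transported
through the underlying maps. -/
theorem Path.homotopic_congr {X : Type*} [TopologicalSpace X] {x y x' y' : X} {γ γ' : Path x y}
    {δ δ' : Path x' y'} (h : γ.1 = δ.1) (h' : γ'.1 = δ'.1) (hγ : γ.Homotopic γ') :
    δ.Homotopic δ' := by
  obtain rfl : x = x' := γ.source.symm.trans ((congrArg (· 0) h).trans δ.source)
  obtain rfl : y = y' := γ.target.symm.trans ((congrArg (· 1) h).trans δ.target)
  obtain rfl : γ = δ := Path.ext (congrArg (fun f : C(I, X) => (f : I → X)) h)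
  obtain rfl : γ' = δ' := Path.ext (congrArg (fun f : C(I, X) => (f : I → X)) h')
  exact hγ

theorem Path.trans_congr {X : Type*} [TopologicalSpace X] {x y z x' y' z' : X} {γ : Path x y}
    {γ' : Path y z} {δ : Path x' y'} {δ' : Path y' z'} (h : γ.1 = δ.1) (h' : γ'.1 = δ'.1) :
    (γ.trans γ').1 = (δ.trans δ').1 := by
  obtain rfl : x = x' := γ.source.symm.trans ((congrArg (· 0) h).trans δ.source)
  obtain rfl : y = y' := γ.target.symm.trans ((congrArg (· 1) h).trans δ.target)
  obtain rfl : z = z' := γ'.target.symm.trans ((congrArg (· 1) h').trans δ'.target)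
  obtain rfl : γ = δ := Path.ext (congrArg (fun f : C(I, X) => (f : I → X)) h)
  obtain rfl : γ' = δ' := Path.ext (congrArg (fun f : C(I, X) => (f : I → X)) h')
  rfl

variable {M : Type*} [TopologicalSpace M] {G : Type u} [Group G] {p : M}
  (e : FundamentalGroup M p ≃* G)

theorem Path.Homotopic.Quotient.symm_trans_cancel {x y z : M} (a : Path.Homotopic.Quotient x y)
    (b : Path.Homotopic.Quotient y z) : a.symm.trans (a.trans b) = b := by
  rw [← Path.Homotopic.Quotient.trans_assoc, Path.Homotopic.Quotient.symm_trans,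
    Path.Homotopic.Quotient.refl_trans]

/-- The element of the fundamental group represented by a loop. -/
def loopClass (γ : Path p p) : FundamentalGroup M p := Path.Homotopic.Quotient.mk γ

theorem loopClass_surjective (g : FundamentalGroup M p) : ∃ γ : Path p p, loopClass γ = g :=
  Path.Homotopic.Quotient.mk_surjective g

theorem loopClass_eq_iff {γ γ' : Path p p} : loopClass γ = loopClass γ' ↔ γ.Homotopic γ' :=
  Path.Homotopic.Quotient.eq

/-- Products of loop classes are traversed from right to left, which fixes the order in the
conjugations below. -/
theorem loopClass_mul (γ γ' : Path p p) :
    loopClass γ * loopClass γ' = loopClass (γ'.trans γ) := rfl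

theorem loopClass_inv (γ : Path p p) : (loopClass γ)⁻¹ = loopClass γ.symm := rfl

theorem map_loopClass {N : Type*} [TopologicalSpace N] (F : C(M, N)) (γ : Path p p) :
    FundamentalGroup.map F p (loopClass γ) = loopClass (γ.map F.continuous) := rfl

theorem FundamentalGroup.map_bijective (F : M ≃ₜ M) :
    Bijective (FundamentalGroup.map (F : C(M, M)) p) := by
  constructor
  · intro a b
    obtain ⟨γ, rfl⟩ := loopClass_surjective a
    obtain ⟨γ', rfl⟩ := loopClass_surjective b
    rw [map_loopClass, map_loopClass, loopClass_eq_iff, loopClass_eq_iff]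
    refine fun h => Path.homotopic_congr ?_ ?_ (h.map (F.symm : C(M, M)))
    · ext t
      exact F.symm_apply_apply _
    · ext t
      exact F.symm_apply_apply _
  · intro b
    obtain ⟨γ, rfl⟩ := loopClass_surjective b
    refine ⟨loopClass ((γ.map F.symm.continuous).cast (F.symm_apply_apply p).symm
      (F.symm_apply_apply p).symm), ?_⟩
    rw [map_loopClass]
    exact congrArg _ (Path.ext (funext fun t => F.apply_symm_apply _))

theorem exists_isInducedOuter [PathConnectedSpace M] (F : M ≃ₜ M) :
    ∃ q : OutGroup G, IsInducedOuter e F q := by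
  let δ := PathConnectedSpace.somePath p (F p)
  let a : MulAut G := e.symm.trans (((MulEquiv.ofBijective _ (FundamentalGroup.map_bijective F)).trans
    (FundamentalGroup.fundamentalGroupMulEquivOfPath δ).symm).trans e)
  refine ⟨QuotientGroup.mk a, δ, a, rfl, fun g => ?_⟩
  change e ((FundamentalGroup.fundamentalGroupMulEquivOfPath δ).symm
    (FundamentalGroup.map (F : C(M, M)) p (e.symm (e g)))) = _
  rw [e.symm_apply_apply]

theorem mk_mulAut_eq_of_conj {a a' : MulAut G} (c : G) (h : ∀ g, a' g = c * a g * c⁻¹) :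
    (QuotientGroup.mk a' : OutGroup G) = QuotientGroup.mk a := by
  have h1 : a' = MulAut.conj c * a := MulEquiv.ext h
  have h2 : (QuotientGroup.mk (MulAut.conj c) : OutGroup G) = 1 :=
    (QuotientGroup.eq_one_iff _).2 (MonoidHom.mem_range.2 ⟨c, rfl⟩)
  rw [h1, QuotientGroup.mk_mul, h2, one_mul]

variable {e}

theorem IsInducedOuter.apply_loopClass {F : M ≃ₜ M} {δ : Path p (F p)} {a : MulAut G}
    (ha : ∀ g : FundamentalGroup M p, a (e g) =
      e ((FundamentalGroup.fundamentalGroupMulEquivOfPath δ).symm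
        (FundamentalGroup.map (F : C(M, M)) p g))) (γ : Path p p) :
    a (e (loopClass γ)) = e (loopClass (δ.trans ((γ.map F.continuous).trans δ.symm))) := ha _

theorem isInducedOuter_of_loopClass {F : M ≃ₜ M} (δ : Path p (F p)) (a : MulAut G)
    (ha : ∀ γ : Path p p,
      a (e (loopClass γ)) = e (loopClass (δ.trans ((γ.map F.continuous).trans δ.symm)))) :
    IsInducedOuter e F (QuotientGroup.mk a) :=
  ⟨δ, a, rfl, fun g => by obtain ⟨γ, rfl⟩ := loopClass_surjective g; exact ha γ⟩

/-- Two choices of the path from `p` to `F p` differ by a loop at `p`, which changes the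
automorphism by an inner one. -/
theorem IsInducedOuter.unique {F : M ≃ₜ M} {q q' : OutGroup G} (h : IsInducedOuter e F q)
    (h' : IsInducedOuter e F q') : q = q' := by
  obtain ⟨δ, a, rfl, ha⟩ := h
  obtain ⟨δ', a', rfl, ha'⟩ := h'
  refine mk_mulAut_eq_of_conj (e (loopClass (δ'.trans δ.symm))) fun g => ?_
  obtain ⟨g, rfl⟩ := e.surjective g
  obtain ⟨γ, rfl⟩ := loopClass_surjective g
  rw [IsInducedOuter.apply_loopClass ha, IsInducedOuter.apply_loopClass ha', ← map_inv, ← map_mul,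
    ← map_mul, loopClass_inv, loopClass_mul, loopClass_mul]
  refine congrArg e (loopClass_eq_iff.2 ?_)
  rw [← Path.Homotopic.Quotient.eq]
  simp [Path.Homotopic.Quotient.mk_trans, Path.Homotopic.Quotient.mk_symm,
    Path.Homotopic.Quotient.symm_trans_cancel]

theorem IsInducedOuter.mul {F F' : M ≃ₜ M} {q q' : OutGroup G} (h : IsInducedOuter e F q)
    (h' : IsInducedOuter e F' q') : IsInducedOuter e (F'.trans F) (q * q') := by
  obtain ⟨δ, a, rfl, ha⟩ := h
  obtain ⟨δ', a', rfl, ha'⟩ := h'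
  refine isInducedOuter_of_loopClass (δ.trans (δ'.map F.continuous)) (a * a') fun γ => ?_
  rw [MulAut.mul_apply, IsInducedOuter.apply_loopClass ha', IsInducedOuter.apply_loopClass ha]
  refine congrArg e (loopClass_eq_iff.2 ?_)
  change Path.Homotopic _ ((δ.trans (δ'.map F.continuous)).trans
    (((γ.map F'.continuous).map F.continuous).trans (δ.trans (δ'.map F.continuous)).symm))
  rw [← Path.Homotopic.Quotient.eq]
  simp only [Path.map_trans, Path.trans_symm, Path.Homotopic.Quotient.mk_trans,
    Path.Homotopic.Quotient.trans_assoc, Path.map_symm]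

theorem isInducedOuter_one {F : M ≃ₜ M} (δ : Path p (F p))
    (h : ∀ γ : Path p p, (δ.trans (γ.map F.continuous)).Homotopic (γ.trans δ)) :
    IsInducedOuter e F (1 : OutGroup G) := by
  refine isInducedOuter_of_loopClass δ 1 fun γ => ?_
  rw [MulAut.one_apply]
  refine congrArg e (loopClass_eq_iff.2 ?_)
  have := Path.Homotopic.Quotient.eq.2 (h γ)
  rw [← Path.Homotopic.Quotient.eq]
  rw [Path.Homotopic.Quotient.mk_trans, Path.Homotopic.Quotient.mk_trans] at this
  rw [Path.Homotopic.Quotient.mk_trans, Path.Homotopic.Quotient.mk_trans,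
    ← Path.Homotopic.Quotient.trans_assoc, this]
  simp

end Induced

/-! ## Extension by the identity -/

namespace IsTameEmbedding

variable {X M : Type*} [TopologicalSpace X] [TopologicalSpace M] {ι : X → M} {B : Set X}
  (h : IsTameEmbedding ι B)

include h

omit [TopologicalSpace X] [TopologicalSpace M] h in
theorem mem_compl_of_notMem_range {y : M} (hy : y ∉ range ι) : y ∈ (ι '' Bᶜ)ᶜ :=
  fun hy' => hy (image_subset_range _ _ hy')

theorem apply_mem_compl_iff {x : X} : ι x ∈ (ι '' Bᶜ)ᶜ ↔ x ∈ B := by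
  rw [mem_compl_iff, h.injective.mem_set_image, mem_compl_iff, not_not]

/-- The map is pasted from the closed sets `range ι` and the complement of the interior; on the
latter it is the identity because `f` fixes `B`. -/
theorem exists_continuous_extension (f : C(X, X)) (hf : ∀ x ∈ B, f x = x) :
    ∃ F : C(M, M), (∀ x, F (ι x) = ι (f x)) ∧ ∀ y ∉ range ι, F y = y := by
  classical
  by_cases hX : Nonempty X
  swap
  · exact ⟨.id M, fun x => absurd ⟨x⟩ hX, fun _ _ => rfl⟩
  let F : M → M := fun y => if y ∈ range ι then ι (f (invFun ι y)) else y
  have h1 : ∀ x, F (ι x) = ι (f x) := fun x => by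
    change (if ι x ∈ range ι then _ else _) = _
    rw [if_pos ⟨x, rfl⟩, leftInverse_invFun h.injective]
  have h2 : ∀ y ∉ range ι, F y = y := fun y hy => if_neg hy
  refine ⟨⟨F, ?_⟩, h1, h2⟩
  have hc1 : ContinuousOn F (range ι) := by
    rw [← image_univ, h.isClosedEmbedding.isInducing.continuousOn_image_iff]
    have : F ∘ ι = ι ∘ f := funext h1
    rw [this]
    exact (h.continuous.comp f.continuous).continuousOn
  have hc2 : ContinuousOn F (ι '' Bᶜ)ᶜ := continuousOn_id.congr fun y hy => by
    by_cases hyr : y ∈ range ι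
    · obtain ⟨x, rfl⟩ := hyr
      rw [h1, hf x (h.apply_mem_compl_iff.1 hy)]
      rfl
    · exact h2 y hyr
  rw [← continuousOn_univ]
  have hu : range ι ∪ (ι '' Bᶜ)ᶜ = univ := by
    rw [eq_univ_iff_forall]
    intro y
    by_cases hyr : y ∈ range ι
    · exact Or.inl hyr
    · exact Or.inr (mem_compl_of_notMem_range hyr)
  rw [← hu]
  exact hc1.union_of_isClosed hc2 h.isClosedEmbedding.isClosed_range h.isOpen_image_compl.isClosed_compl

theorem exists_extension_homeomorph (f : X ≃ₜ X) (hf : ∀ x ∈ B, f x = x) :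
    ∃ F : M ≃ₜ M, (∀ x, F (ι x) = ι (f x)) ∧ ∀ y ∉ range ι, F y = y := by
  obtain ⟨F, h1, h2⟩ := h.exists_continuous_extension f hf
  obtain ⟨F', h1', h2'⟩ := h.exists_continuous_extension f.symm fun x hx => by
    have := f.symm_apply_apply x
    rwa [hf x hx] at this
  refine ⟨⟨⟨F, F', fun y => ?_, fun y => ?_⟩, F.continuous, F'.continuous⟩, h1, h2⟩
  · by_cases hyr : y ∈ range ι
    · obtain ⟨x, rfl⟩ := hyr
      rw [h1, h1']
      exact congrArg ι (f.symm_apply_apply x)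
    · rw [h2 y hyr, h2' y hyr]
  · by_cases hyr : y ∈ range ι
    · obtain ⟨x, rfl⟩ := hyr
      rw [h1', h1]
      exact congrArg ι (f.apply_symm_apply x)
    · rw [h2' y hyr, h2 y hyr]

theorem extension_eq_self {f : C(X, X)} (hf : ∀ x ∈ B, f x = x) {F : C(M, M)}
    (hF : ∀ x, F (ι x) = ι (f x)) (hF' : ∀ y ∉ range ι, F y = y) {y : M} (hy : y ∈ (ι '' Bᶜ)ᶜ) :
    F y = y := by
  by_cases hyr : y ∈ range ι
  · obtain ⟨x, rfl⟩ := hyr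
    rw [hF, hf x (h.apply_mem_compl_iff.1 hy)]
  · exact hF' y hyr

end IsTameEmbedding

/-! ## Homotopically trivial maps -/

/-- `f` acts trivially on the fundamental groupoid, relative to the set `B` of fixed points:
there are paths `c x` from `x` to `f x`, constant for `x ∈ B`, that are natural with respect to
homotopy classes of paths. -/
def IsHomotopicallyTrivial {X : Type*} [TopologicalSpace X] (B : Set X) (f : C(X, X)) : Prop :=
  ∃ c : ∀ x, Path x (f x), (∀ x ∈ B, ∀ t, c x t = x) ∧
    ∀ {x y : X} (γ : Path x y), ((c x).trans (γ.map f.continuous)).Homotopic (γ.trans (c y))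

section Trivial

variable {X : Type*} [TopologicalSpace X] {B : Set X} {f : C(X, X)}

/-- Naturality of a family of paths can be checked locally. -/
theorem natural_trans {c : ∀ x, Path x (f x)} {x y z : X} {γ : Path x y} {γ' : Path y z}
    (h : ((c x).trans (γ.map f.continuous)).Homotopic (γ.trans (c y)))
    (h' : ((c y).trans (γ'.map f.continuous)).Homotopic (γ'.trans (c z))) :
    ((c x).trans ((γ.trans γ').map f.continuous)).Homotopic ((γ.trans γ').trans (c z)) := by
  rw [← Path.Homotopic.Quotient.eq] at h h' ⊢
  simp only [Path.map_trans, Path.Homotopic.Quotient.mk_trans] at h h' ⊢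
  rw [← Path.Homotopic.Quotient.trans_assoc, h, Path.Homotopic.Quotient.trans_assoc, h',
    Path.Homotopic.Quotient.trans_assoc]

theorem natural_homotopic {c : ∀ x, Path x (f x)} {x y : X} {γ γ' : Path x y} (hγ : γ.Homotopic γ')
    (h : ((c x).trans (γ.map f.continuous)).Homotopic (γ.trans (c y))) :
    ((c x).trans (γ'.map f.continuous)).Homotopic (γ'.trans (c y)) :=
  ((Path.Homotopic.refl _).hcomp (hγ.map f).symm).trans
    (h.trans (hγ.hcomp (Path.Homotopic.refl _)))

/-- The naturality of `c` at the path `g`. -/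
def NaturalAt (c : ∀ x, Path x (f x)) (g : C(I, X)) : Prop :=
  ((c (g 0)).trans ((⟨g, rfl, rfl⟩ : Path (g 0) (g 1)).map f.continuous)).Homotopic
    ((⟨g, rfl, rfl⟩ : Path (g 0) (g 1)).trans (c (g 1)))

theorem naturalAt_iff {c : ∀ x, Path x (f x)} {x y : X} (γ : Path x y) :
    NaturalAt c γ.1 ↔ ((c x).trans (γ.map f.continuous)).Homotopic (γ.trans (c y)) := by
  obtain ⟨g, rfl, rfl⟩ := γ
  rfl

theorem isHomotopicallyTrivial_of_local {c : ∀ x, Path x (f x)} (hc : ∀ x ∈ B, ∀ t, c x t = x)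
    (hl : ∀ x, ∃ O ∈ 𝓝 x, ∀ g : C(I, X), range g ⊆ O → NaturalAt c g) :
    IsHomotopicallyTrivial B f := by
  refine ⟨c, hc, fun {x y} γ => (naturalAt_iff γ).1 ?_⟩
  refine ContinuousMap.path_induction (fun γ γ' h hh => ?_) (fun γ γ' h1 h2 => ?_) γ.1 fun t => ?_
  · exact (naturalAt_iff _).2 (natural_homotopic h ((naturalAt_iff _).1 hh))
  · exact (naturalAt_iff _).2 (natural_trans ((naturalAt_iff _).1 h1) ((naturalAt_iff _).1 h2))
  · obtain ⟨O, hO, hg⟩ := hl (γ.1 t)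
    exact ⟨O, hO, fun g hgO => hg g (hgO.trans inter_subset_right)⟩

/-- A homotopically trivial map acts trivially on homology. -/
theorem IsHomotopicallyTrivial.cocycle_eq (hf : IsHomotopicallyTrivial B f) {A : Type*}
    [AddCommGroup A] (T : PathCocycle X A) {g : C(I, X)} (hg : g 0 = g 1 ∨ (g 0 ∈ B ∧ g 1 ∈ B)) :
    T (f.comp g) = T g := by
  obtain ⟨c, hc, hn⟩ := hf
  let γ : Path (g 0) (g 1) := ⟨g, rfl, rfl⟩
  have h1 := T.map_homotopic (hn γ)
  rw [T.map_trans, T.map_trans] at h1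
  have h2 : T (γ.map f.continuous).1 = T (f.comp g) := rfl
  have h3 : T γ.1 = T g := rfl
  have h4 : T (c (g 0)).1 = T (c (g 1)).1 := by
    rcases hg with hg | ⟨h0, h1⟩
    · rw [hg]
    · have hconst : ∀ x ∈ B, T (c x).1 = 0 := fun x hx => by
        rw [← T.map_const x]
        exact congrArg T.toFun (ContinuousMap.ext (hc x hx))
      rw [hconst _ h0, hconst _ h1]
  rw [h2, h3, h4, add_comm] at h1
  exact add_right_cancel h1

/-- The end of a homotopy that is constant on `B` is homotopically trivial. -/
theorem isHomotopicallyTrivial_of_homotopy (Φ : C(I × X, X)) (h0 : ∀ x, Φ (0, x) = x)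
    (h1 : ∀ x, Φ (1, x) = f x) (hB : ∀ x ∈ B, ∀ t, Φ (t, x) = x) : IsHomotopicallyTrivial B f := by
  have : SimplyConnectedSpace I :=
    have : ContractibleSpace I := (convex_Icc (0 : ℝ) 1).contractibleSpace ⟨0, by simp⟩
    inferInstance
  let c : ∀ x, Path x (f x) := fun x => ⟨Φ.comp ⟨fun t => (t, x), by fun_prop⟩, h0 x, h1 x⟩
  refine ⟨c, hB, fun {x y} γ => ?_⟩
  let H : C(I × I, X) := ⟨fun q => Φ (q.1, γ q.2), by fun_prop⟩
  let a : ∀ s : I, Path ((0, s) : I × I) (1, s) := fun s =>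
    ⟨⟨fun t => (t, s), by fun_prop⟩, rfl, rfl⟩
  let b : ∀ s : I, Path ((s, 0) : I × I) (s, 1) := fun s =>
    ⟨⟨fun t => (s, t), by fun_prop⟩, rfl, rfl⟩
  -- The two ways around the unit square; the homotopy carries them to the two sides of naturality.
  have hh : ((a 0).trans (b 1)).Homotopic ((b 0).trans (a 1)) :=
    SimplyConnectedSpace.paths_homotopic _ _
  have hh := hh.map H
  rw [Path.map_trans, Path.map_trans] at hh
  refine Path.homotopic_congr (Path.trans_congr ?_ ?_) (Path.trans_congr ?_ ?_) hh
  · ext t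
    change Φ (t, γ 0) = Φ (t, x)
    rw [γ.source]
  · ext t
    exact h1 _
  · ext t
    exact h0 _
  · ext t
    change Φ (t, γ 1) = Φ (t, y)
    rw [γ.target]

/-- A map that is supported in a closed subset `K` of a simply connected open set is
homotopically trivial. -/
theorem isHomotopicallyTrivial_of_support {Y : Type*} [TopologicalSpace Y] [SimplyConnectedSpace Y]
    {U : Y → X} (hU : IsOpenEmbedding U) {K : Set X} (hK : IsClosed K) (hKU : K ⊆ range U)
    (hf : ∀ x ∉ K, f x = x) (hfU : ∀ x ∈ range U, f x ∈ range U) (hB : ∀ x ∈ B, x ∉ range U) :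
    IsHomotopicallyTrivial B f := by
  have hUs : ∀ {x y : X} (γ γ' : Path x y), range γ ⊆ range U → range γ' ⊆ range U →
      γ.Homotopic γ' := by
    intro x y γ γ' hγ hγ'
    obtain ⟨g, hg⟩ := hU.isEmbedding.exists_lift γ.1 hγ
    obtain ⟨g', hg'⟩ := hU.isEmbedding.exists_lift γ'.1 hγ'
    have h0 : g' 0 = g 0 := hU.injective (by
      rw [hg, hg']; exact γ'.source.trans γ.source.symm)
    have h1 : g' 1 = g 1 := hU.injective (by
      rw [hg, hg']; exact γ'.target.trans γ.target.symm)
    let δ : Path (g 0) (g 1) := ⟨g, rfl, rfl⟩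
    let δ' : Path (g 0) (g 1) := ⟨g', h0, h1⟩
    have hδ : δ.Homotopic δ' := SimplyConnectedSpace.paths_homotopic _ _
    exact Path.homotopic_congr (ContinuousMap.ext hg) (ContinuousMap.ext hg')
      (hδ.map ⟨U, hU.continuous⟩)
  have hex : ∀ x, ∃ c : Path x (f x), (x ∈ range U → range c ⊆ range U) ∧
      (x ∉ range U → ∀ t, c t = x) := by
    intro x
    by_cases hx : x ∈ range U
    · obtain ⟨z, rfl⟩ := hx
      obtain ⟨z', hz'⟩ := hfU _ ⟨z, rfl⟩
      refine ⟨((PathConnectedSpace.somePath z z').map hU.continuous).cast rfl hz'.symm, fun _ => ?_,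
        fun h => absurd ⟨z, rfl⟩ h⟩
      rintro _ ⟨t, rfl⟩
      exact ⟨_, rfl⟩
    · exact ⟨(Path.refl x).cast rfl (hf x fun h => hx (hKU h)), fun h => absurd h hx, fun _ _ => rfl⟩
  choose c hc hc' using hex
  refine isHomotopicallyTrivial_of_local (c := c) (fun x hx => hc' x (hB x hx)) fun x => ?_
  by_cases hx : x ∈ range U
  · refine ⟨range U, hU.isOpen_range.mem_nhds hx, fun g hg => hUs _ _ ?_ ?_⟩
    · rw [Path.trans_range]
      refine union_subset (hc _ (hg ⟨0, rfl⟩)) ?_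
      rintro _ ⟨t, rfl⟩
      exact hfU _ (hg ⟨t, rfl⟩)
    · rw [Path.trans_range]
      exact union_subset hg (hc _ (hg ⟨1, rfl⟩))
  · refine ⟨Kᶜ, hK.isOpen_compl.mem_nhds fun h => hx (hKU h), fun g hg => ?_⟩
    -- Off `K` the map fixes `y`, and `c y` is a null-homotopic loop, either inside the tube or
    -- constant. Naturality there reduces to the unit laws.
    have hnull : ∀ y, y ∉ K → (c y).1.HomotopicRel (Path.refl y).1 {0, 1} := by
      intro y hy
      by_cases hyU : y ∈ range U
      · refine hUs ((c y).cast rfl (hf y hy).symm) (Path.refl y) (hc y hyU) ?_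
        rintro _ ⟨t, rfl⟩
        exact hyU
      · have : (c y).1 = (Path.refl y).1 := ContinuousMap.ext (hc' y hyU)
        rw [this]
        exact ContinuousMap.HomotopicRel.refl _
    let γ : Path (g 0) (g 1) := ⟨g, rfl, rfl⟩
    have hfg : (γ.map f.continuous).1 = γ.1 := ContinuousMap.ext fun t => hf _ (hg ⟨t, rfl⟩)
    have h0 : ((c (g 0)).cast rfl (hf _ (hg ⟨0, rfl⟩)).symm).Homotopic (Path.refl (g 0)) :=
      hnull _ (hg ⟨0, rfl⟩)
    have h1 : ((c (g 1)).cast rfl (hf _ (hg ⟨1, rfl⟩)).symm).Homotopic (Path.refl (g 1)) :=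
      hnull _ (hg ⟨1, rfl⟩)
    have hh := ((h0.hcomp (Path.Homotopic.refl γ)).trans (Path.Homotopic.refl_trans γ)).trans
      ((Path.Homotopic.refl γ).hcomp h1 |>.trans (Path.Homotopic.trans_refl γ)).symm
    refine Path.homotopic_congr (Path.trans_congr ?_ hfg.symm) (Path.trans_congr ?_ ?_) hh <;> rfl

/-- The extension by the identity of a homotopically trivial map is homotopically trivial. -/
theorem IsTameEmbedding.isHomotopicallyTrivial_extension {M : Type*} [TopologicalSpace M]
    {ι : X → M} (h : IsTameEmbedding ι B) (hf : IsHomotopicallyTrivial B f)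
    (hfB : ∀ x ∈ B, f x = x) {F : C(M, M)} (hF : ∀ x, F (ι x) = ι (f x))
    (hF' : ∀ y ∉ range ι, F y = y) : IsHomotopicallyTrivial ∅ F := by
  obtain ⟨c, hc, hn⟩ := hf
  -- The image of `c` over `X` and the constant path over the complement agree on ι(B), as `c` is
  -- constant on `B`.
  have hex : ∀ y, ∃ C : Path y (F y), (∀ x, ι x = y → ∀ t, C t = ι (c x t)) ∧
      (y ∈ (ι '' Bᶜ)ᶜ → ∀ t, C t = y) := by
    intro y
    by_cases hy : y ∈ range ι
    · obtain ⟨x, rfl⟩ := hy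
      refine ⟨((c x).map h.continuous).cast rfl (hF x), fun x' hx' t => ?_, fun hx t => ?_⟩
      · rw [h.injective hx']
        rfl
      · exact congrArg ι (hc x (h.apply_mem_compl_iff.1 hx) t)
    · exact ⟨(Path.refl y).cast rfl (hF' y hy), fun x hx => absurd ⟨x, hx⟩ hy, fun _ _ => rfl⟩
  choose C hC hC' using hex
  refine ⟨C, fun _ h => absurd h (notMem_empty _), fun {x y} γ => (naturalAt_iff γ).1 ?_⟩
  refine h.path_induction (fun γ γ' h hh => ?_) (fun γ γ' h1 h2 => ?_) (fun a => ?_)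
    (fun g hg => ?_) γ.1
  · exact (naturalAt_iff _).2 (natural_homotopic h ((naturalAt_iff _).1 hh))
  · exact (naturalAt_iff _).2 (natural_trans ((naturalAt_iff _).1 h1) ((naturalAt_iff _).1 h2))
  · let α : Path (a 0) (a 1) := ⟨a, rfl, rfl⟩
    have := (hn α).map ⟨ι, h.continuous⟩
    rw [Path.map_trans, Path.map_trans] at this
    refine Path.homotopic_congr (Path.trans_congr ?_ ?_) (Path.trans_congr rfl ?_) this
    · ext t
      exact (hC _ _ rfl t).symm
    · ext t
      exact (hF _).symm
    · ext t
      exact (hC _ _ rfl t).symm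
  · let γ : Path (g 0) (g 1) := ⟨g, rfl, rfl⟩
    have hfix : ∀ t, F (g t) = g t := fun t => h.extension_eq_self hfB hF hF' (hg ⟨t, rfl⟩)
    refine Path.homotopic_congr (Path.trans_congr ?_ ?_) (Path.trans_congr rfl ?_)
      ((Path.Homotopic.refl_trans γ).trans (Path.Homotopic.trans_refl γ).symm)
    · ext t
      exact (hC' _ (hg ⟨0, rfl⟩) t).symm
    · ext t
      exact (hfix t).symm
    · ext t
      exact (hC' _ (hg ⟨1, rfl⟩) t).symm

theorem IsHomotopicallyTrivial.isInducedOuter_one {M : Type*} [TopologicalSpace M] {G : Type u}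
    [Group G] {p : M} (e : FundamentalGroup M p ≃* G) {F : M ≃ₜ M} {B : Set M}
    (hF : IsHomotopicallyTrivial B (F : C(M, M))) : IsInducedOuter e F (1 : OutGroup G) := by
  obtain ⟨c, -, hn⟩ := hF
  exact _root_.isInducedOuter_one (c p) fun γ => hn γ

end Trivial

/-! ## Isotopies and sphere twists -/

section MappingClasses

variable {X : Type u} [TopologicalSpace X] [ChartedSpace (EuclideanHalfSpace 3) X]
  [IsManifold (𝓡∂ 3) ∞ X] {o : ManifoldOrientation X}

/-- The continuous map underlying a diffeomorphism. -/
noncomputable def diffMap (f : DiffRel o) : C(X, X) := ⟨f.1, f.1.continuous⟩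

theorem diffMap_eq_self (f : DiffRel o) {x : X} (hx : x ∈ (𝓡∂ 3).boundary X) :
    diffMap f x = x := f.2.2 x hx

theorem diffMap_injective (f : DiffRel o) : Injective (diffMap f) := f.1.injective

theorem diffMap_mem_boundary_iff (f : DiffRel o) {x : X} :
    diffMap f x ∈ (𝓡∂ 3).boundary X ↔ x ∈ (𝓡∂ 3).boundary X := by
  refine ⟨fun h => ?_, fun h => by rwa [diffMap_eq_self f h]⟩
  rwa [← diffMap_injective f (diffMap_eq_self f h)]

theorem IsotopicToId.isHomotopicallyTrivial {f : DiffRel o} (hf : IsotopicToId f) :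
    IsHomotopicallyTrivial ((𝓡∂ 3).boundary X) (diffMap f) := by
  obtain ⟨Φ, hΦ, h0, rfl⟩ := hf
  refine isHomotopicallyTrivial_of_homotopy
    ⟨fun q : I × X => (Φ q.1).1 q.2, hΦ.continuous.comp (by fun_prop : Continuous
      fun q : I × X => ((q.1 : ℝ), q.2))⟩ (fun x => ?_) (fun x => ?_) fun x hx t => (Φ t).2.2 x hx
  · change (Φ ((0 : I) : ℝ)).1 x = x
    rw [Icc.coe_zero, h0]
    rfl
  · change (Φ ((1 : I) : ℝ)).1 x = _
    rw [Icc.coe_one]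
    rfl

theorem rotS2_zero (x : S2) : rotS2 0 x = x := by
  apply Subtype.ext
  ext i
  fin_cases i <;> simp [rotS2]

theorem rotS2_two_pi (x : S2) : rotS2 (2 * Real.pi) x = x := by
  apply Subtype.ext
  ext i
  fin_cases i <;> simp [rotS2]

/-- The rotation angle is 0 or 2π off S² × [0, 1], so the support is compact inside the simply
connected tube. The tube misses the boundary, being a local diffeomorphic image of a manifold
without boundary. -/
theorem IsSphereTwist.isHomotopicallyTrivial [T2Space X] {f : DiffRel o} (hf : IsSphereTwist f) :
    IsHomotopicallyTrivial ((𝓡∂ 3).boundary X) (diffMap f) := by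
  obtain ⟨U, hU, hinj, hin, hout⟩ := hf
  have hUo := hU.isOpenEmbedding hinj
  refine isHomotopicallyTrivial_of_support hUo (K := U '' (univ ×ˢ Icc 0 1))
    ((isCompact_univ.prod isCompact_Icc).image hUo.continuous).isClosed (image_subset_range _ _)
    (fun x hx => ?_) ?_ ?_
  · by_cases hxU : x ∈ range U
    · obtain ⟨⟨x, t⟩, rfl⟩ := hxU
      refine (hin x t).trans ?_
      rcases le_total t 0 with h0 | h0
      · rw [Real.smoothTransition.zero_of_nonpos h0, mul_zero, rotS2_zero]
      · rcases le_total 1 t with h1 | h1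
        · rw [Real.smoothTransition.one_of_one_le h1, mul_one, rotS2_two_pi]
        · exact absurd ⟨(x, t), ⟨trivial, h0, h1⟩, rfl⟩ hx
    · exact hout x hxU
  · rintro _ ⟨⟨x, t⟩, rfl⟩
    exact ⟨_, (hin x t).symm⟩
  · rintro _ hx ⟨z, rfl⟩
    have h1 := ((hU z).isInteriorPoint_iff (by simp)).1 BoundarylessManifold.isInteriorPoint
    exact ((𝓡∂ 3).isInteriorPoint_iff_not_isBoundaryPoint _).1 h1 hx

theorem outClass_surjective : Surjective (outClass o) := fun q => by
  obtain ⟨q, rfl⟩ := QuotientGroup.mk_surjective q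
  obtain ⟨f, rfl⟩ := QuotientGroup.mk_surjective q
  exact ⟨f, rfl⟩

/-- A homomorphism on diffeomorphisms that kills homotopically trivial maps descends to
`Out_{n,b}`. -/
theorem exists_hom_outBdry [T2Space X] {G : Type*} [Group G] (Ψ : DiffRel o →* G)
    (hΨ : ∀ f : DiffRel o, IsHomotopicallyTrivial ((𝓡∂ 3).boundary X) (diffMap f) → Ψ f = 1) :
    ∃ φ : OutBdry o →* G, ∀ f, φ (outClass o f) = Ψ f := by
  let Ψ' : MappingClassGroup o →* G := QuotientGroup.lift (isotopySubgroup o) Ψ fun f hf =>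
    hΨ f (IsotopicToId.isHomotopicallyTrivial hf)
  refine ⟨QuotientGroup.lift (sphereTwistSubgroup o) Ψ' fun q hq => ?_, fun f => rfl⟩
  refine (Subgroup.closure_le Ψ'.ker).2 ?_ hq
  rintro _ ⟨f, hf, rfl⟩
  exact hΨ f hf.isHomotopicallyTrivial

/-! ### The action on homology -/

theorem diffH1_pathClass (f : DiffRel o) (h : C(I, X))
    (hh : h 0 = h 1 ∨ (h 0 ∈ (𝓡∂ 3).boundary X ∧ h 1 ∈ (𝓡∂ 3).boundary X)) :
    diffH1 f (pathClass _ h hh) = pathClass _ ((diffMap f).comp h)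
      (hh.imp (congrArg (diffMap f)) fun h =>
        ⟨(diffMap_mem_boundary_iff f).2 h.1, (diffMap_mem_boundary_iff f).2 h.2⟩) :=
  RelH1.map_pathClass _ _ h hh

theorem IsSimpleClosedCurve.comp (f : DiffRel o) {h : C(I, X)} (hh : IsSimpleClosedCurve h) :
    IsSimpleClosedCurve ((diffMap f).comp h) :=
  ⟨congrArg (diffMap f) hh.1, (diffMap_injective f).injOn.comp hh.2 (mapsTo_univ _ _)⟩

variable {P : Set (Set (Set X))}

theorem IsAdjacentArc.comp (f : DiffRel o) {h : C(I, X)} (hh : IsAdjacentArc P h) :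
    IsAdjacentArc P ((diffMap f).comp h) := by
  obtain ⟨h1, h2, C, hC, C', hC', hCC, hP, h0, h01⟩ := hh
  refine ⟨(diffMap_injective f).comp h1, fun t => (diffMap_mem_boundary_iff f).trans (h2 t), C, hC, C', hC', hCC,
    hP, ?_, ?_⟩
  · change diffMap f (h 0) ∈ C
    rwa [diffMap_eq_self f ((h2 0).2 (Or.inl rfl))]
  · change diffMap f (h 1) ∈ C'
    rwa [diffMap_eq_self f ((h2 1).2 (Or.inr rfl))]

/-- The restriction of the action of a diffeomorphism to `H₁ᴾ`. -/
noncomputable def diffH1P (P : Set (Set (Set X))) (f : DiffRel o) : H1P P →ₗ[ℤ] H1P P :=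
  (diffH1 f).restrict fun c hc => by
    refine (Submodule.map_le_iff_le_comap (f := diffH1 f) (q := H1P P)).1 ?_ hc
    rw [H1P, Submodule.map_span_le]
    rintro _ ⟨h, hh, hs, rfl⟩
    rw [diffH1_pathClass]
    exact Submodule.subset_span ⟨_, _, hs.imp (fun hs => hs.comp f) fun hs => hs.comp f, rfl⟩

theorem coe_diffH1P (f : DiffRel o) (c : H1P P) :
    (diffH1P P f c : RelH1 ((𝓡∂ 3).boundary X)) = diffH1 f c := rfl

omit [IsManifold (𝓡∂ 3) ∞ X] in
/-- Linear maps on `H₁ᴾ` are determined by the classes of curves and arcs. -/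
theorem H1P_hom_ext {N : Type*} [AddCommGroup N] {α β : H1P P →ₗ[ℤ] N}
    (hαβ : ∀ (h : C(I, X)) (hh : h 0 = h 1 ∨ (h 0 ∈ (𝓡∂ 3).boundary X ∧ h 1 ∈ (𝓡∂ 3).boundary X))
      (hs : IsSimpleClosedCurve h ∨ IsAdjacentArc P h),
      α ⟨pathClass _ h hh, Submodule.subset_span ⟨h, hh, hs, rfl⟩⟩ =
        β ⟨pathClass _ h hh, Submodule.subset_span ⟨h, hh, hs, rfl⟩⟩) : α = β := by
  refine LinearMap.ext fun ⟨c, hc⟩ => ?_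
  refine Submodule.span_induction (p := fun c hc => α ⟨c, hc⟩ = β ⟨c, hc⟩) ?_ ?_ ?_ ?_ hc
  · rintro _ ⟨h, hh, hs, rfl⟩
    exact hαβ h hh hs
  · exact (map_zero α).trans (map_zero β).symm
  · intro x y hx hy h1 h2
    exact (map_add α ⟨x, hx⟩ ⟨y, hy⟩).trans ((congrArg₂ (· + ·) h1 h2).trans
      (map_add β ⟨x, hx⟩ ⟨y, hy⟩).symm)
  · intro a x hx h1
    exact (map_smul α a ⟨x, hx⟩).trans ((congrArg (a • ·) h1).trans (map_smul β a ⟨x, hx⟩).symm)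

theorem diffH1P_mul (f g : DiffRel o) : diffH1P P (f * g) = diffH1P P f ∘ₗ diffH1P P g := by
  refine H1P_hom_ext fun h hh hs => Subtype.ext ?_
  rw [LinearMap.comp_apply, coe_diffH1P, coe_diffH1P, coe_diffH1P, diffH1_pathClass,
    diffH1_pathClass, diffH1_pathClass]
  rfl

theorem diffH1P_one : diffH1P P (1 : DiffRel o) = LinearMap.id := by
  refine H1P_hom_ext fun h hh hs => Subtype.ext ?_
  rw [coe_diffH1P, diffH1_pathClass]
  rfl

theorem diffH1P_eq_id_iff {f : DiffRel o} : diffH1P P f = LinearMap.id ↔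
    ∀ h : C(I, X), IsSimpleClosedCurve h ∨ IsAdjacentArc P h →
      chainClass ((𝓡∂ 3).boundary X) ((diffMap f).comp h) = chainClass ((𝓡∂ 3).boundary X) h := by
  constructor
  · intro hf h hs
    have hh : h 0 = h 1 ∨ (h 0 ∈ (𝓡∂ 3).boundary X ∧ h 1 ∈ (𝓡∂ 3).boundary X) :=
      hs.imp And.left fun hs => ⟨(hs.2.1 0).2 (Or.inl rfl), (hs.2.1 1).2 (Or.inr rfl)⟩
    have h1 := congrArg Subtype.val (LinearMap.congr_fun hf
      ⟨pathClass _ h hh, Submodule.subset_span ⟨h, hh, hs, rfl⟩⟩)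
    rw [coe_diffH1P, diffH1_pathClass] at h1
    exact (pathClass_eq_iff (hh' := hh)).1 h1
  · intro hf
    refine H1P_hom_ext fun h hh hs => Subtype.ext ?_
    rw [coe_diffH1P, diffH1_pathClass]
    exact (pathClass_eq_iff (hh' := hh)).2 (hf h hs)

/-- The action of diffeomorphisms on `H₁ᴾ`. -/
noncomputable def diffH1PHom (o : ManifoldOrientation X) (P : Set (Set (Set X))) :
    DiffRel o →* (H1P P ≃ₗ[ℤ] H1P P) where
  toFun f := LinearEquiv.ofLinearMap (diffH1P P f) (diffH1P P f⁻¹)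
    (by rw [← diffH1P_mul, mul_inv_cancel, diffH1P_one])
    (by rw [← diffH1P_mul, inv_mul_cancel, diffH1P_one])
  map_one' := LinearEquiv.toLinearMap_injective diffH1P_one
  map_mul' f g := LinearEquiv.toLinearMap_injective (diffH1P_mul f g)

theorem diffH1PHom_eq_one_iff {f : DiffRel o} : diffH1PHom o P f = 1 ↔ diffH1P P f = LinearMap.id :=
  ⟨fun h => congrArg LinearEquiv.toLinearMap h, fun h => LinearEquiv.toLinearMap_injective h⟩

theorem isActionOnH1P_iff {ρ : OutBdry o →* (H1P P ≃ₗ[ℤ] H1P P)} :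
    IsActionOnH1P P ρ ↔ ∀ f, ρ (outClass o f) = diffH1PHom o P f :=
  ⟨fun h f => LinearEquiv.ext fun c => Subtype.ext (h f c), fun h f c => by rw [h f]; rfl⟩

/-- A homotopically trivial map preserves the values of `chainCocycle` on loops and on arcs with
ends in the boundary, hence acts trivially on the generators of H₁ᴾ. -/
theorem existsUnique_isActionOnH1P [T2Space X] :
    ∃! ρ : OutBdry o →* (H1P P ≃ₗ[ℤ] H1P P), IsActionOnH1P P ρ := by
  obtain ⟨ρ, hρ⟩ := exists_hom_outBdry (diffH1PHom o P) fun f hf =>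
    diffH1PHom_eq_one_iff.2 <| diffH1P_eq_id_iff.2 fun h hs => by
      refine hf.cocycle_eq (chainCocycle _) (hs.imp And.left fun hs => ?_)
      exact ⟨(hs.2.1 0).2 (Or.inl rfl), (hs.2.1 1).2 (Or.inr rfl)⟩
  refine ⟨ρ, isActionOnH1P_iff.2 hρ, fun ρ' hρ' => MonoidHom.ext fun q => ?_⟩
  obtain ⟨f, rfl⟩ := outClass_surjective q
  rw [hρ, isActionOnH1P_iff.1 hρ']

/-! ### The induced homomorphism -/

variable {M : Type v} [TopologicalSpace M] {ι : X → M}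

theorem IsExtensionById.unique {f : DiffRel o} {F F' : M ≃ₜ M} (h : IsExtensionById ι f F)
    (h' : IsExtensionById ι f F') : F = F' := by
  ext y
  by_cases hy : y ∈ range ι
  · obtain ⟨x, rfl⟩ := hy
    rw [h.1, h'.1]
  · rw [h.2 y hy, h'.2 y hy]

theorem IsExtensionById.mul {f f' : DiffRel o} {F F' : M ≃ₜ M} (h : IsExtensionById ι f F)
    (h' : IsExtensionById ι f' F') : IsExtensionById ι (f * f') (F'.trans F) :=
  ⟨fun x => (congrArg F (h'.1 x)).trans (h.1 _), fun y hy =>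
    (congrArg F (h'.2 y hy)).trans (h.2 y hy)⟩

variable {G : Type*} [Group G] {p : M} (e : FundamentalGroup M p ≃* G)

theorem existsUnique_inducedOuter [PathConnectedSpace M]
    (hι : IsTameEmbedding ι ((𝓡∂ 3).boundary X)) (f : DiffRel o) :
    ∃! q : OutGroup G, ∃ F : M ≃ₜ M, IsExtensionById ι f F ∧ IsInducedOuter e F q := by
  obtain ⟨F, hF⟩ := hι.exists_extension_homeomorph f.1.toHomeomorph fun x hx => f.2.2 x hx
  obtain ⟨q, hq⟩ := exists_isInducedOuter e F
  refine ⟨q, ⟨F, hF, hq⟩, ?_⟩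
  rintro q' ⟨F', hF', hq'⟩
  obtain rfl := IsExtensionById.unique (f := f) hF hF'
  exact hq'.unique hq

/-- Uniqueness of the extension and of its outer class makes the assignment multiplicative. It kills
homotopically trivial maps because their extensions are homotopically trivial. -/
theorem existsUnique_inducedHom [T2Space X] [PathConnectedSpace M]
    (hι : IsTameEmbedding ι ((𝓡∂ 3).boundary X)) : ∃! φ : OutBdry o →* OutGroup G,
      ∀ f : DiffRel o, ∃ F : M ≃ₜ M, IsExtensionById ι f F ∧ IsInducedOuter e F (φ (outClass o f)) := by
  choose q hq hqu using existsUnique_inducedOuter (o := o) e hι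
  let Ψ : DiffRel o →* OutGroup G := MonoidHom.mk' q fun f g => by
    obtain ⟨F, hF, hFq⟩ := hq f
    obtain ⟨F', hF', hFq'⟩ := hq g
    exact (hqu _ _ ⟨_, hF.mul hF', hFq.mul hFq'⟩).symm
  obtain ⟨φ, hφ⟩ := exists_hom_outBdry Ψ fun f hf => by
    obtain ⟨F, hF, -⟩ := hq f
    have h1 := hι.isHomotopicallyTrivial_extension hf (fun x hx => f.2.2 x hx)
      (F := (F : C(M, M))) hF.1 hF.2
    exact (hqu f 1 ⟨F, hF, h1.isInducedOuter_one e⟩).symm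
  refine ⟨φ, fun f => ?_, fun φ' hφ' => MonoidHom.ext fun r => ?_⟩
  · rw [hφ]
    exact hq f
  · obtain ⟨f, rfl⟩ := outClass_surjective r
    rw [hφ]
    exact hqu f _ (hφ' f)

end MappingClasses

/-! ## Action on the first homology of `M` -/

section Abelianization

variable {M : Type*} [TopologicalSpace M] {p : M}

/-- The homomorphism from the fundamental group defined by a path cocycle. -/
def PathCocycle.loopHom {A : Type*} [AddCommGroup A] (T : PathCocycle M A) (p : M) :
    FundamentalGroup M p →* Multiplicative A where
  toFun g := Multiplicative.ofAdd (Quotient.lift (fun γ : Path p p => T γ.1)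
    (fun _ _ h => T.map_homotopic h) (show Path.Homotopic.Quotient p p from g))
  map_one' := congrArg Multiplicative.ofAdd (T.map_refl p)
  map_mul' a b := by
    obtain ⟨γ, rfl⟩ := loopClass_surjective a
    obtain ⟨γ', rfl⟩ := loopClass_surjective b
    rw [loopClass_mul]
    refine congrArg Multiplicative.ofAdd ((T.map_trans γ' γ).trans (add_comm _ _))

theorem PathCocycle.loopHom_loopClass {A : Type*} [AddCommGroup A] (T : PathCocycle M A)
    (γ : Path p p) : T.loopHom p (loopClass γ) = Multiplicative.ofAdd (T γ.1) := rfl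

/-- The universal path cocycle on a path connected space. -/
theorem exists_universal_pathCocycle [PathConnectedSpace M] (p : M) :
    ∃ T : PathCocycle M (Additive (Abelianization (FundamentalGroup M p))),
      ∀ γ : Path p p, T γ.1 = Additive.ofMul (Abelianization.of (loopClass γ)) := by
  let b : ∀ x, Path p x := fun x => PathConnectedSpace.somePath p x
  let c : ∀ {x y : M}, Path x y → Additive (Abelianization (FundamentalGroup M p)) :=
    fun {x y} γ => Additive.ofMul (Abelianization.of (loopClass ((b x).trans (γ.trans (b y).symm))))
  let c' : C(I, M) → Additive (Abelianization (FundamentalGroup M p)) :=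
    fun h => c (⟨h, rfl, rfl⟩ : Path (h 0) (h 1))
  have hc : ∀ {x y : M} (γ : Path x y), c' γ.1 = c γ := by
    rintro _ _ ⟨f, rfl, rfl⟩
    rfl
  refine ⟨⟨c', fun {x y} γ γ' h => ?_, fun {x y z} γ γ' => ?_⟩, fun γ => ?_⟩
  · rw [hc, hc]
    refine congrArg (fun g => Additive.ofMul (Abelianization.of g)) (loopClass_eq_iff.2 ?_)
    exact (Path.Homotopic.refl _).hcomp (h.hcomp (Path.Homotopic.refl _))
  · rw [hc, hc, hc]
    change _ = Additive.ofMul (Abelianization.of _ * Abelianization.of _)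
    -- Commutativity of the abelianization absorbs the reversed order of `loopClass_mul`.
    rw [mul_comm, ← map_mul, loopClass_mul]
    refine congrArg (fun g => Additive.ofMul (Abelianization.of g)) (loopClass_eq_iff.2 ?_)
    rw [← Path.Homotopic.Quotient.eq]
    simp only [Path.Homotopic.Quotient.mk_trans, Path.Homotopic.Quotient.trans_assoc,
      Path.Homotopic.Quotient.mk_symm, Path.Homotopic.Quotient.symm_trans_cancel]
  · change c' γ.1 = _
    rw [hc]
    refine congrArg Additive.ofMul ?_
    have : loopClass ((b p).trans (γ.trans (b p).symm)) =
        (loopClass (b p))⁻¹ * loopClass γ * loopClass (b p) := by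
      rw [loopClass_inv, loopClass_mul, loopClass_mul]
    rw [this, map_mul, map_mul, map_inv, mul_comm, mul_inv_cancel_left]

variable [PathConnectedSpace M] {G : Type u} [Group G] {e : FundamentalGroup M p ≃* G}

omit [PathConnectedSpace M] in
theorem PathCocycle.map_conj {A : Type*} [AddCommGroup A] (T : PathCocycle M A) {x y : M}
    (δ : Path x y) (γ : Path y y) : T (δ.trans (γ.trans δ.symm)).1 = T γ.1 := by
  rw [T.map_trans, T.map_trans, T.map_symm]
  abel

/-- On loops at `p` the cocycle factors through the abelianization of π₁, where conjugation by δ is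
invisible; other loops are first connected to `p`. -/
theorem IsInducedOuter.cocycle_eq {F : M ≃ₜ M} {q : OutGroup G} (h : IsInducedOuter e F q)
    (hq : outAb G q = 1) {A : Type*} [AddCommGroup A] (T : PathCocycle M A) {g : C(I, M)}
    (hg : g 0 = g 1) : T ((F : C(M, M)).comp g) = T g := by
  obtain ⟨δ, a, rfl, ha⟩ := h
  have hbase : ∀ γ : Path p p, T ((F : C(M, M)).comp γ.1) = T γ.1 := by
    intro γ
    let L := (T.loopHom p).comp e.symm.toMonoidHom
    have h1 : Abelianization.of (a (e (loopClass γ))) = Abelianization.of (e (loopClass γ)) :=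
      DFunLike.congr_fun hq (Abelianization.of (e (loopClass γ)))
    have h2 := congrArg (Abelianization.lift L) h1
    rw [Abelianization.lift_apply_of, Abelianization.lift_apply_of,
      IsInducedOuter.apply_loopClass ha] at h2
    have h3 : T.loopHom p (e.symm (e (loopClass (δ.trans ((γ.map F.continuous).trans δ.symm))))) =
      T.loopHom p (e.symm (e (loopClass γ))) := h2
    rw [e.symm_apply_apply, e.symm_apply_apply, T.loopHom_loopClass, T.loopHom_loopClass,
      T.map_conj] at h3
    exact Multiplicative.ofAdd.injective h3
  let c := PathConnectedSpace.somePath p (g 0)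
  let γ : Path (g 0) (g 0) := ⟨g, rfl, hg.symm⟩
  have h1 := hbase (c.trans (γ.trans c.symm))
  rw [T.map_conj] at h1
  have h2 := (T.comp (F : C(M, M))).map_conj c γ
  exact h2.symm.trans h1

/-- The hypothesis is applied to the universal cocycle, whose value on a loop is its class in H₁. -/
theorem IsInducedOuter.outAb_eq_one {F : M ≃ₜ M} {q : OutGroup G} (h : IsInducedOuter e F q)
    (hF : ∀ (T : PathCocycle M (Additive (Abelianization (FundamentalGroup M p))))
      (γ : Path p p), T ((F : C(M, M)).comp γ.1) = T γ.1) : outAb G q = 1 := by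
  obtain ⟨δ, a, rfl, ha⟩ := h
  obtain ⟨T, hT⟩ := exists_universal_pathCocycle p
  ext x
  induction x using QuotientGroup.induction_on with | _ x
  obtain ⟨g, rfl⟩ := e.surjective x
  obtain ⟨γ, rfl⟩ := loopClass_surjective g
  change Abelianization.of (a (e (loopClass γ))) = Abelianization.of (e (loopClass γ))
  rw [IsInducedOuter.apply_loopClass ha]
  have h1 := hT (δ.trans ((γ.map F.continuous).trans δ.symm))
  rw [T.map_conj] at h1
  have h2 : T (γ.map F.continuous).1 = T γ.1 := hF T γ
  rw [h2, hT] at h1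
  have h3 := congrArg (Abelianization.map e.toMonoidHom) (Additive.ofMul.injective h1)
  rw [Abelianization.map_of, Abelianization.map_of] at h3
  exact h3.symm

end Abelianization

/-! ## Comparison of the kernels -/

namespace IsTameEmbedding

variable {X M : Type*} [TopologicalSpace X] [TopologicalSpace M] {ι : X → M} {B : Set X}
  (h : IsTameEmbedding ι B)

include h

/-- If the extension `F` of `f` preserves the values of path cocycles on loops, then `f` preserves
the relative classes of curves, and of arcs that can be closed up in the complement of `X`. -/
theorem chainClass_comp_eq {f : C(X, X)} (hf : ∀ x ∈ B, f x = x) {F : C(M, M)}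
    (hF : ∀ x, F (ι x) = ι (f x)) (hF' : ∀ y ∉ range ι, F y = y)
    (hT : ∀ (T : PathCocycle M (SingChain X 1 ⧸ relBoundaries B)) (g : C(I, M)), g 0 = g 1 →
      T (F.comp g) = T g) {g : C(I, X)}
    (hg : g 0 = g 1 ∨ JoinedIn (ι '' Bᶜ)ᶜ (ι (g 1)) (ι (g 0))) :
    chainClass B (f.comp g) = chainClass B g := by
  obtain ⟨T, hTX, hTZ⟩ := h.exists_extension (chainCocycle B) fun a ha => chainClass_of_mem ha
  let g' : C(I, M) := ContinuousMap.comp ⟨ι, h.continuous⟩ g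
  have hFg : F.comp g' = ContinuousMap.comp ⟨ι, h.continuous⟩ (f.comp g) :=
    ContinuousMap.ext fun t => hF _
  have h1 : T g' = chainClass B g := hTX g
  have h2 : T (F.comp g') = chainClass B (f.comp g) := by rw [hFg]; exact hTX _
  rw [← h1, ← h2]
  rcases hg with hg | ⟨ζ, hζ⟩
  · exact hT T g' (congrArg ι hg)
  -- The arc is closed up by a path ζ outside the interior of `X`. Since `F` fixes ζ pointwise, its
  -- contribution cancels.
  · let γ : Path (ι (g 0)) (ι (g 1)) := ⟨g', rfl, rfl⟩
    have h3 := hT T (γ.trans ζ).1 ((γ.trans ζ).source.trans (γ.trans ζ).target.symm)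
    have h4 : T (F.comp (γ.trans ζ).1) = T (F.comp γ.1) + T (F.comp ζ.1) :=
      (T.comp F).map_trans γ ζ
    have h5 : F.comp ζ.1 = ζ.1 :=
      ContinuousMap.ext fun t => h.extension_eq_self hf hF hF' (hζ t)
    rw [h4, T.map_trans, h5] at h3
    exact add_right_cancel h3

/-- If `f` preserves the classes of simple closed curves and of properly embedded arcs between
points of a component of the complement of `X`, then its extension `F` preserves the values of path
cocycles on loops. -/
theorem cocycle_comp_eq (hX : IsTameDomain X B) {f : C(X, X)} (hf : ∀ x ∈ B, f x = x)
    {F : C(M, M)} (hF : ∀ x, F (ι x) = ι (f x)) (hF' : ∀ y ∉ range ι, F y = y)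
    (hloop : ∀ g : C(I, X), g 0 = g 1 → InjOn g {t | t ≠ 1} →
      chainClass B (f.comp g) = chainClass B g)
    (harc : ∀ g : C(I, X), Injective g → (∀ t, g t ∈ B ↔ t = 0 ∨ t = 1) →
      connectedComponentIn B (g 0) ≠ connectedComponentIn B (g 1) →
      ι (g 1) ∈ connectedComponentIn (ι '' Bᶜ)ᶜ (ι (g 0)) →
      chainClass B (f.comp g) = chainClass B g)
    {A : Type*} [AddCommGroup A] (T : PathCocycle M A) (g : C(I, M)) (hg : g 0 = g 1) :
    T (F.comp g) = T g := by
  classical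
  obtain ⟨_, _, _, hnull⟩ := hX
  let S : PathCocycle X A := T.comp ⟨ι, h.continuous⟩
  obtain ⟨v, hv⟩ := S.exists_primitive B fun a ha h01 => by
    let γ : Path (a 0) (a 0) := ⟨a, rfl, h01.symm⟩
    exact (S.map_homotopic (hnull γ ha)).trans (S.map_refl _)
  -- Subtracting a primitive on the boundary makes the cocycle vanish on `B`, so that it depends
  -- only on relative classes.
  let S' : PathCocycle X A := S.sub (.coboundary v)
  have hS' : ∀ a : C(I, X), range a ⊆ B → S' a = 0 := fun a ha => sub_eq_zero.2 (hv a ha)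
  let D : PathCocycle X A := (S'.comp f).sub S'
  have hD : ∀ a : C(I, X), chainClass B (f.comp a) = chainClass B a → D a = 0 := fun a ha =>
    sub_eq_zero.2 (S'.eq_of_chainClass_eq hS' ha)
  obtain ⟨w, hw⟩ := D.exists_primitive univ fun a _ h01 =>
    PathCocycle.loop_eq_zero_of_simple D h.hasConvexPatches_domain
      (fun a h01 ha => hD a (hloop a h01 ha)) a h01
  have hw : ∀ a, D a = w (a 1) - w (a 0) := fun a => hw a (subset_univ _)
  have hwB : ∀ c ∈ B, ∀ c' ∈ B, ι c' ∈ connectedComponentIn (ι '' Bᶜ)ᶜ (ι c) → w c = w c' := by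
    intro c hc c' hc' hcc
    suffices hs : ∃ a : C(I, X), a 0 = c ∧ a 1 = c' ∧ D a = 0 by
      obtain ⟨a, rfl, rfl, ha⟩ := hs
      rw [hw, sub_eq_zero] at ha
      exact ha.symm
    -- Within one boundary component a path in `B` is fixed by `f`. Between distinct components the
    -- hypothesis on arcs applies.
    by_cases hC : connectedComponentIn B c = connectedComponentIn B c'
    · obtain ⟨γ, hγ⟩ := h.joinedIn_boundary isPreconnected_connectedComponentIn
        (connectedComponentIn_subset B c) (mem_connectedComponentIn hc)
        (hC ▸ mem_connectedComponentIn hc')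
      refine ⟨γ.1, γ.source, γ.target, ?_⟩
      have : f.comp γ.1 = γ.1 := ContinuousMap.ext fun t => hf _ (hγ t)
      change S' (f.comp γ.1) - S' γ.1 = 0
      rw [this, sub_self]
    · obtain ⟨γ, hγ, hγB⟩ := h.exists_arc hc hc' fun h => hC (h ▸ rfl)
      refine ⟨γ.1, γ.source, γ.target, hD _ (harc γ.1 hγ hγB ?_ ?_)⟩
      · change connectedComponentIn B (γ 0) ≠ connectedComponentIn B (γ 1)
        rwa [γ.source, γ.target]
      · change ι (γ 1) ∈ connectedComponentIn (ι '' Bᶜ)ᶜ (ι (γ 0))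
        rwa [γ.source, γ.target]
  -- Undoing the correction by `v` gives a primitive of the change of `S` under `f`; on `B` it
  -- equals `w` because `f` is the identity there.
  let u : X → A := fun x => w x + v (f x) - v x
  have hu : ∀ a, S (f.comp a) - S a = u (a 1) - u (a 0) := by
    intro a
    have h1 : S (f.comp a) - (v (f (a 1)) - v (f (a 0))) - (S a - (v (a 1) - v (a 0))) =
      w (a 1) - w (a 0) := hw a
    have h2 : S (f.comp a) - S a = (S (f.comp a) - (v (f (a 1)) - v (f (a 0))) -
      (S a - (v (a 1) - v (a 0)))) + (v (f (a 1)) - v (f (a 0))) - (v (a 1) - v (a 0)) := by abel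
    rw [h2, h1]
    simp only [u]
    abel
  have huB : ∀ c ∈ B, u c = w c := fun c hc => by simp only [u, hf c hc, add_sub_cancel_right]
  let Z := (ι '' Bᶜ)ᶜ
  have hU : ∃ û : M → A, (∀ x, û (ι x) = u x) ∧ ∀ y ∈ Z, ∀ y' ∈ connectedComponentIn Z y,
      û y = û y' := by
    -- The common value of `w` on the boundary points of a component of `Z`, well defined by `hwB`.
    -- A component without boundary points gets 0, any constant being allowed.
    let k : Set M → A := fun N => if hN : ∃ c ∈ B, ι c ∈ N then w hN.choose else 0
    have hk : ∀ c ∈ B, k (connectedComponentIn Z (ι c)) = w c := by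
      intro c hc
      have hN : ∃ c' ∈ B, ι c' ∈ connectedComponentIn Z (ι c) :=
        ⟨c, hc, mem_connectedComponentIn (h.apply_mem_compl_iff.2 hc)⟩
      refine (dif_pos hN).trans ?_
      exact (hwB c hc _ hN.choose_spec.1 hN.choose_spec.2).symm
    let û : M → A := fun y => if hy : y ∈ ι '' Bᶜ then u hy.choose else k (connectedComponentIn Z y)
    have hûZ : ∀ y ∈ Z, û y = k (connectedComponentIn Z y) := fun y hy => dif_neg hy
    refine ⟨û, fun x => ?_, fun y hy y' hy' => ?_⟩
    · by_cases hx : x ∈ B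
      · rw [hûZ _ (h.apply_mem_compl_iff.2 hx), hk x hx, huB x hx]
      · have hx' : ι x ∈ ι '' Bᶜ := ⟨x, hx, rfl⟩
        refine (dif_pos hx').trans ?_
        rw [h.injective hx'.choose_spec.2]
    · rw [hûZ y hy, hûZ y' (connectedComponentIn_subset _ _ hy'), connectedComponentIn_eq hy']
  obtain ⟨û, hûι, hûZ⟩ := hU
  have key : ∀ a : C(I, M), (T.comp F).sub T a = PathCocycle.coboundary û a := by
    refine h.path_induction (fun γ γ' hγ hh => ?_) (fun γ γ' h1 h2 => ?_) (fun a => ?_)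
      (fun a ha => ?_)
    · rw [← PathCocycle.map_homotopic _ hγ, hh, PathCocycle.map_homotopic _ hγ]
    · rw [PathCocycle.map_trans, PathCocycle.map_trans, h1, h2]
    · have hFa : F.comp (ContinuousMap.comp ⟨ι, h.continuous⟩ a) =
          ContinuousMap.comp ⟨ι, h.continuous⟩ (f.comp a) := ContinuousMap.ext fun t => hF _
      have h1 : T (F.comp (ContinuousMap.comp ⟨ι, h.continuous⟩ a)) = S (f.comp a) := by rw [hFa]; rfl
      change T (F.comp _) - S a = û (ι (a 1)) - û (ι (a 0))
      rw [h1, hûι, hûι]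
      exact hu a
    · have hFa : F.comp a = a :=
        ContinuousMap.ext fun t => h.extension_eq_self hf hF hF' (ha ⟨t, rfl⟩)
      change T (F.comp a) - T a = û (a 1) - û (a 0)
      rw [hFa, sub_self, hûZ (a 0) (ha ⟨0, rfl⟩) (a 1), sub_self]
      exact (isPreconnected_range a.continuous).subset_connectedComponentIn ⟨0, rfl⟩ ha ⟨1, rfl⟩
  have hk := key g
  change T (F.comp g) - T g = û (g 1) - û (g 0) at hk
  rwa [hg, sub_self, sub_eq_zero] at hk

end IsTameEmbedding

section Kernel

variable {X : Type u} [TopologicalSpace X] [ChartedSpace (EuclideanHalfSpace 3) X]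
  {M : Type v} [TopologicalSpace M] {ι : X → M}

theorem boundary_compl_eq : (𝓡∂ 3).interior X = ((𝓡∂ 3).boundary X)ᶜ :=
  (𝓡∂ 3).compl_boundary.symm

/-- The image of a boundary component is connected, so it lies entirely in the component of the
complement that contains any one of its points. -/
theorem pAdjacent_inducedPartition_iff (h : IsTameEmbedding ι ((𝓡∂ 3).boundary X)) {c c' : X}
    (hc : c ∈ (𝓡∂ 3).boundary X) (hc' : c' ∈ (𝓡∂ 3).boundary X) :
    PAdjacent (inducedPartition ι) (connectedComponentIn ((𝓡∂ 3).boundary X) c)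
      (connectedComponentIn ((𝓡∂ 3).boundary X) c') ↔
    ι c' ∈ connectedComponentIn (ι '' ((𝓡∂ 3).boundary X)ᶜ)ᶜ (ι c) := by
  have hsub : ∀ {c : X} {y : M}, c ∈ (𝓡∂ 3).boundary X →
      ι c ∈ connectedComponentIn (ι '' ((𝓡∂ 3).boundary X)ᶜ)ᶜ y →
      ι '' connectedComponentIn ((𝓡∂ 3).boundary X) c ⊆
        connectedComponentIn (ι '' ((𝓡∂ 3).boundary X)ᶜ)ᶜ y := by
    intro c y hc hy
    rw [connectedComponentIn_eq hy]
    refine (isPreconnected_connectedComponentIn.image _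
      h.continuous.continuousOn).subset_connectedComponentIn ⟨c, mem_connectedComponentIn hc, rfl⟩ ?_
    rintro _ ⟨x, hx, rfl⟩
    exact h.apply_mem_compl_iff.2 (connectedComponentIn_subset _ _ hx)
  constructor
  · rintro ⟨_, ⟨y, hy, rfl⟩, hp⟩
    rw [boundary_compl_eq] at hp hy
    have h1 := (hp (Or.inl rfl)).2 ⟨c, mem_connectedComponentIn hc, rfl⟩
    have h2 := (hp (Or.inr rfl)).2 ⟨c', mem_connectedComponentIn hc', rfl⟩
    rwa [← connectedComponentIn_eq h1]
  · intro hcc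
    refine ⟨_, ⟨ι c, ?_, rfl⟩, ?_⟩
    · rw [boundary_compl_eq]
      exact h.apply_mem_compl_iff.2 hc
    · rw [boundary_compl_eq]
      rintro _ (rfl | rfl)
      · exact ⟨⟨c, hc, rfl⟩, hsub hc (mem_connectedComponentIn (h.apply_mem_compl_iff.2 hc))⟩
      · exact ⟨⟨c', hc', rfl⟩, hsub hc' hcc⟩

theorem eq_connectedComponentIn_of_mem {C : Set X} (hC : C ∈ boundaryComponents X) {x : X}
    (hx : x ∈ C) : x ∈ (𝓡∂ 3).boundary X ∧ C = connectedComponentIn ((𝓡∂ 3).boundary X) x := by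
  obtain ⟨c, hc, rfl⟩ := hC
  exact ⟨connectedComponentIn_subset _ _ hx, connectedComponentIn_eq hx⟩

variable [IsManifold (𝓡∂ 3) ∞ X] {o : ManifoldOrientation X} [PathConnectedSpace M] {p : M}
  {G : Type*} [Group G] {e : FundamentalGroup M p ≃* G}

/-- The two directions are `cocycle_comp_eq` and `chainClass_comp_eq`, with adjacency translated
into lying in one component of the complement. -/
theorem diffH1P_eq_id_iff_outAb_eq_one (hX : IsTameDomain X ((𝓡∂ 3).boundary X))
    (h : IsTameEmbedding ι ((𝓡∂ 3).boundary X)) {f : DiffRel o} {F : M ≃ₜ M}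
    (hF : IsExtensionById ι f F) {q : OutGroup G} (hq : IsInducedOuter e F q) :
    diffH1P (inducedPartition ι) f = LinearMap.id ↔ outAb G q = 1 := by
  have hf : ∀ x ∈ (𝓡∂ 3).boundary X, diffMap f x = x := fun x hx => diffMap_eq_self f hx
  rw [diffH1P_eq_id_iff]
  constructor
  · intro hc
    refine hq.outAb_eq_one fun T γ => ?_
    refine h.cocycle_comp_eq hX (F := (F : C(M, M))) hf hF.1 hF.2
      (fun g h01 hg => hc g (Or.inl ⟨h01, hg⟩)) (fun g hg hgB hne hcomp => hc g (Or.inr ?_)) T γ.1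
      (γ.source.trans γ.target.symm)
    have h0 := (hgB 0).2 (Or.inl rfl)
    have h1 := (hgB 1).2 (Or.inr rfl)
    exact ⟨hg, hgB, _, ⟨g 0, h0, rfl⟩, _, ⟨g 1, h1, rfl⟩, hne,
      (pAdjacent_inducedPartition_iff h h0 h1).2 hcomp, mem_connectedComponentIn h0,
      mem_connectedComponentIn h1⟩
  · intro h1 g hg
    refine h.chainClass_comp_eq (F := (F : C(M, M))) hf hF.1 hF.2
      (fun T g hg => hq.cocycle_eq h1 T hg) (hg.imp And.left ?_)
    rintro ⟨-, hgB, C, hC, C', hC', -, hadj, hg0, hg1⟩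
    obtain ⟨h0, rfl⟩ := eq_connectedComponentIn_of_mem hC hg0
    obtain ⟨h1, rfl⟩ := eq_connectedComponentIn_of_mem hC' hg1
    exact h.joinedIn_compl isPreconnected_connectedComponentIn (connectedComponentIn_subset _ _)
      ((pAdjacent_inducedPartition_iff h h0 h1).1 hadj)
      (mem_connectedComponentIn (h.apply_mem_compl_iff.2 h0))

end Kernel

theorem mainTheorem4 {n b m : ℕ}
    {X : Type u} [TopologicalSpace X] [ChartedSpace (EuclideanHalfSpace 3) X]
    [IsManifold (𝓡∂ 3) ∞ X] (hX : IsXnb n b X) (o : ManifoldOrientation X)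
    {M : Type v} [TopologicalSpace M] [ChartedSpace E3 M] [IsManifold (𝓡 3) ∞ M]
    (hM : IsSumS1S2 m M) (p : M) (e : FundamentalGroup M p ≃* FreeGroup (Fin m))
    (ι : X → M) (hι : IsSmoothEmbedding (𝓡∂ 3) (𝓡 3) ∞ ι) :
    (∃! φ : OutBdry o →* OutGroup (FreeGroup (Fin m)), IsInducedMap ι e φ) ∧
    (∃! ρ : OutBdry o →* (H1P (inducedPartition ι) ≃ₗ[ℤ] H1P (inducedPartition ι)), IsActionOnH1P _ ρ) ∧
    ∀ (φ : OutBdry o →* OutGroup (FreeGroup (Fin m)))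
      (ρ : OutBdry o →* (H1P (inducedPartition ι) ≃ₗ[ℤ] H1P (inducedPartition ι))),
      IsInducedMap ι e φ → IsActionOnH1P _ ρ → ρ.ker = (IOut m).comap φ := by
  obtain ⟨_, _, _⟩ := hM.topology
  have hXd := hX.isTameDomain
  obtain ⟨_, _, -, -⟩ := id hXd
  have hιt := IsSmoothEmbedding.isTameEmbedding hι
  have : LocallyPathConnectedSpace M := ChartedSpace.locallyPathConnectedSpace E3 M
  have : PathConnectedSpace M := pathConnectedSpace_iff_connectedSpace.2 inferInstance
  refine ⟨existsUnique_inducedHom e hιt, existsUnique_isActionOnH1P, fun φ ρ hφ hρ => ?_⟩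
  ext q
  obtain ⟨f, rfl⟩ := outClass_surjective q
  obtain ⟨F, hF, hq⟩ := hφ f
  rw [Subgroup.mem_comap, IOut, MonoidHom.mem_ker, MonoidHom.mem_ker, isActionOnH1P_iff.1 hρ,
    diffH1PHom_eq_one_iff]
  exact diffH1P_eq_id_iff_outAb_eq_one hXd hιt hF hq
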